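/- **Setting.** Let $\Omega\subset\mathbb R^d$, $d\ge 1$, be the interior of the union of the elements of a finite conforming simplicial mesh $\mathcal T_h$. Let $\Omega_1,\Omega_2\subset\Omega$ be disjoint open sets, and let $\Gamma=\Omega\setminus(\Omega_1\cup\Omega_2)$ be their common boundary in $\Omega$. Assume that both have a Lipschitz boundary near $\overline\Gamma$, and that $\Gamma$ meets the element boundaries only in a set of surface measure zero (unfitted mesh). Let $n$ be the unit normal on $\Gamma$ from $\Omega_1$ to $\Omega_2$, $T_i=T\cap\Omega_i$, $\alpha=\alpha_i>0$ on $\Omega_i$, $h>0$ the mesh size, and $k$ the polynomial degree. Write $[\![u]\!]=u|_{\Omega_1}-u|_{\Omega_2}$ and $\{\!\!\{v\}\!\!\}=\kappa_1 v|_{\Omega_1}+\kappa_2 v|_{\Omega_2}$ on $\Gamma$, with weights $\kappa_1+\kappa_2=1$ constant on each element. Let $W_h$ be the continuous piecewise polynomials of degree $\le k$ vanishing on $\partial\Omega$, $V_h=W_h|_{\Omega_1}+W_h|_{\Omega_2}$, and $V_{\rm reg}=\{u: u|_{\Omega_i}\in H^2(\Omega_i),\ i=1,2\}$. With broken gradients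 set $$a(u,v)=\sum_T\sum_i\alpha_i(\nabla u,\nabla v)_{T_i},\quad N^c(u,v)=(\{\!\!\{-\alpha\partial_n u\}\!\!\},[\![v]\!])_\Gamma,\quad N^s_1(u,v)=\tfrac1h([\![u]\!],[\![v]\!])_\Gamma ,$$ and let $a_T$, $N^c_T$ be the element contributions. Assume that the weighting is stable with a constant $c_{\rm tr}>0$: $$\alpha_i^2\kappa_i^2h\|\nabla p\|^2_{\Gamma\cap T}\le c_{\rm tr}\,\alpha_i\|\nabla p\|^2_{T_i}\qquad\text{for all polynomials } p \text{ of degree}\le k,\ T\in\mathcal T_h,\ i=1,2.$$ **Lifting.** Let $\mathcal P^k_0(T_{1,2})$ be the functions on $T_1\cup T_2$ which on each $T_i$ are polynomials of degree $\le k$ with mean zero over $T_i$. On cut elements let $\mathcal L_T(u)\in\mathcal P_0^k(T_{1,2})$ satisfy $a_T(\mathcal L_T(u),v)=N^c_T(v,u)$ for all $v\in\mathcal P^k_0(T_{1,2})$; on uncut elements let $\mathcal L_T(u)=0$. Put $\mathcal L(u)|_T=\mathcal L_T(u)$, and $$A^{nn}(u,v)=a(u,v)+N^c(u,v)+N^c(v,u)+2a(\mathcal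 L(u),\mathcal L(v)),\qquad A^*=A^{nn}+N^s_1,$$ $$\|v\|_A^2=a(v,v)+N^s_1(v,v),\qquad |||v|||^2=\|v\|_A^2+h\|\{\!\!\{\alpha\nabla v\}\!\!\}\|_\Gamma^2 .$$ **Claim.** There is a constant $C>0$ depending only on $c_{\rm tr}$ such that, in every such setting: 1. (Lifting) Functions in $H^1(\Omega_1\cup\Omega_2)$ have traces on $\Gamma$ from both sides, with jump in $L^2(\Gamma)$. For $T$ cut and $[\![u]\!]\in L^2(\Gamma\cap T)$, $\mathcal L_T(u)$ exists and is unique. For $u\in H^1(\Omega_1\cup\Omega_2)$ one has $a(\mathcal L(u),v)=N^c(v,u)$ for all $v\in V_h$, and $a(\mathcal L(u),\mathcal L(u))\le \frac Ch\|[\![u]\!]\|_\Gamma^2$. If $[\![u]\!]=0$ on $\Gamma$, then $\mathcal L(u)=0$. 2. (Well-definedness) For $u\in V_h+V_{\rm reg}$: $u\in H^1(\Omega_1\cup\Omega_2)$, the broken gradients of $u$ and $\mathcal L(u)$ are in $L^2(\Omega)$, and $\nabla u$ has traces in $L^2(\Gamma)$ from both sides. $A^*$ is a symmetric bilinear form on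 $V_h+V_{\rm reg}$. 3. (Non-negativity) $A^{nn}(u_h,u_h)\ge\frac12a(u_h,u_h)\ge0$ for all $u_h\in V_h$. 4. (Coercivity) $A^*(u_h,u_h)\ge\frac12\|u_h\|_A^2$ for all $u_h\in V_h$. 5. (Norm equivalence) $\|u_h\|_A\le|||u_h|||\le C\|u_h\|_A$ for all $u_h\in V_h$. With $\{\!\!\{\nabla u_h\}\!\!\}$ in place of $\{\!\!\{\alpha\nabla u_h\}\!\!\}$ in $|||\cdot|||$ this holds with $C(1+\min(\alpha_1,\alpha_2)^{-1})$ instead of $C$. 6. (Continuity) $|A^*(u,v)|\le C\,|||u|||\,|||v|||$ for all $u,v\in V_h+V_{\rm reg}$. 7. (Consistency) Let $u\in V_{\rm reg}$ solve $-\alpha_i\Delta u=f$ in $\Omega_i$, $u=0$ on $\partial\Omega$, $[\![u]\!]=0$ and $[\![-\alpha\partial_nu]\!]=0$ on $\Gamma$. Then $A^*(u,v_h)=(f,v_h)_\Omega$ for all $v_h\in V_h$. If $u_h\in V_h$ satisfies $A^*(u_h,v_h)=(f,v_h)_\Omega$ for all $v_h\in V_h$, then $A^*(u-u_h,v_h)=0$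 for all $v_h\in V_h$. -/

import Mathlib

open MeasureTheory Set Filter Topology
open scoped ContDiff

noncomputable section

namespace UnfittedNitsche

/-- Euclidean space of dimension `m`. -/
abbrev Sp (m : ℕ) := EuclideanSpace ℝ (Fin m)

/-! ### Weak derivatives, Sobolev spaces, traces, normals -/

/-- `G` is the weak gradient of `u` on the open set `U`. -/
def HasWeakGrad {m : ℕ} (U : Set (Sp m)) (u : Sp m → ℝ) (G : Sp m → Sp m) : Prop :=
  LocallyIntegrableOn u U ∧ LocallyIntegrableOn G U ∧
    ∀ φ : Sp m → ℝ, ContDiff ℝ ∞ φ → HasCompactSupport φ → tsupport φ ⊆ U →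
      ∀ v : Sp m, ∫ x in U, u x * fderiv ℝ φ x v = -∫ x in U, φ x * inner ℝ (G x) v

open Classical in
/-- The weak gradient of `u` on `U` (unique almost everywhere on `U` when it exists). -/
def weakGrad {m : ℕ} (U : Set (Sp m)) (u : Sp m → ℝ) : Sp m → Sp m :=
  if h : ∃ G, HasWeakGrad U u G then h.choose else 0

/-- `u ∈ H¹(U)`. -/
def MemH1 {m : ℕ} (U : Set (Sp m)) (u : Sp m → ℝ) : Prop :=
  MemLp u 2 (volume.restrict U) ∧
    ∃ G, HasWeakGrad U u G ∧ MemLp G 2 (volume.restrict U)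

/-- `u ∈ H²(U)`: `u ∈ H¹(U)` and all first weak derivatives are in `H¹(U)`. -/
def MemH2 {m : ℕ} (U : Set (Sp m)) (u : Sp m → ℝ) : Prop :=
  MemH1 U u ∧ ∀ j : Fin m, MemH1 U (fun x => weakGrad U u x j)

/-- The weak Laplacian `Σ_j ∂_j ∂_j u` on `U`. -/
def weakLaplacian {m : ℕ} (U : Set (Sp m)) (u : Sp m → ℝ) (x : Sp m) : ℝ :=
  ∑ j : Fin m, weakGrad U (fun y => weakGrad U u y j) x j

/-- `g` is the trace of `u` at `x` from the side of `U`: the limit of the averages of `u` over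
`B_r(x) ∩ U` as `r → 0`. -/
def HasTrace {m : ℕ} {F : Type*} [NormedAddCommGroup F] [NormedSpace ℝ F]
    (U : Set (Sp m)) (u : Sp m → F) (x : Sp m) (g : F) : Prop :=
  Tendsto (fun r : ℝ => ⨍ y in Metric.ball x r ∩ U, u y) (𝓝[>] 0) (𝓝 g)

/-- The trace of `u` at `x` from the side of `U`. -/
def trace {m : ℕ} {F : Type*} [NormedAddCommGroup F] [NormedSpace ℝ F]
    (U : Set (Sp m)) (u : Sp m → F) (x : Sp m) : F :=
  limUnder (𝓝[>] (0 : ℝ)) (fun r : ℝ => ⨍ y in Metric.ball x r ∩ U, u y)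

/-- Near `x`, in suitable Cartesian coordinates `(x', t)`, the set `U` is the region
`{ψ(x') < t}` above the graph of a Lipschitz function `ψ`. -/
def IsLipschitzAt {n : ℕ} (U : Set (Sp (n + 1))) (x : Sp (n + 1)) : Prop :=
  ∃ (e : Sp (n + 1) ≃ₗᵢ[ℝ] WithLp 2 (Sp n × ℝ)) (ψ : Sp n → ℝ) (K : NNReal),
    LipschitzWith K ψ ∧ ∀ᶠ y in 𝓝 x, (y ∈ U ↔ ψ (e y).fst < (e y).snd)

/-- `ν` is the unit normal to the boundary of `U` at `x`, pointing out of `U`: inside every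
open cone around `-ν` (resp. `ν`) with apex `x`, points close to `x` are in (resp. not in) `U`. -/
def IsOuterNormal {m : ℕ} (U : Set (Sp m)) (x ν : Sp m) : Prop :=
  ‖ν‖ = 1 ∧ ∀ ε > 0, ∀ᶠ y in 𝓝 x,
    (inner ℝ (y - x) ν < -ε * ‖y - x‖ → y ∈ U) ∧ (ε * ‖y - x‖ < inner ℝ (y - x) ν → y ∉ U)

open Classical in
/-- The outer unit normal of `U` at a boundary point. -/
def outerNormal {m : ℕ} (U : Set (Sp m)) (x : Sp m) : Sp m :=
  if h : ∃ ν, IsOuterNormal U x ν then h.choose else 0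

/-- `u` agrees on `S` with a polynomial of total degree at most `k`. -/
def IsPolyOn {m : ℕ} (k : ℕ) (S : Set (Sp m)) (u : Sp m → ℝ) : Prop :=
  ∃ p : MvPolynomial (Fin m) ℝ, p.totalDegree ≤ k ∧
    ∀ x ∈ S, u x = MvPolynomial.eval (fun j => x j) p

/-! ### The unfitted interface problem -/

/-- The data of an unfitted interface problem in dimension `n + 1`: a finite, pure simplicial
mesh, whose union has the interior `Ω`; open sets `Ω₁ = sub 0` and `Ω₂ = sub 1` with diffusion
coefficients `α₁, α₂ > 0`; elementwise averaging weights `κ₁ + κ₂ = 1`; a mesh size `h > 0`. -/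
structure InterfaceProblem (n : ℕ) where
  mesh : Geometry.SimplicialComplex ℝ (Sp (n + 1))
  finite_mesh : mesh.faces.Finite
  pure_mesh : ∀ s ∈ mesh.faces, ∃ t ∈ mesh.faces, s ⊆ t ∧ t.card = n + 2
  sub : Fin 2 → Set (Sp (n + 1))
  isOpen_sub : ∀ i, IsOpen (sub i)
  sub_subset : ∀ i, sub i ⊆ interior mesh.space
  disjoint_sub : Disjoint (sub 0) (sub 1)
  /-- The interface `Γ = Ω \ (Ω₁ ∪ Ω₂)` is the common boundary of both sub-domains in `Ω`. -/
  interface_subset : ∀ i, interior mesh.space \ (sub 0 ∪ sub 1) ⊆ frontier (sub i)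
  /-- Both sub-domains have a Lipschitz boundary around the closure of the interface. -/
  lipschitz_interface : ∀ x ∈ closure (interior mesh.space \ (sub 0 ∪ sub 1)),
    ∀ i, IsLipschitzAt (sub i) x
  /-- The mesh is not aligned with `Γ`: `Γ` meets the element boundaries in a set of surface
  measure zero. -/
  unfitted : ∀ s ∈ mesh.faces, s.card = n + 2 →
    (μHE[n] : Measure (Sp (n + 1)))
      ((interior mesh.space \ (sub 0 ∪ sub 1)) ∩ frontier (convexHull ℝ (s : Set (Sp (n + 1))))) = 0
  alpha : Fin 2 → ℝ
  alpha_pos : ∀ i, 0 < alpha i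
  kappa : Finset (Sp (n + 1)) → Fin 2 → ℝ
  kappa_sum : ∀ s ∈ mesh.faces, s.card = n + 2 → kappa s 0 + kappa s 1 = 1
  h : ℝ
  h_pos : 0 < h

namespace InterfaceProblem

variable {n : ℕ} (P : InterfaceProblem n)

/-- The domain `Ω`. -/
def Om : Set (Sp (n + 1)) := interior P.mesh.space

/-- The interface `Γ`. -/
def Gam : Set (Sp (n + 1)) := P.Om \ (P.sub 0 ∪ P.sub 1)

/-- The surface measure on the interface `Γ`. -/
def surf : Measure (Sp (n + 1)) := (μHE[n] : Measure (Sp (n + 1))).restrict P.Gam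

/-- The elements `T` of the mesh, given by their vertices. -/
def elements : Finset (Finset (Sp (n + 1))) :=
  P.finite_mesh.toFinset.filter (fun s => s.card = n + 2)

/-- The open simplex with the given vertices. -/
def openElt (T : Finset (Sp (n + 1))) : Set (Sp (n + 1)) :=
  interior (convexHull ℝ (T : Set (Sp (n + 1))))

/-- The sub-element `T_i = T ∩ Ω_i`. -/
def part (T : Finset (Sp (n + 1))) (i : Fin 2) : Set (Sp (n + 1)) := openElt T ∩ P.sub i

/-- `T` is cut by the interface. -/
def IsCut (T : Finset (Sp (n + 1))) : Prop := (openElt T ∩ P.Gam).Nonempty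

/-- The unit normal on `Γ` pointing from `Ω₁` into `Ω₂`. -/
def normal (x : Sp (n + 1)) : Sp (n + 1) := outerNormal (P.sub 0) x

/-- The broken gradient: the weak gradient on the union of all sub-elements `T_i`. -/
def grad (u : Sp (n + 1) → ℝ) : Sp (n + 1) → Sp (n + 1) :=
  weakGrad (⋃ T ∈ P.elements, ⋃ i, P.part T i) u

/-- The jump `⟦u⟧ = u|_{Ω₁} - u|_{Ω₂}` on `Γ`. -/
def jump (u : Sp (n + 1) → ℝ) (x : Sp (n + 1)) : ℝ :=
  trace (P.sub 0) u x - trace (P.sub 1) u x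

/-- The weighted average `{β ∇u} = κ₁ β₁ ∇u|_{Ω₁} + κ₂ β₂ ∇u|_{Ω₂}` on `Γ ∩ T`, for a
coefficient `β` that is constant on each sub-domain. -/
def avgGrad (β : Fin 2 → ℝ) (T : Finset (Sp (n + 1))) (u : Sp (n + 1) → ℝ) (x : Sp (n + 1)) :
    Sp (n + 1) :=
  ∑ i, (P.kappa T i * β i) • trace (P.sub i) (P.grad u) x

/-! ### Function spaces -/

/-- `u ∈ H¹(Ω₁ ∪ Ω₂)`. -/
def MemH1Sub (u : Sp (n + 1) → ℝ) : Prop := ∀ i, MemH1 (P.sub i) u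

/-- `u ∈ V_reg`: the restriction of `u` to `Ω_i` is in `H²(Ω_i)`, `i = 1, 2`. -/
def MemVreg (u : Sp (n + 1) → ℝ) : Prop := ∀ i, MemH2 (P.sub i) u

/-- `w ∈ W_h`: continuous piecewise polynomials of degree at most `k`, zero on `∂Ω`. -/
def MemW (k : ℕ) (w : Sp (n + 1) → ℝ) : Prop :=
  ContinuousOn w P.mesh.space ∧
    (∀ T ∈ P.elements, IsPolyOn k (convexHull ℝ (T : Set (Sp (n + 1)))) w) ∧
    ∀ x ∈ frontier P.Om, w x = 0

/-- `v ∈ V_h = W_h|_{Ω₁} + W_h|_{Ω₂}`. -/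
def MemVh (k : ℕ) (v : Sp (n + 1) → ℝ) : Prop :=
  ∀ i, ∃ w, P.MemW k w ∧ ∀ x ∈ P.sub i, v x = w x

/-- `u ∈ V_h + V_reg`. -/
def MemSum (k : ℕ) (u : Sp (n + 1) → ℝ) : Prop :=
  ∃ v w, P.MemVh k v ∧ P.MemVreg w ∧ u = v + w

/-! ### Bilinear forms -/

/-- `a_T(u, v) = Σ_i α_i (∇u, ∇v)_{T_i}`. -/
def aT (T : Finset (Sp (n + 1))) (u v : Sp (n + 1) → ℝ) : ℝ :=
  ∑ i, P.alpha i * ∫ x in P.part T i, inner ℝ (P.grad u x) (P.grad v x)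

/-- `a(u, v) = Σ_T a_T(u, v)`. -/
def a (u v : Sp (n + 1) → ℝ) : ℝ := ∑ T ∈ P.elements, P.aT T u v

/-- `N^c_T(u, v) = ({-α ∂_n u}, ⟦v⟧)_{Γ ∩ T}`. -/
def NcT (T : Finset (Sp (n + 1))) (u v : Sp (n + 1) → ℝ) : ℝ :=
  ∫ x in openElt T, -inner ℝ (P.avgGrad P.alpha T u x) (P.normal x) * P.jump v x ∂P.surf

/-- `N^c(u, v) = Σ_T N^c_T(u, v)`. -/
def Nc (u v : Sp (n + 1) → ℝ) : ℝ := ∑ T ∈ P.elements, P.NcT T u v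

/-- The penalty form with `λ = 1`: `N^s_1(u, v) = h⁻¹ (⟦u⟧, ⟦v⟧)_Γ`. -/
def Ns1 (u v : Sp (n + 1) → ℝ) : ℝ := P.h⁻¹ * ∫ x, P.jump u x * P.jump v x ∂P.surf

/-! ### The lifting -/

/-- `v` belongs to the space of functions on `T₁ ∪ T₂` that are on each `T_i` a polynomial of
degree at most `k` orthogonal to constants on `T_i`; functions on `T₁ ∪ T₂` are extended by zero. -/
def MemP0 (k : ℕ) (T : Finset (Sp (n + 1))) (v : Sp (n + 1) → ℝ) : Prop :=
  (∀ i, IsPolyOn k (P.part T i) v ∧ ∫ x in P.part T i, v x = 0) ∧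
    ∀ x, (∀ i, x ∉ P.part T i) → v x = 0

/-- `w = 𝓛_T(u)` on a cut element. -/
def IsLocalLift (k : ℕ) (T : Finset (Sp (n + 1))) (u w : Sp (n + 1) → ℝ) : Prop :=
  P.MemP0 k T w ∧ ∀ v, P.MemP0 k T v → P.aT T w v = P.NcT T v u

open Classical in
/-- The local lifting `𝓛_T(u)`, which is zero on uncut elements. -/
def localLift (k : ℕ) (T : Finset (Sp (n + 1))) (u : Sp (n + 1) → ℝ) : Sp (n + 1) → ℝ :=
  if h : P.IsCut T ∧ ∃ w, P.IsLocalLift k T u w then h.2.choose else 0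

/-- The global lifting `𝓛(u)`, with `𝓛(u)|_T = 𝓛_T(u)`. -/
def lift (k : ℕ) (u : Sp (n + 1) → ℝ) : Sp (n + 1) → ℝ :=
  ∑ T ∈ P.elements, P.localLift k T u

/-- `A^{nn}(u, v) = a(u, v) + N^c(u, v) + N^c(v, u) + 2 a(𝓛(u), 𝓛(v))`. -/
def Ann (k : ℕ) (u v : Sp (n + 1) → ℝ) : ℝ :=
  P.a u v + P.Nc u v + P.Nc v u + 2 * P.a (P.lift k u) (P.lift k v)

/-- `A^*(u, v) = A^{nn}(u, v) + N^s_1(u, v)`. -/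
def Astar (k : ℕ) (u v : Sp (n + 1) → ℝ) : ℝ := P.Ann k u v + P.Ns1 u v

/-! ### Norms -/

/-- The norm `(a(u, u) + N^s_1(u, u))^{1/2}`. -/
def normA (u : Sp (n + 1) → ℝ) : ℝ := √(P.a u u + P.Ns1 u u)

/-- The norm `(‖u‖_A² + h ‖{β ∇u}‖_Γ²)^{1/2}`. -/
def strongNorm (β : Fin 2 → ℝ) (u : Sp (n + 1) → ℝ) : ℝ :=
  √(P.normA u ^ 2 + P.h * ∑ T ∈ P.elements, ∫ x in openElt T, ‖P.avgGrad β T u x‖ ^ 2 ∂P.surf)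

/-! ### The stable weighting and the original problem -/

/-- The weighting is stable with constant `c`:
`α_i² κ_i² h ‖∇p‖²_{Γ ∩ T} ≤ c α_i ‖∇p‖²_{T_i}` for all polynomials `p` of degree at most `k`. -/
def StableWeighting (k : ℕ) (c : ℝ) : Prop :=
  ∀ T ∈ P.elements, ∀ i, ∀ p : MvPolynomial (Fin (n + 1)) ℝ, p.totalDegree ≤ k →
    P.alpha i ^ 2 * P.kappa T i ^ 2 * P.h *
        ∫ x in openElt T,
          ‖gradient (fun y : Sp (n + 1) => MvPolynomial.eval (fun j => y j) p) x‖ ^ 2 ∂P.surf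
      ≤ c * P.alpha i *
        ∫ x in P.part T i,
          ‖gradient (fun y : Sp (n + 1) => MvPolynomial.eval (fun j => y j) p) x‖ ^ 2

/-- `u ∈ V_reg` solves the interface problem `-α_i Δu = f` in `Ω_i`, `u = 0` on `∂Ω`,
`⟦u⟧ = 0` and `⟦-α ∂_n u⟧ = 0` on `Γ`. -/
structure IsSolution (f u : Sp (n + 1) → ℝ) : Prop where
  memVreg : P.MemVreg u
  pde : ∀ i, ∀ᵐ x ∂(volume.restrict (P.sub i)), -P.alpha i * weakLaplacian (P.sub i) u x = f x
  boundary : ∀ᵐ x ∂((μHE[n] : Measure (Sp (n + 1))).restrict (frontier P.Om)),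
    HasTrace P.Om u x 0
  jump_zero : ∀ᵐ x ∂P.surf, P.jump u x = 0
  flux_zero : ∀ᵐ x ∂P.surf,
    -P.alpha 0 * inner ℝ (trace (P.sub 0) (P.grad u) x) (P.normal x)
      - -P.alpha 1 * inner ℝ (trace (P.sub 1) (P.grad u) x) (P.normal x) = 0

end InterfaceProblem

end UnfittedNitsche

end

open UnfittedNitsche

/-!
The algebraic core is short. The lifting is the Riesz representation of `N^c(·, u)` with respect to
the energy form on broken polynomials (`existsUnique_isLocalLift`, `a_lift`), so for `u ∈ V_h`
`A^{nn}(u, u) = a(u, u) + 2 a(𝓛(u), u) + 2 a(𝓛(u), 𝓛(u))`, which is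
`a(u, u) / 2 + a(u + 2 𝓛(u), u + 2 𝓛(u)) / 2` (`half_a_le_Ann`). Non-negativity and coercivity
follow without any condition on the size of the stabilization. The stability of the weighting enters
through the discrete trace inequality `h ‖{α ∇v}‖²_Γ ≤ 2 c a(v, v)` for broken polynomials
(`StableWeighting.avg_le`). It gives the norm equivalence and the bound
`a(𝓛(u), 𝓛(u)) ≤ 2 c h⁻¹ ‖⟦u⟧‖²_Γ` (`a_lift_self_le`); continuity is then the Cauchy–Schwarz
inequality, term by term (`abs_Astar_le`). For the solution of the interface problem the jump terms
vanish, and Green's formula (`MemVreg.green`) together with the continuity of the flux gives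
consistency (`IsSolution.Astar_eq`).

The analytical part is the theory of traces on a Lipschitz interface, where the trace is a limit of
averages over half balls and the surface measure is the Hausdorff measure.

* In coordinates in which the boundary is a graph, a Sobolev function is on almost every vertical
  line the integral of its vertical derivative. The initial values on the graph are square
  integrable (`exists_isLineTrace`), and by Lebesgue's differentiation theorem they are limits of
  averages over half balls (`IsLineTrace.hasTrace`).
* The Hausdorff measure on the graph is computed by the area formula (`comap_gr`,
  `restrict_range_gr`): by Rademacher's theorem the graph is, up to a null set, a countable union of
  pieces that are almost isometric to pieces of graphs of linear functions.
* Integration by parts above the graph (`IsLineTrace.integral_by_parts`) is obtained from test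
  functions that are cut off in a thin layer along the graph. Finitely many charts cover the
  interface, and a Lipschitz partition of the test function gives the formula on a sub-domain
  (`InterfaceProblem.integral_by_parts`). Only Lipschitz test functions that vanish outside of `Ω`
  are needed, because the functions in `V_h` are of this kind on each sub-domain; nothing has to be
  known about `∂Ω`.
-/

noncomputable section

namespace UnfittedNitsche

/-! ### Calculus of weak gradients -/

section WeakGrad

variable {m : ℕ} {U V : Set (Sp m)} {u v : Sp m → ℝ} {G H : Sp m → Sp m}

theorem integrable_smul_of_locallyIntegrableOn {F : Type*} [NormedAddCommGroup F]
    [NormedSpace ℝ F] {f : Sp m → F} (hf : LocallyIntegrableOn f U) {φ : Sp m → ℝ}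
    (hφ : Continuous φ) (hc : HasCompactSupport φ) (hs : tsupport φ ⊆ U) :
    Integrable (fun x => φ x • f x) := by
  have h1 : IntegrableOn f (tsupport φ) := hf.integrableOn_compact_subset hs hc
  have h2 : IntegrableOn (fun x => φ x • f x) (tsupport φ) :=
    h1.continuousOn_smul hφ.continuousOn hc
  refine (integrableOn_iff_integrable_of_support_subset ?_).1 h2
  intro x hx
  apply subset_tsupport φ
  intro h0
  simp [h0] at hx

theorem setIntegral_eq_integral_of_test {F : Type*} [NormedAddCommGroup F]
    [NormedSpace ℝ F] {f : Sp m → F} {φ : Sp m → ℝ} (hs : tsupport φ ⊆ U) :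
    ∫ x in U, φ x • f x = ∫ x, φ x • f x := by
  apply setIntegral_eq_integral_of_forall_compl_eq_zero
  intro x hx
  rw [image_eq_zero_of_notMem_tsupport (fun h => hx (hs h)), zero_smul]

theorem continuous_fderiv_apply_of_test {φ : Sp m → ℝ} (hφ : ContDiff ℝ ∞ φ) (e : Sp m) :
    Continuous (fun x => fderiv ℝ φ x e) :=
  (hφ.continuous_fderiv (by simp)).clm_apply continuous_const

theorem HasWeakGrad.mono (h : HasWeakGrad U u G) (hVU : V ⊆ U) : HasWeakGrad V u G := by
  refine ⟨h.1.mono_set hVU, h.2.1.mono_set hVU, fun φ hφ hc hs e => ?_⟩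
  have key := h.2.2 φ hφ hc (hs.trans hVU) e
  have hs' := (tsupport_fderiv_apply_subset ℝ (f := φ) e).trans hs
  have e1 := setIntegral_eq_integral_of_test (f := u) (U := U) (hs'.trans hVU)
  have e2 := setIntegral_eq_integral_of_test (f := u) hs'
  have e3 := setIntegral_eq_integral_of_test (f := fun x => (inner ℝ (G x) e : ℝ)) (U := U) (hs.trans hVU)
  have e4 := setIntegral_eq_integral_of_test (f := fun x => (inner ℝ (G x) e : ℝ)) hs
  simp only [smul_eq_mul] at e1 e2 e3 e4
  simp only [mul_comm (u _)] at key ⊢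
  rw [e2, e4, ← e1, ← e3, key]

theorem HasWeakGrad.congr (h : HasWeakGrad U u G) (huv : ∀ᵐ x ∂volume.restrict U, u x = v x)
    (hGH : ∀ᵐ x ∂volume.restrict U, G x = H x) : HasWeakGrad U v H := by
  refine ⟨h.1.congr huv, h.2.1.congr hGH, fun φ hφ hc hs e => ?_⟩
  have key := h.2.2 φ hφ hc hs e
  rw [integral_congr_ae (g := fun x => u x * fderiv ℝ φ x e), key, integral_congr_ae]
  · filter_upwards [hGH] with x hx
    rw [hx]
  · filter_upwards [huv] with x hx
    rw [hx]

theorem HasWeakGrad.ae_unique (hU : IsOpen U) (h : HasWeakGrad U u G) (h' : HasWeakGrad U u H) :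
    ∀ᵐ x ∂volume.restrict U, G x = H x := by
  have h1 : ∀ᵐ x, x ∈ U → G x - H x = 0 := by
    refine hU.ae_eq_zero_of_integral_contDiff_smul_eq_zero (h.2.1.sub h'.2.1) ?_
    intro φ hφ hc hs
    refine ext_inner_right ℝ fun e => ?_
    have iG := integrable_smul_of_locallyIntegrableOn h.2.1 hφ.continuous hc hs
    have iH := integrable_smul_of_locallyIntegrableOn h'.2.1 hφ.continuous hc hs
    have key := (h.2.2 φ hφ hc hs e).symm.trans (h'.2.2 φ hφ hc hs e)
    have e3 := setIntegral_eq_integral_of_test (f := fun x => (inner ℝ (G x) e : ℝ)) hs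
    have e4 := setIntegral_eq_integral_of_test (f := fun x => (inner ℝ (H x) e : ℝ)) hs
    simp only [smul_eq_mul] at e3 e4
    rw [e3, e4, neg_inj] at key
    have s1 : ∀ F : Sp m → Sp m, Integrable (fun x => φ x • F x) →
        inner ℝ (∫ x, φ x • F x) e = ∫ x, φ x * inner ℝ (F x) e := by
      intro F hF
      rw [real_inner_comm, ← integral_inner hF]
      simp [inner_smul_right, real_inner_comm]
    simp only [smul_sub]
    rw [integral_sub iG iH, inner_sub_left, s1 G iG, s1 H iH, key]
    simp
  rw [ae_restrict_iff' hU.measurableSet]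
  filter_upwards [h1] with x hx hxU
  exact sub_eq_zero.1 (hx hxU)

theorem HasWeakGrad.add (h : HasWeakGrad U u G) (h' : HasWeakGrad U v H) :
    HasWeakGrad U (u + v) (G + H) := by
  refine ⟨h.1.add h'.1, h.2.1.add h'.2.1, fun φ hφ hc hs e => ?_⟩
  have k1 := h.2.2 φ hφ hc hs e
  have k2 := h'.2.2 φ hφ hc hs e
  have hs' := (tsupport_fderiv_apply_subset ℝ (f := φ) e).trans hs
  have hc' : HasCompactSupport (fun x => fderiv ℝ φ x e) :=
    hc.mono' ((subset_tsupport _).trans (tsupport_fderiv_apply_subset ℝ (f := φ) e))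
  have c' := continuous_fderiv_apply_of_test hφ e
  have i1 : IntegrableOn (fun x => u x * fderiv ℝ φ x e) U := by
    simpa [mul_comm] using (integrable_smul_of_locallyIntegrableOn h.1 c' hc' hs').integrableOn
  have i2 : IntegrableOn (fun x => v x * fderiv ℝ φ x e) U := by
    simpa [mul_comm] using (integrable_smul_of_locallyIntegrableOn h'.1 c' hc' hs').integrableOn
  have i3 : ∀ F : Sp m → Sp m, LocallyIntegrableOn F U →
      IntegrableOn (fun x => φ x * inner ℝ (F x) e) U := by
    intro F hF
    have := (integrable_smul_of_locallyIntegrableOn hF hφ.continuous hc hs).inner_const (𝕜 := ℝ) e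
    simpa [inner_smul_left] using this.integrableOn (s := U)
  simp only [Pi.add_apply, add_mul, inner_add_left, mul_add]
  rw [integral_add i1 i2, integral_add (i3 G h.2.1) (i3 H h'.2.1), k1, k2]
  ring

theorem HasWeakGrad.smul (h : HasWeakGrad U u G) (r : ℝ) : HasWeakGrad U (r • u) (r • G) := by
  refine ⟨h.1.smul r, h.2.1.smul r, fun φ hφ hc hs e => ?_⟩
  have k1 := h.2.2 φ hφ hc hs e
  simp only [Pi.smul_apply, smul_eq_mul, inner_smul_left, mul_assoc, RCLike.conj_to_real,
    mul_left_comm _ r]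
  rw [integral_const_mul, integral_const_mul, k1]
  ring

theorem hasWeakGrad_weakGrad (h : HasWeakGrad U u G) : HasWeakGrad U u (weakGrad U u) := by
  have hex : ∃ G, HasWeakGrad U u G := ⟨G, h⟩
  rw [weakGrad, dif_pos hex]
  exact hex.choose_spec

theorem HasWeakGrad.weakGrad_ae_eq (hU : IsOpen U) (h : HasWeakGrad U u G) :
    ∀ᵐ x ∂volume.restrict U, weakGrad U u x = G x :=
  (hasWeakGrad_weakGrad h).ae_unique hU h

open Classical in
/-- Weak differentiability is checked separately on the members of a finite disjoint family of
open sets: a test function supported in the union splits into test functions supported in the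
members. -/
theorem HasWeakGrad.iUnion {ι : Type*} [Fintype ι] {W : ι → Set (Sp m)}
    (hW : ∀ i, IsOpen (W i)) (hd : Pairwise fun i j => Disjoint (W i) (W j))
    (h : ∀ i, HasWeakGrad (W i) u G) : HasWeakGrad (⋃ i, W i) u G := by
  have hloc : ∀ {F : Type} [NormedAddCommGroup F] (f : Sp m → F),
      (∀ i, LocallyIntegrableOn f (W i)) → LocallyIntegrableOn f (⋃ i, W i) := by
    intro F _ f hf x hx
    obtain ⟨i, hi⟩ := mem_iUnion.1 hx
    have := hf i x hi
    rw [(hW i).nhdsWithin_eq hi] at this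
    exact this.filter_mono nhdsWithin_le_nhds
  refine ⟨hloc _ fun i => (h i).1, hloc _ fun i => (h i).2.1, fun φ hφ hc hs e => ?_⟩
  have hloc_i : LocallyIntegrableOn u (⋃ i, W i) := hloc _ fun i => (h i).1
  have hloc_G : LocallyIntegrableOn G (⋃ i, W i) := hloc _ fun i => (h i).2.1
  have hs' := (tsupport_fderiv_apply_subset ℝ (f := φ) e).trans hs
  have hc' : HasCompactSupport (fun x => fderiv ℝ φ x e) :=
    hc.mono' ((subset_tsupport _).trans (tsupport_fderiv_apply_subset ℝ (f := φ) e))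
  have c' := continuous_fderiv_apply_of_test hφ e
  have i1 : Integrable (fun x => u x * fderiv ℝ φ x e) := by
    simpa [mul_comm] using (integrable_smul_of_locallyIntegrableOn hloc_i c' hc' hs')
  have i2 : Integrable (fun x => φ x * inner ℝ (G x) e) := by
    have := (integrable_smul_of_locallyIntegrableOn hloc_G hφ.continuous hc hs).inner_const
      (𝕜 := ℝ) e
    simpa [inner_smul_left] using this
  rw [integral_iUnion (fun i => (hW i).measurableSet) hd i1.integrableOn,
    integral_iUnion (fun i => (hW i).measurableSet) hd i2.integrableOn, tsum_fintype, tsum_fintype,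
    ← Finset.sum_neg_distrib]
  refine Finset.sum_congr rfl fun i _ => ?_
  -- the part of the test function that lives on `W i`
  set ψ : Sp m → ℝ := (W i).indicator φ with hψ
  have near_in : ∀ x ∈ W i, ψ =ᶠ[𝓝 x] φ := fun x hx => by
    filter_upwards [(hW i).mem_nhds hx] with y hy
    exact indicator_of_mem hy φ
  have near_out : ∀ x ∉ W i, ψ =ᶠ[𝓝 x] 0 := fun x hx => by
    by_cases hxs : x ∈ tsupport φ
    · obtain ⟨j, hj⟩ := mem_iUnion.1 (hs hxs)
      have hij : j ≠ i := by rintro rfl; exact hx hj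
      filter_upwards [(hW j).mem_nhds hj] with y hy
      exact indicator_of_notMem (fun hyi => disjoint_left.1 (hd hij) hy hyi) φ
    · filter_upwards [notMem_tsupport_iff_eventuallyEq.1 hxs] with y hy
      simp [hψ, indicator_apply, hy]
  have ψs : ContDiff ℝ ∞ ψ := by
    rw [contDiff_iff_contDiffAt]
    intro x
    by_cases hx : x ∈ W i
    · exact hφ.contDiffAt.congr_of_eventuallyEq (near_in x hx)
    · exact contDiffAt_const.congr_of_eventuallyEq (near_out x hx)
  have ψt : tsupport ψ ⊆ W i := by
    intro x hx
    by_contra hxi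
    exact (notMem_tsupport_iff_eventuallyEq.2 (near_out x hxi)) hx
  have ψc : HasCompactSupport ψ := by
    refine hc.mono ?_
    intro x hx h0
    apply hx
    simp [hψ, indicator_apply, h0]
  have key := (h i).2.2 ψ ψs ψc ψt e
  rw [setIntegral_congr_fun (hW i).measurableSet (g := fun x => u x * fderiv ℝ ψ x e), key,
    setIntegral_congr_fun (hW i).measurableSet]
  · intro x hx
    simp [hψ, indicator_of_mem hx]
  · intro x hx
    simp only
    rw [(near_in x hx).fderiv_eq]

theorem hasWeakGrad_of_contDiff {f : Sp m → ℝ} (hf : ContDiff ℝ 1 f) (U : Set (Sp m)) :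
    HasWeakGrad U f (gradient f) := by
  have gc : Continuous (gradient f) := by
    unfold gradient
    exact (LinearIsometryEquiv.continuous _).comp (hf.continuous_fderiv (by simp))
  refine ⟨hf.continuous.locallyIntegrable.locallyIntegrableOn U,
    gc.locallyIntegrable.locallyIntegrableOn U, fun φ hφ hc hs e => ?_⟩
  have hs' := (tsupport_fderiv_apply_subset ℝ (f := φ) e).trans hs
  have hc' : HasCompactSupport (fun x => fderiv ℝ φ x e) :=
    hc.mono' ((subset_tsupport _).trans (tsupport_fderiv_apply_subset ℝ (f := φ) e))
  have c' := continuous_fderiv_apply_of_test hφ e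
  have dc : Continuous (fun x => fderiv ℝ f x e) :=
    (hf.continuous_fderiv (by simp)).clm_apply continuous_const
  have e1 := setIntegral_eq_integral_of_test (f := f) hs'
  have e2 := setIntegral_eq_integral_of_test (f := fun x => (inner ℝ (gradient f x) e : ℝ)) hs
  simp only [smul_eq_mul] at e1 e2
  simp only [mul_comm (f _)]
  rw [e1, e2]
  simp only [mul_comm _ (f _)]
  rw [integral_mul_fderiv_eq_neg_fderiv_mul_of_integrable]
  · congr 2
    ext x
    rw [gradient, InnerProductSpace.toDual_symm_apply, mul_comm]
  · exact (dc.mul hφ.continuous).integrable_of_hasCompactSupport hc.mul_left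
  · exact (hf.continuous.mul c').integrable_of_hasCompactSupport hc'.mul_left
  · exact (hf.continuous.mul hφ.continuous).integrable_of_hasCompactSupport hc.mul_left
  · exact fun x _ => hf.differentiable (by simp) x
  · exact fun x _ => hφ.differentiable (by simp) x

/-- A Lipschitz function is weakly differentiable and its weak gradient is its almost everywhere
defined gradient. -/
theorem hasWeakGrad_of_lipschitz {f : Sp m → ℝ} {K : NNReal} (hf : LipschitzWith K f)
    (U : Set (Sp m)) : HasWeakGrad U f (gradient f) := by
  have gm : Measurable (gradient f) := by
    unfold gradient
    exact (LinearIsometryEquiv.continuous _).measurable.comp (measurable_fderiv ℝ f)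
  have gb : ∀ x, ‖gradient f x‖ ≤ K := fun x => by
    unfold gradient
    rw [LinearIsometryEquiv.norm_map]
    exact norm_fderiv_le_of_lipschitz ℝ hf
  have gl : LocallyIntegrable (gradient f) := by
    refine (locallyIntegrable_const (K : ℝ)).mono gm.aestronglyMeasurable ?_
    exact Eventually.of_forall fun x => by simpa using gb x
  refine ⟨hf.continuous.locallyIntegrable.locallyIntegrableOn U,
    gl.locallyIntegrableOn U, fun φ hφ hc hs e => ?_⟩
  have hs' := (tsupport_fderiv_apply_subset ℝ (f := φ) e).trans hs
  have e1 := setIntegral_eq_integral_of_test (f := f) hs'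
  have e2 := setIntegral_eq_integral_of_test (f := fun x => (inner ℝ (gradient f x) e : ℝ)) hs
  simp only [smul_eq_mul] at e1 e2
  simp only [mul_comm (f _)]
  rw [e1, e2]
  obtain ⟨D, hD⟩ := (hφ.of_le (by simp) : ContDiff ℝ 1 φ).lipschitzWith_of_hasCompactSupport hc
    (by simp)
  have key := hf.integral_lineDeriv_mul_eq (μ := volume) hD hc e
  have k1 : ∀ᵐ x, lineDeriv ℝ f x e * φ x = φ x * inner ℝ (gradient f x) e := by
    filter_upwards [hf.ae_differentiableAt (μ := volume)] with x hx
    rw [hx.lineDeriv_eq_fderiv, gradient, InnerProductSpace.toDual_symm_apply, mul_comm]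
  have k2 : ∀ x, lineDeriv ℝ φ x (-e) * f x = -(fderiv ℝ φ x e * f x) := fun x => by
    rw [(hφ.differentiable (by simp) x).lineDeriv_eq_fderiv, map_neg, neg_mul]
  rw [integral_congr_ae k1, integral_congr_ae (Eventually.of_forall k2), integral_neg] at key
  rw [key, neg_neg]

end WeakGrad

/-! ### Weak directional derivatives and Lipschitz test functions -/

section WeakDeriv

variable {m : ℕ} {U V : Set (Sp m)} {u w : Sp m → ℝ} {τ : Sp m}

/-- `w` is the weak derivative of `u` in the direction `τ` on `U`, for functions `u` and `w` that
are given on the whole space. -/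
def WeakDerivOn (U : Set (Sp m)) (τ : Sp m) (u w : Sp m → ℝ) : Prop :=
  ∀ φ : Sp m → ℝ, ContDiff ℝ ∞ φ → HasCompactSupport φ → tsupport φ ⊆ U →
    ∫ x, u x * fderiv ℝ φ x τ = -∫ x, φ x * w x

theorem HasWeakGrad.weakDerivOn {G : Sp m → Sp m} (h : HasWeakGrad U u G)
    {u' : Sp m → ℝ} (hu : ∀ᵐ x ∂volume.restrict U, u x = u' x)
    (hw : ∀ᵐ x ∂volume.restrict U, inner ℝ (G x) τ = w x) : WeakDerivOn U τ u' w := by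
  intro φ hφ hc hs
  have key := h.2.2 φ hφ hc hs τ
  have hs' := (tsupport_fderiv_apply_subset ℝ (f := φ) τ).trans hs
  have e1 := setIntegral_eq_integral_of_test (f := u') hs'
  have e2 := setIntegral_eq_integral_of_test (f := w) hs
  simp only [smul_eq_mul] at e1 e2
  simp only [mul_comm (u' _)]
  rw [← e1, ← e2, integral_congr_ae (g := fun x => u x * fderiv ℝ φ x τ), key, integral_congr_ae]
  · filter_upwards [hw] with x hx
    rw [hx]
  · filter_upwards [hu] with x hx
    rw [hx, mul_comm]

theorem measurePreserving_shift (τ : Sp m) (ν : Measure ℝ) [SFinite ν] :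
    MeasurePreserving (fun p : ℝ × Sp m => (p.1, p.2 + p.1 • τ)) (ν.prod volume)
      (ν.prod volume) := by
  refine (MeasurePreserving.id ν).skew_product (g := fun σ y => y + σ • τ) ?_ ?_
  · exact (by fun_prop : Continuous fun p : ℝ × Sp m => p.2 + p.1 • τ).measurable
  · exact ae_of_all _ fun σ => (measurePreserving_add_right volume (σ • τ)).map_eq

theorem integrable_mul_shift {f : Sp m → ℝ} (hf : Integrable f) {c : Sp m → ℝ}
    (hc : Continuous c) {M : ℝ} (hM : ∀ x, ‖c x‖ ≤ M) (ν : Measure ℝ) [IsFiniteMeasure ν] :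
    Integrable (fun p : ℝ × Sp m => f p.2 * c (p.2 - p.1 • τ)) (ν.prod volume) :=
  (hf.comp_snd ν).mul_bdd
    (by fun_prop : Continuous fun p : ℝ × Sp m => c (p.2 - p.1 • τ)).aestronglyMeasurable
    (ae_of_all _ fun p => hM _)

/-- Fubini's theorem and translation invariance move averages along a direction from `f` to the
test function `c`. -/
theorem integral_smul_shift_eq {f : Sp m → ℝ} (hf : Integrable f) {c : Sp m → ℝ}
    (hc : Continuous c) {M : ℝ} (hM : ∀ x, ‖c x‖ ≤ M) (h : ℝ) :
    ∫ y, c y * ∫ σ in Ioc 0 h, f (y + σ • τ) =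
      ∫ σ in Ioc 0 h, ∫ y, f y * c (y - σ • τ) := by
  have h1 : Integrable (fun p : ℝ × Sp m => f (p.2 + p.1 • τ) * c p.2)
      ((volume.restrict (Ioc 0 h)).prod volume) := by
    have := (measurePreserving_shift τ (volume.restrict (Ioc 0 h))).integrable_comp_of_integrable
      (integrable_mul_shift (τ := τ) hf hc hM (volume.restrict (Ioc 0 h)))
    simpa [Function.comp_def] using this
  simp_rw [← integral_const_mul]
  rw [← integral_integral_swap (f := fun (σ : ℝ) y => c y * f (y + σ • τ))]
  · congr 1
    ext σ
    rw [← integral_add_right_eq_self (fun y => f y * c (y - σ • τ)) (σ • τ)]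
    simp [mul_comm]
  · simpa [Function.uncurry_def, mul_comm] using h1

/-- Along a segment that stays in `U`, a function is almost everywhere the integral of its weak
directional derivative. -/
theorem WeakDerivOn.ae_sub_eq_integral (H : WeakDerivOn U τ u w) (hu : Integrable u)
    (hw : Integrable w) (hV : IsOpen V) {h : ℝ} (hh : 0 ≤ h)
    (hVU : ∀ y ∈ V, ∀ σ ∈ Icc 0 h, y + σ • τ ∈ U) :
    ∀ᵐ y, y ∈ V → u (y + h • τ) - u y = ∫ σ in Ioc 0 h, w (y + σ • τ) := by
  have hI : Integrable (fun y => ∫ σ in Ioc 0 h, w (y + σ • τ)) := by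
    have h0 := (measurePreserving_shift τ (volume.restrict (Ioc 0 h))).integrable_comp_of_integrable
      (hw.comp_snd (volume.restrict (Ioc 0 h)))
    exact h0.integral_prod_right
  have hu' : Integrable (fun y => u (y + h • τ)) := hu.comp_add_right _
  have key : ∀ᵐ y, y ∈ V → (u (y + h • τ) - u y) - ∫ σ in Ioc 0 h, w (y + σ • τ) = 0 := by
    refine hV.ae_eq_zero_of_integral_contDiff_smul_eq_zero
      (((hu'.sub hu).sub hI).locallyIntegrable.locallyIntegrableOn V) ?_
    intro φ hφ hc hs
    obtain ⟨M, hM⟩ := hφ.continuous.bounded_above_of_compact_support hc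
    have c' := continuous_fderiv_apply_of_test hφ τ
    have hc' : HasCompactSupport (fun x => fderiv ℝ φ x τ) :=
      hc.mono' ((subset_tsupport _).trans (tsupport_fderiv_apply_subset ℝ (f := φ) τ))
    obtain ⟨M', hM'⟩ := c'.bounded_above_of_compact_support hc'
    have i1 : ∀ {f : Sp m → ℝ}, Integrable f → Integrable (fun y => φ y * f y) := fun hf =>
      hf.bdd_mul hφ.continuous.aestronglyMeasurable (ae_of_all _ hM)
    -- the weak derivative identity for the translates of the test function
    have trans : ∀ σ ∈ Ioc 0 h, ∫ y, u y * fderiv ℝ φ (y - σ • τ) τ =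
        -∫ y, w y * φ (y - σ • τ) := by
      intro σ hσ
      have t1 := H (fun y => φ (y - σ • τ)) (hφ.comp (contDiff_id.sub contDiff_const))
        (hc.comp_homeomorph (Homeomorph.subRight (σ • τ))) ?_
      · have t2 : ∀ y, fderiv ℝ (fun y => φ (y - σ • τ)) y = fderiv ℝ φ (y - σ • τ) := fun y =>
          fderiv_comp_sub (σ • τ)
        simpa [t2, mul_comm] using t1
      · intro y hy
        have hy' : y - σ • τ ∈ tsupport φ := by
          have := tsupport_comp_subset_preimage φ
            (f := fun y : Sp m => y - σ • τ) (by fun_prop) hy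
          exact this
        have := hVU _ (hs hy') σ ⟨hσ.1.le, hσ.2⟩
        simpa using this
    have ftc : ∀ y, φ (y - h • τ) - φ y = -∫ σ in Ioc 0 h, fderiv ℝ φ (y - σ • τ) τ := by
      intro y
      have hd : ∀ σ ∈ uIcc 0 h, HasDerivAt (fun σ : ℝ => φ (y - σ • τ))
          (-fderiv ℝ φ (y - σ • τ) τ) σ := by
        intro σ _
        have d1 : HasDerivAt (fun σ : ℝ => y - σ • τ) (-τ) σ := by
          simpa using ((hasDerivAt_id σ).smul_const τ).const_sub y
        have d2 := (hφ.differentiable (by simp) (y - σ • τ)).hasFDerivAt.comp_hasDerivAt σ d1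
        simpa [Function.comp_def] using d2
      have := intervalIntegral.integral_eq_sub_of_hasDerivAt hd
        (Continuous.intervalIntegrable (by fun_prop) 0 h)
      rw [intervalIntegral.integral_of_le hh, integral_neg] at this
      simpa using this.symm
    have e1 : ∫ y, φ y * u (y + h • τ) = ∫ y, φ (y - h • τ) * u y := by
      rw [← integral_add_right_eq_self (fun y => φ (y - h • τ) * u y) (h • τ)]
      simp
    have e2 : (∫ y, φ (y - h • τ) * u y) - ∫ y, φ y * u y
        = -∫ σ in Ioc 0 h, ∫ y, u y * fderiv ℝ φ (y - σ • τ) τ := by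
      have i2 : Integrable fun y => φ (y - h • τ) * u y :=
        hu.bdd_mul (by fun_prop : Continuous fun y => φ (y - h • τ)).aestronglyMeasurable
          (ae_of_all _ fun y => hM _)
      have i3 : ∫ y, (φ (y - h • τ) * u y - φ y * u y) =
          (∫ y, φ (y - h • τ) * u y) - ∫ y, φ y * u y := integral_sub i2 (i1 hu)
      rw [← i3, integral_integral_swap (f := fun (σ : ℝ) y => u y * fderiv ℝ φ (y - σ • τ) τ)
        (integrable_mul_shift hu c' hM' _), ← integral_neg]
      congr 1
      ext y
      rw [← sub_mul, ftc y, integral_const_mul]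
      ring
    simp only [smul_eq_mul, mul_sub]
    have i4 : ∫ y, (φ y * u (y + h • τ) - φ y * u y - φ y * ∫ σ in Ioc 0 h, w (y + σ • τ)) =
        (∫ y, (φ y * u (y + h • τ) - φ y * u y)) - ∫ y, φ y * ∫ σ in Ioc 0 h, w (y + σ • τ) :=
      integral_sub ((i1 hu').sub (i1 hu)) (i1 hI)
    have i5 : ∫ y, (φ y * u (y + h • τ) - φ y * u y) =
        (∫ y, φ y * u (y + h • τ)) - ∫ y, φ y * u y := integral_sub (i1 hu') (i1 hu)
    rw [i4, i5, e1, e2,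
      integral_smul_shift_eq hw hφ.continuous hM, setIntegral_congr_fun measurableSet_Ioc trans,
      integral_neg]
    simp
  filter_upwards [key] with y hy hyV
  exact sub_eq_zero.1 (hy hyV)

/-- The derivative of a Lipschitz function vanishes almost everywhere on its zero set, because
the absolute value has a minimum there and is differentiable almost everywhere as well. -/
theorem ae_fderiv_eq_zero_of_eq_zero {f : Sp m → ℝ} {K : NNReal} (hf : LipschitzWith K f) :
    ∀ᵐ x, f x = 0 → fderiv ℝ f x = 0 := by
  have hn : LipschitzWith K fun x => ‖f x‖ := by
    simpa [Function.comp_def] using lipschitzWith_one_norm.comp hf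
  filter_upwards [hn.ae_differentiableAt (μ := volume)] with x hx h0
  have hmin : IsLocalMin (fun y => ‖f y‖) x := Eventually.of_forall fun y => by simp [h0]
  have hd : HasFDerivAt (fun y => ‖f y‖) (0 : Sp m →L[ℝ] ℝ) x := by
    rw [← hmin.fderiv_eq_zero]
    exact hx.hasFDerivAt
  have : HasFDerivAt f (0 : Sp m →L[ℝ] ℝ) x := by
    rw [hasFDerivAt_iff_isLittleO] at hd ⊢
    simp only [h0, norm_zero, sub_zero, zero_apply] at hd ⊢
    exact Asymptotics.isLittleO_norm_left.1 hd
  exact this.fderiv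

/-- The weak derivative may be tested with Lipschitz functions supported in `U`: the difference
quotients of the test function are moved to `u`, where they are averages of `w`. -/
theorem WeakDerivOn.integral_lipschitz_of_tsupport (H : WeakDerivOn U τ u w) (hU : IsOpen U)
    (hu : Integrable u) (hw : Integrable w) {φ : Sp m → ℝ} {K : NNReal} (hφ : LipschitzWith K φ)
    (hc : HasCompactSupport φ) (hs : tsupport φ ⊆ U) :
    ∫ x, u x * fderiv ℝ φ x τ = -∫ x, φ x * w x := by
  obtain ⟨M, hM⟩ := hφ.continuous.bounded_above_of_compact_support hc
  obtain ⟨δ, hδ, hδU⟩ := IsCompact.exists_thickening_subset_open hc hU hs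
  set k : ℝ → ℝ := fun σ => ∫ y, w y * φ (y - σ • τ) with hk
  have ki : ∀ σ : ℝ, Integrable (fun y => w y * φ (y - σ • τ)) := fun σ =>
    hw.mul_bdd (hφ.continuous.comp (by fun_prop : Continuous fun y : Sp m => y - σ • τ)).aestronglyMeasurable
      (ae_of_all _ fun y => hM _)
  have kc : Continuous k := by
    refine continuous_of_dominated (bound := fun y => ‖w y‖ * M) (fun σ => (ki σ).1) ?_ ?_ ?_
    · intro σ
      refine ae_of_all _ fun y => ?_
      rw [norm_mul]
      gcongr
      exact hM _
    · exact hw.norm.mul_const M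
    · refine ae_of_all _ fun y => ?_
      exact continuous_const.mul (hφ.continuous.comp (by fun_prop))
  -- for small `t` the difference quotients of the test function can be moved to `u`
  have small : ∀ᶠ t in 𝓝[>] (0 : ℝ),
      ∫ x, (t⁻¹ • (φ (x + t • (-τ)) - φ x)) * u x = t⁻¹ • ∫ σ in (0 : ℝ)..t, k σ := by
    have ht : ∀ᶠ t in 𝓝[>] (0 : ℝ), t * ‖τ‖ < δ / 2 := by
      refine nhdsWithin_le_nhds ?_
      have : Tendsto (fun t : ℝ => t * ‖τ‖) (𝓝 0) (𝓝 0) := by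
        simpa using (by fun_prop : Continuous fun t : ℝ => t * ‖τ‖).tendsto 0
      exact this.eventually (gt_mem_nhds (by positivity))
    filter_upwards [ht, self_mem_nhdsWithin] with t ht (ht0 : 0 < t)
    have T := H.ae_sub_eq_integral hu hw (V := Metric.thickening (δ / 2) (tsupport φ))
      Metric.isOpen_thickening ht0.le ?_
    · have i1 : ∀ {f : Sp m → ℝ}, Integrable f → Integrable (fun y => φ y * f y) := fun hf =>
        hf.bdd_mul hφ.continuous.aestronglyMeasurable (ae_of_all _ hM)
      have e1 : ∫ y, φ y * u (y + t • τ) = ∫ y, φ (y - t • τ) * u y := by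
        rw [← integral_add_right_eq_self (fun y => φ (y - t • τ) * u y) (t • τ)]
        simp
      have e2 : ∫ y, φ y * (u (y + t • τ) - u y) = ∫ σ in Ioc 0 t, k σ := by
        rw [← integral_smul_shift_eq hw hφ.continuous hM]
        refine integral_congr_ae ?_
        filter_upwards [T] with y hy
        by_cases hyφ : y ∈ tsupport φ
        · rw [hy (Metric.self_subset_thickening (by positivity) _ hyφ)]
        · rw [image_eq_zero_of_notMem_tsupport hyφ, zero_mul, zero_mul]
      rw [intervalIntegral.integral_of_le ht0.le, ← e2]
      simp only [mul_sub, smul_eq_mul]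
      have i2 : Integrable fun y => φ (y - t • τ) * u y :=
        hu.bdd_mul (hφ.continuous.comp
          (by fun_prop : Continuous fun y : Sp m => y - t • τ)).aestronglyMeasurable
          (ae_of_all _ fun y => hM _)
      have i3 : ∫ y, (φ (y - t • τ) * u y - φ y * u y) =
          (∫ y, φ (y - t • τ) * u y) - ∫ y, φ y * u y := integral_sub i2 (i1 hu)
      have i4 : ∫ y, (φ y * u (y + t • τ) - φ y * u y) =
          (∫ y, φ y * u (y + t • τ)) - ∫ y, φ y * u y :=
        integral_sub (i1 (hu.comp_add_right _)) (i1 hu)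
      rw [i4, e1, ← i3, ← integral_const_mul]
      congr 1
      ext x
      simp only [smul_neg, ← sub_eq_add_neg]
      ring
    · intro y hy σ hσ
      apply hδU
      rw [Metric.mem_thickening_iff] at hy ⊢
      obtain ⟨z, hz, hyz⟩ := hy
      refine ⟨z, hz, ?_⟩
      calc dist (y + σ • τ) z ≤ dist (y + σ • τ) y + dist y z := dist_triangle _ _ _
        _ = σ * ‖τ‖ + dist y z := by
          rw [dist_self_add_left, norm_smul, Real.norm_of_nonneg hσ.1]
        _ ≤ t * ‖τ‖ + dist y z := by
          gcongr
          exact hσ.2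
        _ < δ := by linarith
  have L1 := LipschitzWith.integral_inv_smul_sub_mul_tendsto_integral_lineDeriv_mul (μ := volume) hφ hu (-τ)
  have L2 : Tendsto (fun t : ℝ => t⁻¹ • ∫ σ in (0 : ℝ)..t, k σ) (𝓝[>] 0) (𝓝 (k 0)) := by
    have := (intervalIntegral.integral_hasDerivAt_right (kc.intervalIntegrable 0 0)
      (kc.stronglyMeasurableAtFilter _ _) kc.continuousAt).tendsto_slope_zero_right
    simpa using this
  have L3 := tendsto_nhds_unique (L1.congr' small) L2
  have e3 : ∫ x, lineDeriv ℝ φ x (-τ) * u x = -∫ x, u x * fderiv ℝ φ x τ := by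
    rw [← integral_neg]
    refine integral_congr_ae ?_
    filter_upwards [hφ.ae_differentiableAt (μ := volume)] with x hx
    rw [hx.lineDeriv_eq_fderiv, map_neg]
    ring
  rw [e3] at L3
  rw [← neg_neg (∫ x, u x * fderiv ℝ φ x τ), L3]
  simp [hk, mul_comm]

/-- The weak derivative may be tested with any compactly supported Lipschitz function that
vanishes outside `U`, without a condition at the boundary of `U`: truncating the test function at
height `ε` moves its support into `U`. -/
theorem WeakDerivOn.integral_lipschitz (H : WeakDerivOn U τ u w) (hU : IsOpen U)
    (hu : Integrable u) (hw : Integrable w) {φ : Sp m → ℝ} {K : NNReal} (hφ : LipschitzWith K φ)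
    (hc : HasCompactSupport φ) (hs : ∀ x ∉ U, φ x = 0) :
    ∫ x, u x * fderiv ℝ φ x τ = -∫ x, φ x * w x := by
  obtain ⟨M, hM⟩ := hφ.continuous.bounded_above_of_compact_support hc
  set ε : ℕ → ℝ := fun j => 1 / ((j : ℝ) + 1) with hε
  have εpos : ∀ j, 0 < ε j := fun j => by positivity
  have εlim : Tendsto ε atTop (𝓝 0) := tendsto_one_div_add_atTop_nhds_zero_nat
  set q : ℕ → Sp m → ℝ := fun j x => max (-ε j) (min (ε j) (φ x)) with hq
  have qL : ∀ j, LipschitzWith K (q j) := fun j => (hφ.const_min (ε j)).const_max (-ε j)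
  have hL : ∀ j, LipschitzWith (K + K) (fun x => φ x - q j x) := fun j => hφ.sub (qL j)
  have q_eq : ∀ j x, |φ x| ≤ ε j → q j x = φ x := fun j x hx => by
    rw [abs_le] at hx
    simp [hq, hx.1, hx.2]
  have q_le : ∀ j x, |q j x| ≤ ε j := fun j x => by
    rw [abs_le]
    exact ⟨le_max_left _ _, max_le (by linarith [εpos j]) (min_le_left _ _)⟩
  have q_le' : ∀ j x, |φ x - q j x| ≤ |φ x| := fun j x => by
    rcases le_total (|φ x|) (ε j) with h | h
    · simp [q_eq j x h]
    · have := εpos j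
      rcases le_total 0 (φ x) with h0 | h0
      · rw [abs_of_nonneg h0] at h ⊢
        have : q j x = ε j := by simp only [hq]; rw [min_eq_left h, max_eq_right (by linarith)]
        rw [this, abs_of_nonneg (by linarith)]
        linarith
      · rw [abs_of_nonpos h0] at h ⊢
        have : q j x = -ε j := by
          simp only [hq]; rw [min_eq_right (by linarith), max_eq_left (by linarith)]
        rw [this, abs_of_nonpos (by linarith)]
        linarith
  have cpt : ∀ j, HasCompactSupport (fun x => φ x - q j x) := fun j => by
    refine hc.mono fun x hx h0 => hx ?_
    have h0' : φ x = 0 := h0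
    simp [q_eq j x (by rw [h0']; simpa using (εpos j).le)]
  have supp : ∀ j, tsupport (fun x => φ x - q j x) ⊆ U := fun j x hx => by
    have hcl : IsClosed {x | ε j ≤ |φ x|} := isClosed_le continuous_const hφ.continuous.abs
    have hx' : ε j ≤ |φ x| := by
      refine closure_minimal (fun y hy => ?_) hcl hx
      by_contra hlt
      exact hy (by simp only [q_eq j y (not_le.1 hlt).le, sub_self])
    by_contra hxU
    rw [hs x hxU, abs_zero] at hx'
    exact absurd hx' (not_le.2 (εpos j))
  have key := fun j => H.integral_lipschitz_of_tsupport hU hu hw (hL j) (cpt j) (supp j)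
  have lim1 : Tendsto (fun j => ∫ x, (φ x - q j x) * w x) atTop (𝓝 (∫ x, φ x * w x)) := by
    refine tendsto_integral_of_dominated_convergence (fun x => M * ‖w x‖) ?_ (hw.norm.const_mul M) ?_ ?_
    · exact fun j => ((hL j).continuous.aestronglyMeasurable).mul hw.1
    · refine fun j => ae_of_all _ fun x => ?_
      rw [norm_mul]
      gcongr
      exact (q_le' j x).trans (hM x)
    · refine ae_of_all _ fun x => ?_
      refine Tendsto.mul_const _ ?_
      have : Tendsto (fun j => q j x) atTop (𝓝 0) :=
        squeeze_zero_norm (fun j => q_le j x) εlim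
      simpa using this.const_sub (φ x)
  have lim2 : Tendsto (fun j => ∫ x, u x * fderiv ℝ (fun x => φ x - q j x) x τ) atTop
      (𝓝 (∫ x, u x * fderiv ℝ φ x τ)) := by
    refine tendsto_integral_of_dominated_convergence (fun x => ‖u x‖ * ((K + K) * ‖τ‖)) ?_
      (hu.norm.mul_const _) ?_ ?_
    · exact fun j => hu.1.mul (measurable_fderiv_apply_const ℝ _ τ).aestronglyMeasurable
    · refine fun j => ae_of_all _ fun x => ?_
      rw [norm_mul]
      gcongr
      refine (ContinuousLinearMap.le_opNorm _ _).trans ?_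
      gcongr
      exact_mod_cast norm_fderiv_le_of_lipschitz ℝ (hL j)
    · filter_upwards [ae_fderiv_eq_zero_of_eq_zero hφ] with x hx
      refine tendsto_const_nhds.congr' ?_
      by_cases h0 : φ x = 0
      · refine Eventually.of_forall fun j => ?_
        have : (fun x => φ x - q j x) =ᶠ[𝓝 x] fun _ => 0 := by
          have : ∀ᶠ y in 𝓝 x, |φ y| < ε j :=
            hφ.continuous.abs.continuousAt.eventually (gt_mem_nhds (by simpa [h0] using εpos j))
          filter_upwards [this] with y hy
          rw [q_eq j y hy.le, sub_self]
        simp only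
        rw [this.fderiv_eq, hx h0]
        simp
      · have hlt : ∀ᶠ j in atTop, ε j < |φ x| := εlim.eventually (gt_mem_nhds (abs_pos.2 h0))
        filter_upwards [hlt] with j hj
        have : ∃ c, (fun x => φ x - q j x) =ᶠ[𝓝 x] fun y => φ y - c := by
          have ej := εpos j
          rcases lt_or_gt_of_ne h0 with h | h
          · refine ⟨-ε j, ?_⟩
            have : ∀ᶠ y in 𝓝 x, φ y < -ε j :=
              hφ.continuous.continuousAt.eventually (gt_mem_nhds (by
                rw [abs_of_neg h] at hj; linarith))
            filter_upwards [this] with y hy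
            simp only [hq]
            rw [min_eq_right (by linarith), max_eq_left (by linarith)]
          · refine ⟨ε j, ?_⟩
            have : ∀ᶠ y in 𝓝 x, ε j < φ y :=
              hφ.continuous.continuousAt.eventually (lt_mem_nhds (by
                rw [abs_of_pos h] at hj; linarith))
            filter_upwards [this] with y hy
            simp only [hq]
            rw [min_eq_left (by linarith), max_eq_right (by linarith)]
        obtain ⟨c, hc⟩ := this
        rw [hc.fderiv_eq, fderiv_sub_const]
  exact tendsto_nhds_unique lim2 ((lim1.neg).congr fun j => (key j).symm)

end WeakDeriv

/-! ### Lipschitz graph charts -/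

/-- A Lipschitz graph together with a box around one of its points: Cartesian coordinates `e`, a
Lipschitz function `ψ`, and a ball of centre `b` and radius `r` in the coordinate plane. -/
structure GraphChart (n : ℕ) where
  /-- the Cartesian coordinates -/
  e : Sp (n + 1) ≃ₗᵢ[ℝ] WithLp 2 (Sp n × ℝ)
  /-- the function whose graph is considered -/
  ψ : Sp n → ℝ
  /-- a Lipschitz constant of `ψ` -/
  K : NNReal
  lip : LipschitzWith K ψ
  /-- the centre of the base of the box -/
  b : Sp n
  /-- the size of the box -/
  r : ℝ
  r_pos : 0 < r

namespace GraphChart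

variable {n : ℕ} (C : GraphChart n)

/-- The horizontal coordinates. -/
def base : Sp (n + 1) →L[ℝ] Sp n :=
  (ContinuousLinearMap.fst ℝ (Sp n) ℝ).comp
    ((WithLp.prodContinuousLinearEquiv 2 ℝ (Sp n) ℝ).toContinuousLinearMap.comp
      C.e.toContinuousLinearEquiv.toContinuousLinearMap)

/-- The vertical coordinate. -/
def top : Sp (n + 1) →L[ℝ] ℝ :=
  (ContinuousLinearMap.snd ℝ (Sp n) ℝ).comp
    ((WithLp.prodContinuousLinearEquiv 2 ℝ (Sp n) ℝ).toContinuousLinearMap.comp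
      C.e.toContinuousLinearEquiv.toContinuousLinearMap)

/-- The point with given horizontal and vertical coordinates. -/
def ofCoord (y : Sp n) (t : ℝ) : Sp (n + 1) := C.e.symm (WithLp.toLp 2 (y, t))

/-- The vertical height above the graph. -/
def height (x : Sp (n + 1)) : ℝ := C.top x - C.ψ (C.base x)

/-- The point at height `z.2` above the graph over `z.1`. -/
def pt (z : Sp n × ℝ) : Sp (n + 1) := C.ofCoord z.1 (C.ψ z.1 + z.2)

/-- The parametrization of the graph. -/
def gr (y : Sp n) : Sp (n + 1) := C.ofCoord y (C.ψ y)

/-- The vertical unit vector. -/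
def up : Sp (n + 1) := C.ofCoord 0 1

/-- The box around the graph over the ball `B_r(b)`. -/
def box : Set (Sp (n + 1)) := {x | C.base x ∈ Metric.ball C.b C.r ∧ |C.height x| < C.r}

/-- Within the box, `U` is the region above the graph. -/
def Fits (U : Set (Sp (n + 1))) : Prop := ∀ x ∈ C.box, (x ∈ U ↔ 0 < C.height x)

theorem base_apply (x : Sp (n + 1)) : C.base x = (C.e x).fst := rfl

theorem top_apply (x : Sp (n + 1)) : C.top x = (C.e x).snd := rfl

@[simp] theorem base_ofCoord (y : Sp n) (t : ℝ) : C.base (C.ofCoord y t) = y := by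
  simp [base_apply, ofCoord]

@[simp] theorem top_ofCoord (y : Sp n) (t : ℝ) : C.top (C.ofCoord y t) = t := by
  simp [top_apply, ofCoord]

@[simp] theorem ofCoord_base_top (x : Sp (n + 1)) : C.ofCoord (C.base x) (C.top x) = x := by
  rw [ofCoord, LinearIsometryEquiv.symm_apply_eq]
  rfl

theorem ofCoord_sub (y y' : Sp n) (t t' : ℝ) : C.ofCoord y t - C.ofCoord y' t' = C.ofCoord (y - y') (t - t') := by
  rw [ofCoord, ofCoord, ofCoord, ← map_sub]
  rfl

theorem ofCoord_add (y y' : Sp n) (t t' : ℝ) : C.ofCoord y t + C.ofCoord y' t' = C.ofCoord (y + y') (t + t') := by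
  rw [ofCoord, ofCoord, ofCoord, ← map_add]
  rfl

theorem smul_ofCoord (c : ℝ) (y : Sp n) (t : ℝ) : c • C.ofCoord y t = C.ofCoord (c • y) (c * t) := by
  rw [ofCoord, ofCoord, ← map_smul]
  rfl

theorem norm_ofCoord_sq (y : Sp n) (t : ℝ) : ‖C.ofCoord y t‖ ^ 2 = ‖y‖ ^ 2 + t ^ 2 := by
  rw [ofCoord, LinearIsometryEquiv.norm_map, WithLp.prod_norm_sq_eq_of_L2]
  simp

theorem norm_le_norm_ofCoord (y : Sp n) (t : ℝ) : ‖y‖ ≤ ‖C.ofCoord y t‖ := by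
  rw [← sq_le_sq₀ (norm_nonneg _) (norm_nonneg _), norm_ofCoord_sq]
  exact le_add_of_nonneg_right (sq_nonneg t)

theorem abs_le_norm_ofCoord (y : Sp n) (t : ℝ) : |t| ≤ ‖C.ofCoord y t‖ := by
  rw [← abs_norm, ← sq_le_sq, norm_ofCoord_sq]
  nlinarith [sq_nonneg ‖y‖]

theorem norm_ofCoord_le (y : Sp n) (t : ℝ) : ‖C.ofCoord y t‖ ≤ ‖y‖ + |t| := by
  rw [← abs_of_nonneg (by positivity : 0 ≤ ‖y‖ + |t|), ← abs_norm, ← sq_le_sq, norm_ofCoord_sq]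
  nlinarith [mul_nonneg (norm_nonneg y) (abs_nonneg t), sq_abs t]

theorem inner_ofCoord (y y' : Sp n) (t t' : ℝ) :
    inner ℝ (C.ofCoord y t) (C.ofCoord y' t') = inner ℝ y y' + t * t' := by
  rw [ofCoord, ofCoord, LinearIsometryEquiv.inner_map_map, WithLp.prod_inner_apply]
  simp [mul_comm]

theorem norm_base_le (x : Sp (n + 1)) : ‖C.base x‖ ≤ ‖x‖ := by
  simpa using C.norm_le_norm_ofCoord (C.base x) (C.top x)

theorem abs_top_le (x : Sp (n + 1)) : |C.top x| ≤ ‖x‖ := by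
  simpa using C.abs_le_norm_ofCoord (C.base x) (C.top x)

@[simp] theorem base_pt (z : Sp n × ℝ) : C.base (C.pt z) = z.1 := by simp [pt]

@[simp] theorem height_pt (z : Sp n × ℝ) : C.height (C.pt z) = z.2 := by simp [pt, height]

@[simp] theorem base_gr (y : Sp n) : C.base (C.gr y) = y := by simp [gr]

@[simp] theorem height_gr (y : Sp n) : C.height (C.gr y) = 0 := by simp [gr, height]

theorem pt_zero (y : Sp n) : C.pt (y, 0) = C.gr y := by simp [pt, gr]

theorem pt_base_height (x : Sp (n + 1)) : C.pt (C.base x, C.height x) = x := by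
  simp [pt, height]

theorem gr_base_of_height_eq_zero {x : Sp (n + 1)} (h : C.height x = 0) : C.gr (C.base x) = x := by
  rw [← pt_zero, ← h, pt_base_height]

theorem pt_add_up (y : Sp n) (s h : ℝ) : C.pt (y, s) + h • C.up = C.pt (y, s + h) := by
  simp [pt, up, smul_ofCoord, ofCoord_add, add_assoc]

theorem dist_base_le (x x' : Sp (n + 1)) : dist (C.base x) (C.base x') ≤ dist x x' := by
  rw [dist_eq_norm, dist_eq_norm, ← map_sub]
  exact C.norm_base_le _

theorem lipschitz_height : LipschitzWith (1 + C.K) C.height := by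
  have h1 : LipschitzWith 1 C.top := LipschitzWith.of_dist_le_mul fun x y => by
    rw [Real.dist_eq, ← map_sub, dist_eq_norm]
    simpa using C.abs_top_le (x - y)
  have h2 : LipschitzWith 1 C.base := LipschitzWith.of_dist_le_mul fun x y => by
    simpa using C.dist_base_le x y
  have h3 : LipschitzWith (1 + C.K) fun x => C.top x - C.ψ (C.base x) := by
    simpa [Function.comp_def] using h1.sub (C.lip.comp h2)
  exact h3

theorem dist_pt_le (z z' : Sp n × ℝ) :
    dist (C.pt z) (C.pt z') ≤ (1 + C.K) * dist z.1 z'.1 + |z.2 - z'.2| := by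
  rw [dist_eq_norm, pt, pt, ofCoord_sub]
  refine (C.norm_ofCoord_le _ _).trans ?_
  have h1 := C.lip.dist_le_mul z.1 z'.1
  rw [Real.dist_eq] at h1
  have h2 : |C.ψ z.1 + z.2 - (C.ψ z'.1 + z'.2)| ≤ |C.ψ z.1 - C.ψ z'.1| + |z.2 - z'.2| := by
    rw [show C.ψ z.1 + z.2 - (C.ψ z'.1 + z'.2) = (C.ψ z.1 - C.ψ z'.1) + (z.2 - z'.2) by ring]
    exact abs_add_le _ _
  rw [← dist_eq_norm]
  linarith

theorem dist_gr_le (y y' : Sp n) : dist (C.gr y) (C.gr y') ≤ (1 + C.K) * dist y y' := by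
  simpa [pt_zero] using C.dist_pt_le (y, 0) (y', 0)

theorem continuous_height : Continuous C.height := C.lipschitz_height.continuous

theorem continuous_ofCoord : Continuous fun z : Sp n × ℝ => C.ofCoord z.1 z.2 :=
  C.e.symm.continuous.comp (WithLp.prod_continuous_toLp 2 _ _)

theorem continuous_pt : Continuous C.pt :=
  C.continuous_ofCoord.comp (continuous_fst.prodMk ((C.lip.continuous.comp continuous_fst).add
    continuous_snd))

theorem continuous_gr : Continuous C.gr :=
  C.continuous_ofCoord.comp (continuous_id.prodMk C.lip.continuous)

theorem isOpen_box : IsOpen C.box :=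
  (Metric.isOpen_ball.preimage C.base.continuous).inter
    (isOpen_lt C.continuous_height.abs continuous_const)

theorem gr_mem_box {y : Sp n} (hy : y ∈ Metric.ball C.b C.r) : C.gr y ∈ C.box := by
  simpa [box, C.r_pos] using hy

/-- The coordinates given by the base point and the height above the graph. -/
def homeo : Sp n × ℝ ≃ₜ Sp (n + 1) where
  toFun := C.pt
  invFun x := (C.base x, C.height x)
  left_inv z := by simp
  right_inv x := C.pt_base_height x
  continuous_toFun := C.continuous_pt
  continuous_invFun := C.base.continuous.prodMk C.continuous_height

/-- The coordinates are the composition of a shear and an isometry. -/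
theorem measurePreserving_pt : MeasurePreserving C.pt := by
  have h1 : MeasurePreserving (fun z : Sp n × ℝ => (z.1, C.ψ z.1 + z.2)) := by
    refine (MeasurePreserving.id (volume : Measure (Sp n))).skew_product
      (g := fun y t => C.ψ y + t) ?_ ?_
    · exact ((C.lip.continuous.comp continuous_fst).add continuous_snd).measurable
    · exact ae_of_all _ fun y => (measurePreserving_add_left volume (C.ψ y)).map_eq
  exact (C.e.symm.measurePreserving.comp (WithLp.volume_preserving_toLp (Sp n) ℝ)).comp h1

theorem measurableEmbedding_pt : MeasurableEmbedding C.pt := C.homeo.measurableEmbedding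

theorem measurableEmbedding_gr : MeasurableEmbedding C.gr := by
  refine (AntilipschitzWith.isClosedEmbedding (K := 1) ?_ ?_).measurableEmbedding
  · refine AntilipschitzWith.of_le_mul_dist fun y y' => ?_
    simpa using C.dist_base_le (C.gr y) (C.gr y')
  · exact (LipschitzWith.of_dist_le_mul (K := 1 + C.K) fun y y' => by
      simpa using C.dist_gr_le y y').uniformContinuous

theorem gr_injective : Function.Injective C.gr := C.measurableEmbedding_gr.injective

/-- A point at which a set has a Lipschitz boundary lies in the box of a chart that describes the
set: the box is made so small that it stays in the neighbourhood of the local description. -/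
theorem _root_.UnfittedNitsche.IsLipschitzAt.exists_chart {U : Set (Sp (n + 1))}
    {x : Sp (n + 1)} (h : IsLipschitzAt U x) (hx : x ∈ frontier U) :
    ∃ C : GraphChart n, x ∈ C.box ∧ C.Fits U := by
  obtain ⟨e, ψ, K, hψ, hev⟩ := h
  let C₀ : GraphChart n := ⟨e, ψ, K, hψ, (e x).fst, 1, one_pos⟩
  obtain ⟨ρ, hρ, hball⟩ := Metric.eventually_nhds_iff_ball.1 hev
  have hU : ∀ y ∈ Metric.ball x ρ, (y ∈ U ↔ 0 < C₀.height y) := fun y hy => by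
    rw [hball y hy, height, top_apply, base_apply, sub_pos]
  have h0 : C₀.height x = 0 := by
    rcases lt_trichotomy (C₀.height x) 0 with h | h | h
    · exfalso
      have : ∀ᶠ y in 𝓝 x, y ∉ U := by
        filter_upwards [Metric.ball_mem_nhds x hρ,
          C₀.continuous_height.continuousAt.eventually (gt_mem_nhds h)] with y hy hy'
        rw [hU y hy]
        exact not_lt.2 hy'.le
      have hx' := hx.1
      rw [mem_closure_iff_frequently] at hx'
      exact hx' this
    · exact h
    · exfalso
      refine hx.2 (mem_interior_iff_mem_nhds.2 ?_)
      filter_upwards [Metric.ball_mem_nhds x hρ,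
        C₀.continuous_height.continuousAt.eventually (lt_mem_nhds h)] with y hy hy'
      exact (hU y hy).2 hy'
  have hr : 0 < ρ / (3 + K) := by positivity
  let C : GraphChart n := ⟨e, ψ, K, hψ, (e x).fst, ρ / (3 + K), hr⟩
  refine ⟨C, ⟨Metric.mem_ball_self hr, ?_⟩, fun y hy => hU y ?_⟩
  · change |C₀.height x| < _
    rw [h0, abs_zero]
    exact hr
  · have hy1 : dist (C.base y) (C.base x) < ρ / (3 + K) := hy.1
    have hy2 : |C.height y| < ρ / (3 + K) := hy.2
    have hx0 : C.height x = 0 := h0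
    have key := C.dist_pt_le (C.base y, C.height y) (C.base x, C.height x)
    rw [pt_base_height, pt_base_height] at key
    simp only [hx0, sub_zero] at key
    rw [Metric.mem_ball]
    have hK : (C.K : ℝ) = K := rfl
    rw [hK] at key
    have k2 : (1 + (K : ℝ)) * dist (C.base y) (C.base x) ≤ (1 + K) * (ρ / (3 + K)) := by gcongr
    have k3 : ρ = (3 + (K : ℝ)) * (ρ / (3 + K)) := by field_simp
    nlinarith

theorem frontier_inter_box {U : Set (Sp (n + 1))} (h : C.Fits U) {x : Sp (n + 1)}
    (hx : x ∈ C.box) : x ∈ frontier U ↔ C.height x = 0 := by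
  constructor
  · intro hf
    by_contra hne
    rcases lt_or_gt_of_ne hne with hlt | hgt
    · have : ∀ᶠ y in 𝓝 x, y ∉ U := by
        filter_upwards [C.isOpen_box.mem_nhds hx,
          C.continuous_height.continuousAt.eventually (gt_mem_nhds hlt)] with y hy hy'
        rw [h y hy]
        exact not_lt.2 hy'.le
      have hx' := hf.1
      rw [mem_closure_iff_frequently] at hx'
      exact hx' this
    · refine hf.2 (mem_interior_iff_mem_nhds.2 ?_)
      filter_upwards [C.isOpen_box.mem_nhds hx,
        C.continuous_height.continuousAt.eventually (lt_mem_nhds hgt)] with y hy hy'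
      exact (h y hy).2 hy'
  · intro h0
    have lim : Tendsto (fun s : ℝ => C.pt (C.base x, s)) (𝓝[>] 0) (𝓝 x) := by
      have : Continuous fun s : ℝ => C.pt (C.base x, s) := C.continuous_pt.comp (by fun_prop)
      have := this.tendsto 0
      rw [pt_zero, C.gr_base_of_height_eq_zero h0] at this
      exact this.mono_left nhdsWithin_le_nhds
    refine ⟨mem_closure_of_tendsto lim ?_, fun hi => ?_⟩
    · filter_upwards [lim.eventually (C.isOpen_box.mem_nhds hx), self_mem_nhdsWithin] with s hs hs0
      rw [h _ hs, height_pt]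
      exact hs0
    · have := (h x hx).1 (interior_subset hi)
      exact this.ne' h0

/-! ### Normal vector and area formula of a Lipschitz graph -/

/-- The derivative of the height function above a point of the base. -/
def dheight (y : Sp n) : Sp (n + 1) →L[ℝ] ℝ := C.top - (fderiv ℝ C.ψ y).comp C.base

theorem hasFDerivAt_height {x : Sp (n + 1)} (h : DifferentiableAt ℝ C.ψ (C.base x)) :
    HasFDerivAt C.height (C.dheight (C.base x)) x :=
  C.top.hasFDerivAt.sub (h.hasFDerivAt.comp x C.base.hasFDerivAt)

/-- The area element of the graph. -/
def area (y : Sp n) : ℝ := √(1 + ‖fderiv ℝ C.ψ y‖ ^ 2)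

theorem one_le_area (y : Sp n) : 1 ≤ C.area y := by
  rw [area, Real.one_le_sqrt]
  nlinarith [sq_nonneg ‖fderiv ℝ C.ψ y‖]

theorem area_pos (y : Sp n) : 0 < C.area y := one_pos.trans_le (C.one_le_area y)

theorem area_le (y : Sp n) : C.area y ≤ 1 + C.K := by
  have h1 : ‖fderiv ℝ C.ψ y‖ ≤ C.K := norm_fderiv_le_of_lipschitz ℝ C.lip
  rw [area, Real.sqrt_le_left (by positivity)]
  nlinarith [norm_nonneg (fderiv ℝ C.ψ y), C.K.2, sq_nonneg ((C.K : ℝ) - ‖fderiv ℝ C.ψ y‖),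
    NNReal.coe_nonneg C.K]

theorem measurable_area : Measurable C.area :=
  (((measurable_fderiv ℝ C.ψ).norm.pow_const 2).const_add 1).sqrt

/-- The unit normal of the graph that points downwards. -/
def nu (y : Sp n) : Sp (n + 1) := (C.area y)⁻¹ • C.ofCoord (gradient C.ψ y) (-1)

theorem inner_nu (y : Sp n) (v : Sp (n + 1)) :
    inner ℝ (C.nu y) v = -((C.area y)⁻¹ * C.dheight y v) := by
  rw [nu, inner_smul_left, ← C.ofCoord_base_top v, inner_ofCoord, gradient,
    InnerProductSpace.toDual_symm_apply, dheight]
  simp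
  ring

theorem norm_nu (y : Sp n) : ‖C.nu y‖ = 1 := by
  have h1 : ‖C.ofCoord (gradient C.ψ y) (-1)‖ = C.area y := by
    rw [← sq_eq_sq₀ (norm_nonneg _) (C.area_pos y).le, norm_ofCoord_sq, area,
      Real.sq_sqrt (by positivity), gradient, LinearIsometryEquiv.norm_map]
    ring
  rw [nu, norm_smul, h1, norm_inv, Real.norm_of_nonneg (C.area_pos y).le,
    inv_mul_cancel₀ (C.area_pos y).ne']

theorem measurable_nu : Measurable C.nu := by
  have h1 : Measurable (gradient C.ψ) := by
    unfold gradient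
    exact (LinearIsometryEquiv.continuous _).measurable.comp (measurable_fderiv ℝ _)
  exact C.measurable_area.inv.smul (C.continuous_ofCoord.measurable.comp (h1.prodMk measurable_const))

/-- By Rademacher's theorem this provides an outer normal at almost every point of the graph. -/
theorem isOuterNormal_nu {U : Set (Sp (n + 1))} (h : C.Fits U) {y : Sp n}
    (hy : y ∈ Metric.ball C.b C.r) (hd : DifferentiableAt ℝ C.ψ y) :
    IsOuterNormal U (C.gr y) (C.nu y) := by
  refine ⟨C.norm_nu y, fun ε hε => ?_⟩
  have hda := C.hasFDerivAt_height (x := C.gr y) (by simpa using hd)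
  rw [hasFDerivAt_iff_isLittleO, Asymptotics.isLittleO_iff] at hda
  filter_upwards [hda hε, C.isOpen_box.mem_nhds (C.gr_mem_box hy)] with z hz hzb
  simp only [base_gr, height_gr, sub_zero] at hz
  rw [Real.norm_eq_abs, abs_le] at hz
  have hin : inner ℝ (z - C.gr y) (C.nu y) = -((C.area y)⁻¹ * C.dheight y (z - C.gr y)) := by
    rw [real_inner_comm, inner_nu]
  have ha := C.one_le_area y
  have ha0 := C.area_pos y
  rw [hin, h z hzb]
  have hN := mul_nonneg hε.le (norm_nonneg (z - C.gr y))
  have hmul : C.area y * ((C.area y)⁻¹ * C.dheight y (z - C.gr y)) = C.dheight y (z - C.gr y) := by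
    field_simp
  constructor
  · intro hlt
    have : ε * ‖z - C.gr y‖ < (C.area y)⁻¹ * C.dheight y (z - C.gr y) := by linarith
    have : C.area y * (ε * ‖z - C.gr y‖) < C.dheight y (z - C.gr y) := by
      rw [← hmul]
      exact mul_lt_mul_of_pos_left this ha0
    nlinarith
  · intro hlt
    have : (C.area y)⁻¹ * C.dheight y (z - C.gr y) < -(ε * ‖z - C.gr y‖) := by linarith
    have : C.dheight y (z - C.gr y) < C.area y * (-(ε * ‖z - C.gr y‖)) := by
      rw [← hmul]
      exact mul_lt_mul_of_pos_left this ha0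
    rw [not_lt]
    nlinarith

end GraphChart

/-- A small step from `x` in the direction `ν' - ν` would enter the set with respect to `ν` and
leave it with respect to `ν'`. -/
theorem IsOuterNormal.unique {m : ℕ} {U : Set (Sp m)} {x ν ν' : Sp m} (h : IsOuterNormal U x ν)
    (h' : IsOuterNormal U x ν') : ν = ν' := by
  by_contra hne
  have hlt : inner ℝ ν ν' < 1 := (inner_lt_one_iff_real_of_norm_eq_one h.1 h'.1).2 hne
  set d := ν' - ν
  have h1 : inner ℝ d ν = inner ℝ ν ν' - 1 := by
    rw [inner_sub_left, real_inner_comm, real_inner_self_eq_norm_sq, h.1]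
    norm_num
  have h2 : inner ℝ d ν' = 1 - inner ℝ ν ν' := by
    rw [inner_sub_left, real_inner_self_eq_norm_sq, h'.1]
    norm_num
  have hd : 0 ≤ ‖d‖ := norm_nonneg d
  set ε := (1 - inner ℝ ν ν') / (‖d‖ + 1)
  have hε : 0 < ε := div_pos (by linarith) (by linarith)
  have hεd : ε * ‖d‖ < 1 - inner ℝ ν ν' := by
    have : ε * (‖d‖ + 1) = 1 - inner ℝ ν ν' := by simp only [ε]; field_simp
    linarith
  have lim : Tendsto (fun t : ℝ => x + t • d) (𝓝[>] 0) (𝓝 x) := by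
    have : Continuous fun t : ℝ => x + t • d := by fun_prop
    simpa using (this.tendsto 0).mono_left nhdsWithin_le_nhds
  obtain ⟨t, ⟨ht1, ht2⟩, ht⟩ := ((lim.eventually (h.2 ε hε)).and
    (lim.eventually (h'.2 ε hε)) |>.and self_mem_nhdsWithin).exists
  have ht0 : (0 : ℝ) < t := ht
  simp only [add_sub_cancel_left, inner_smul_left, norm_smul, Real.norm_of_nonneg ht0.le,
    RCLike.conj_to_real, h1, h2] at ht1 ht2
  exact ht2.2 (by nlinarith) (ht1.1 (by nlinarith))

/-- Two disjoint sets have opposite outer normals at a common boundary point. -/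
theorem IsOuterNormal.eq_neg {m : ℕ} {U V : Set (Sp m)} {x ν ν' : Sp m}
    (h : IsOuterNormal U x ν) (h' : IsOuterNormal V x ν') (hUV : Disjoint U V) : ν' = -ν := by
  by_contra hne
  have hne' : ν ≠ -ν' := fun h => hne (by rw [h, neg_neg])
  have hlt : inner ℝ ν (-ν') < 1 :=
    (inner_lt_one_iff_real_of_norm_eq_one h.1 (by rw [norm_neg, h'.1])).2 hne'
  rw [inner_neg_right] at hlt
  set d := -(ν + ν')
  have h1 : inner ℝ d ν = -(1 + inner ℝ ν ν') := by
    rw [inner_neg_left, inner_add_left, real_inner_self_eq_norm_sq, h.1, real_inner_comm]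
    norm_num
  have h2 : inner ℝ d ν' = -(1 + inner ℝ ν ν') := by
    rw [inner_neg_left, inner_add_left, real_inner_self_eq_norm_sq, h'.1]
    ring
  have hd : 0 ≤ ‖d‖ := norm_nonneg d
  set ε := (1 + inner ℝ ν ν') / (‖d‖ + 1)
  have hε : 0 < ε := div_pos (by linarith) (by linarith)
  have hεd : ε * ‖d‖ < 1 + inner ℝ ν ν' := by
    have : ε * (‖d‖ + 1) = 1 + inner ℝ ν ν' := by simp only [ε]; field_simp
    linarith
  have lim : Tendsto (fun t : ℝ => x + t • d) (𝓝[>] 0) (𝓝 x) := by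
    have : Continuous fun t : ℝ => x + t • d := by fun_prop
    simpa using (this.tendsto 0).mono_left nhdsWithin_le_nhds
  obtain ⟨t, ⟨ht1, ht2⟩, ht⟩ := ((lim.eventually (h.2 ε hε)).and
    (lim.eventually (h'.2 ε hε)) |>.and self_mem_nhdsWithin).exists
  have ht0 : (0 : ℝ) < t := ht
  simp only [add_sub_cancel_left, inner_smul_left, norm_smul, Real.norm_of_nonneg ht0.le,
    RCLike.conj_to_real, h1, h2] at ht1 ht2
  exact disjoint_left.1 hUV (ht1.1 (by nlinarith)) (ht2.1 (by nlinarith))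

theorem IsOuterNormal.outerNormal_eq {m : ℕ} {U : Set (Sp m)} {x ν : Sp m}
    (h : IsOuterNormal U x ν) : outerNormal U x = ν := by
  have hex : ∃ ν, IsOuterNormal U x ν := ⟨ν, h⟩
  rw [outerNormal, dif_pos hex]
  exact hex.choose_spec.unique h

namespace GraphChart

variable {n : ℕ} (C : GraphChart n)

/-- The linear parametrization of the graph of a linear function. -/
def tangent (p : Sp n →L[ℝ] ℝ) : Sp n →ₗ[ℝ] Sp (n + 1) where
  toFun y := C.ofCoord y (p y)
  map_add' y y' := by rw [map_add, ofCoord_add]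
  map_smul' c y := by rw [map_smul, RingHom.id_apply, smul_ofCoord, smul_eq_mul]

/-- The Gram matrix of the parametrization is a rank-one perturbation of the identity. -/
theorem normDet_tangent (p : Sp n →L[ℝ] ℝ) : (C.tangent p).normDet = √(1 + ‖p‖ ^ 2) := by
  have h0 := (C.tangent p).normDet_nonneg
  rw [← Real.sqrt_sq h0]
  congr 1
  let b := EuclideanSpace.basisFun (Fin n) ℝ
  have h1 := (C.tangent p).normDet_sq_eq_det_gram b
  have h2 : Matrix.gram ℝ (fun i => C.tangent p (b i)) =
      1 + Matrix.replicateCol (Fin 1) (fun i => p (b i)) *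
        Matrix.replicateRow (Fin 1) (fun i => p (b i)) := by
    ext i j
    simp only [Matrix.gram_apply, tangent, LinearMap.coe_mk, AddHom.coe_mk, inner_ofCoord,
      Matrix.add_apply, Matrix.mul_apply, Matrix.replicateCol_apply, Matrix.replicateRow_apply,
      Finset.univ_unique, Finset.sum_singleton, Matrix.one_apply]
    rw [orthonormal_iff_ite.1 b.orthonormal i j]
  rw [h2, Matrix.det_one_add_mul_comm, Matrix.det_unique] at h1
  have h3 : ‖p‖ ^ 2 = ∑ i, p (b i) * p (b i) := by
    rw [← (InnerProductSpace.toDual ℝ (Sp n)).symm.norm_map p, ← b.sum_sq_norm_inner_left]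
    refine Finset.sum_congr rfl fun i _ => ?_
    rw [InnerProductSpace.toDual_symm_apply, Real.norm_eq_abs, sq_abs, sq]
  rw [h3]
  simpa [Matrix.mul_apply] using h1

theorem hausdorff_tangent (p : Sp n →L[ℝ] ℝ) (A : Set (Sp n)) :
    (μHE[n] : Measure (Sp (n + 1))) (C.tangent p '' A) =
      ENNReal.ofReal (√(1 + ‖p‖ ^ 2)) * volume A := by
  have := (C.tangent p).euclideanHausdorffMeasure_image_eq_normDet_mul_volume A
  rwa [finrank_euclideanSpace_fin, normDet_tangent] at this

theorem _root_.LipschitzOnWith.euclideanHausdorffMeasure_image_le {X Y : Type*}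
    [MetricSpace X] [MeasurableSpace X] [BorelSpace X] [MetricSpace Y] [MeasurableSpace Y]
    [BorelSpace Y] {f : X → Y} {K : NNReal} {s : Set X} (h : LipschitzOnWith K f s) (d : ℕ) :
    (μHE[d] : Measure Y) (f '' s) ≤ (K : ENNReal) ^ d * (μHE[d] : Measure X) s := by
  have := h.hausdorffMeasure_image_le (d := (d : ℝ)) (by positivity)
  rw [ENNReal.rpow_natCast] at this
  simp only [Measure.euclideanHausdorffMeasure_def, Measure.smul_apply, ENNReal.smul_def,
    smul_eq_mul]
  rw [mul_left_comm]
  gcongr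

/-- Where `ψ` is approximated by a linear function, the graph and the graph of the linear
function are bi-Lipschitz images of each other with constants close to one. -/
theorem hausdorff_of_approximates {p : Sp n →L[ℝ] ℝ} {A : Set (Sp n)} {ε : NNReal}
    (h : ApproximatesLinearOn C.ψ p A ε) :
    (μHE[n] : Measure (Sp (n + 1))) (C.gr '' A) ≤
        ((1 + ε : NNReal) : ENNReal) ^ n * (μHE[n] : Measure (Sp (n + 1))) (C.tangent p '' A) ∧
      (μHE[n] : Measure (Sp (n + 1))) (C.tangent p '' A) ≤
        ((1 + ε : NNReal) : ENNReal) ^ n * (μHE[n] : Measure (Sp (n + 1))) (C.gr '' A) := by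
  have base_tangent : ∀ y, C.base (C.tangent p y) = y := fun y => by simp [tangent]
  have diff : ∀ y ∈ A, ∀ z ∈ A,
      ‖(C.gr y - C.gr z) - (C.tangent p y - C.tangent p z)‖ ≤ ε * ‖y - z‖ := fun y hy z hz => by
    have e1 : (C.gr y - C.gr z) - (C.tangent p y - C.tangent p z) =
        C.ofCoord 0 (C.ψ y - C.ψ z - p (y - z)) := by
      simp [gr, tangent, ofCoord_sub]
    rw [e1]
    refine (C.norm_ofCoord_le _ _).trans ?_
    simpa using h y hy z hz
  have le1 : ∀ y z, ‖y - z‖ ≤ ‖C.gr y - C.gr z‖ := fun y z => by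
    rw [gr, gr, ofCoord_sub]
    exact C.norm_le_norm_ofCoord _ _
  have le2 : ∀ y z, ‖y - z‖ ≤ ‖C.tangent p y - C.tangent p z‖ := fun y z => by
    simp only [tangent, LinearMap.coe_mk, AddHom.coe_mk, ofCoord_sub]
    exact C.norm_le_norm_ofCoord _ _
  constructor
  · have e : C.gr '' A = (fun x => C.gr (C.base x)) '' (C.tangent p '' A) := by
      rw [image_image]
      simp only [base_tangent]
    rw [e]
    refine LipschitzOnWith.euclideanHausdorffMeasure_image_le ?_ n
    refine LipschitzOnWith.of_dist_le_mul ?_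
    rintro _ ⟨y, hy, rfl⟩ _ ⟨z, hz, rfl⟩
    rw [base_tangent, base_tangent, dist_eq_norm, dist_eq_norm]
    have h1 := diff y hy z hz
    have h2 := norm_le_norm_add_norm_sub (C.tangent p y - C.tangent p z) (C.gr y - C.gr z)
    rw [norm_sub_rev (C.tangent p y - C.tangent p z)] at h2
    have h3 : (ε : ℝ) * ‖y - z‖ ≤ ε * ‖C.tangent p y - C.tangent p z‖ := by
      gcongr
      exact le2 y z
    push_cast
    linarith
  · have e : C.tangent p '' A = (fun x => C.tangent p (C.base x)) '' (C.gr '' A) := by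
      rw [image_image]
      simp only [base_gr]
    rw [e]
    refine LipschitzOnWith.euclideanHausdorffMeasure_image_le ?_ n
    refine LipschitzOnWith.of_dist_le_mul ?_
    rintro _ ⟨y, hy, rfl⟩ _ ⟨z, hz, rfl⟩
    rw [base_gr, base_gr, dist_eq_norm, dist_eq_norm]
    have h1 := diff y hy z hz
    have h2 := norm_le_norm_add_norm_sub (C.gr y - C.gr z) (C.tangent p y - C.tangent p z)
    have h3 : (ε : ℝ) * ‖y - z‖ ≤ ε * ‖C.gr y - C.gr z‖ := by
      gcongr
      exact le1 y z
    push_cast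
    linarith

theorem sqrt_one_add_sq_le {a b ε : ℝ} (hε : 0 ≤ ε) (h : a ≤ b + ε)
    (ha : 0 ≤ a) : √(1 + a ^ 2) ≤ (1 + ε) * √(1 + b ^ 2) := by
  have hs := Real.sq_sqrt (by positivity : 0 ≤ 1 + b ^ 2)
  have h1 : 1 ≤ √(1 + b ^ 2) := by
    rw [Real.one_le_sqrt]
    nlinarith
  have h2 : b ≤ √(1 + b ^ 2) := Real.le_sqrt_of_sq_le (by linarith)
  rw [Real.sqrt_le_left (by positivity)]
  have h3 : a ^ 2 ≤ (b + ε) ^ 2 := by gcongr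
  have h4 : 0 ≤ ε * (√(1 + b ^ 2) - b) := mul_nonneg hε (by linarith)
  have h5 : 0 ≤ ε ^ 2 * (√(1 + b ^ 2) ^ 2 - 1) := mul_nonneg (sq_nonneg _) (by rw [hs]; nlinarith)
  have h6 : 0 ≤ ε * √(1 + b ^ 2) * (√(1 + b ^ 2) - 1) := by
    apply mul_nonneg (by positivity) (by linarith)
  rw [mul_pow, hs]
  rw [hs] at h5
  nlinarith [mul_nonneg hε (sq_nonneg (b - 1)), mul_nonneg hε (sq_nonneg b)]

/-- Countably many measurable sets cover almost all of the coordinate plane, so that on each of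
them the area formula holds up to a factor close to one. -/
theorem exists_cover_area {ε : NNReal} (hε : 0 < ε) :
    ∃ S : ℕ × ℕ → Set (Sp n), (∀ i, MeasurableSet (S i)) ∧ volume (⋃ i, S i)ᶜ = 0 ∧
      ∀ i, ∀ A ⊆ S i, MeasurableSet A →
        (μHE[n] : Measure (Sp (n + 1))) (C.gr '' A) ≤ ((1 + ε : NNReal) : ENNReal) ^ (n + 1) *
            ∫⁻ y in A, ENNReal.ofReal (C.area y) ∧
          ∫⁻ y in A, ENNReal.ofReal (C.area y) ≤ ((1 + ε : NNReal) : ENNReal) ^ (n + 1) *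
            (μHE[n] : Measure (Sp (n + 1))) (C.gr '' A) := by
  let q : ℕ → (Sp n →L[ℝ] ℝ) := TopologicalSpace.denseSeq _
  let D : ℕ → Set (Sp n) := fun j =>
    {y | DifferentiableAt ℝ C.ψ y} ∩ {y | ‖fderiv ℝ C.ψ y - q j‖ < ε / 2}
  have Dm : ∀ j, MeasurableSet (D j) := fun j =>
    (measurableSet_of_differentiableAt ℝ C.ψ).inter
      (measurableSet_lt ((measurable_fderiv ℝ C.ψ).sub_const _).norm measurable_const)
  have part := fun j => exists_partition_approximatesLinearOn_of_hasFDerivWithinAt C.ψ (D j)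
    (fderiv ℝ C.ψ) (fun x hx => hx.1.hasFDerivAt.hasFDerivWithinAt) (fun _ => ε) (fun _ => hε.ne')
  choose t p _ tm tcov tapp tp using part
  refine ⟨fun i => D i.1 ∩ t i.1 i.2, fun i => (Dm i.1).inter (tm i.1 i.2), ?_, ?_⟩
  · change ∀ᵐ y, y ∈ ⋃ i : ℕ × ℕ, D i.1 ∩ t i.1 i.2
    filter_upwards [C.lip.ae_differentiableAt (μ := volume)] with y hy
    obtain ⟨j, hj⟩ := (TopologicalSpace.denseRange_denseSeq (Sp n →L[ℝ] ℝ)).exists_dist_lt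
      (fderiv ℝ C.ψ y) (by positivity : (0 : ℝ) < ε / 2)
    have hyD : y ∈ D j := ⟨hy, by rwa [dist_eq_norm] at hj⟩
    obtain ⟨k, hk⟩ := mem_iUnion.1 (tcov j hyD)
    exact mem_iUnion.2 ⟨(j, k), hyD, hk⟩
  · rintro ⟨j, k⟩ A hA hAm
    rcases A.eq_empty_or_nonempty with rfl | ⟨y₀, hy₀⟩
    · simp
    obtain ⟨y₁, hy₁, hpy₁⟩ := tp j ⟨y₀, (hA hy₀).1⟩ k
    have close : ∀ y ∈ A, ‖p j k - fderiv ℝ C.ψ y‖ ≤ ε := fun y hy => by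
      have h1 : ‖fderiv ℝ C.ψ y₁ - q j‖ < ε / 2 := hy₁.2
      have h2 : ‖fderiv ℝ C.ψ y - q j‖ < ε / 2 := (hA hy).1.2
      rw [hpy₁, ← sub_sub_sub_cancel_right _ _ (q j)]
      exact (norm_sub_le _ _).trans (by linarith)
    have area1 : ∀ y ∈ A, √(1 + ‖p j k‖ ^ 2) ≤ (1 + ε) * C.area y := fun y hy =>
      sqrt_one_add_sq_le ε.2
        ((norm_le_norm_add_norm_sub (fderiv ℝ C.ψ y) (p j k)).trans (by
          rw [norm_sub_rev]; gcongr; exact close y hy)) (norm_nonneg _)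
    have area2 : ∀ y ∈ A, C.area y ≤ (1 + ε) * √(1 + ‖p j k‖ ^ 2) := fun y hy =>
      sqrt_one_add_sq_le ε.2
        ((norm_le_norm_add_norm_sub (p j k) (fderiv ℝ C.ψ y)).trans (by
          gcongr; exact close y hy)) (norm_nonneg _)
    have happ : ApproximatesLinearOn C.ψ (p j k) A ε := (tapp j k).mono_set hA
    obtain ⟨b1, b2⟩ := C.hausdorff_of_approximates happ
    rw [hausdorff_tangent] at b1 b2
    have cast : ENNReal.ofReal (1 + (ε : ℝ)) = ((1 + ε : NNReal) : ENNReal) := by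
      rw [← ENNReal.ofReal_coe_nnreal]
      push_cast
      rfl
    constructor
    · refine b1.trans ?_
      rw [pow_succ ((1 + ε : NNReal) : ENNReal) n, mul_assoc]
      refine mul_le_mul' le_rfl ?_
      rw [← setLIntegral_const, ← lintegral_const_mul' _ _ ENNReal.coe_ne_top]
      refine setLIntegral_mono' hAm fun y hy => ?_
      rw [← cast, ← ENNReal.ofReal_mul (by positivity)]
      exact ENNReal.ofReal_le_ofReal (area1 y hy)
    · calc ∫⁻ y in A, ENNReal.ofReal (C.area y)
          ≤ ∫⁻ _ in A, ((1 + ε : NNReal) : ENNReal) * ENNReal.ofReal (√(1 + ‖p j k‖ ^ 2)) := by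
            refine setLIntegral_mono' hAm fun y hy => ?_
            rw [← cast, ← ENNReal.ofReal_mul (by positivity)]
            exact ENNReal.ofReal_le_ofReal (area2 y hy)
        _ = ((1 + ε : NNReal) : ENNReal) * (ENNReal.ofReal (√(1 + ‖p j k‖ ^ 2)) * volume A) := by
            rw [setLIntegral_const, mul_assoc]
        _ ≤ _ := by
            rw [pow_succ' ((1 + ε : NNReal) : ENNReal) n, mul_assoc]
            gcongr

/-- A comparison of two measures on the subsets of the members of a countable cover of almost all
of the space holds on the whole space. -/
theorem _root_.UnfittedNitsche.measure_le_of_cover {X : Type*} [MeasurableSpace X]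
    {μ ν : Measure X} {c : ENNReal} {ι : Type*} [Countable ι] {S : ι → Set X}
    (hS : ∀ i, MeasurableSet (S i)) (h0 : μ (⋃ i, S i)ᶜ = 0)
    (h : ∀ i, ∀ A ⊆ S i, MeasurableSet A → μ A ≤ c * ν A) {A : Set X} (hA : MeasurableSet A) :
    μ A ≤ c * ν A := by
  rcases isEmpty_or_nonempty ι with hι | hι
  · have : μ A = 0 := measure_mono_null (subset_univ A) (by simpa using h0)
    simp [this]
  obtain ⟨g, hg⟩ := exists_surjective_nat ι
  have hU : (⋃ i, S i) = ⋃ k, disjointed (fun k => S (g k)) k := by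
    rw [iUnion_disjointed, hg.iUnion_comp S]
  have dm : ∀ k, MeasurableSet (disjointed (fun k => S (g k)) k) :=
    MeasurableSet.disjointed fun k => hS (g k)
  calc μ A ≤ μ (A ∩ ⋃ i, S i) + μ (A ∩ (⋃ i, S i)ᶜ) := by
        conv_lhs => rw [← inter_union_compl A (⋃ i, S i)]
        exact measure_union_le _ _
    _ = μ (⋃ k, A ∩ disjointed (fun k => S (g k)) k) := by
        rw [measure_mono_null inter_subset_right h0, add_zero, hU, inter_iUnion]
    _ ≤ ∑' k, μ (A ∩ disjointed (fun k => S (g k)) k) := measure_iUnion_le _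
    _ ≤ ∑' k, c * ν (A ∩ disjointed (fun k => S (g k)) k) :=
        ENNReal.tsum_le_tsum fun k => h (g k) _
          (inter_subset_right.trans (disjointed_subset _ _)) (hA.inter (dm k))
    _ = c * ν (⋃ k, A ∩ disjointed (fun k => S (g k)) k) := by
        rw [ENNReal.tsum_mul_left, measure_iUnion]
        · exact fun i j hij => ((disjoint_disjointed (fun k => S (g k))) hij).mono
            inter_subset_right inter_subset_right
        · exact fun k => hA.inter (dm k)
    _ ≤ c * ν A := by
        gcongr
        exact iUnion_subset fun k => inter_subset_left

/-- The area formula for Lipschitz graphs. -/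
theorem comap_gr : Measure.comap C.gr (μHE[n] : Measure (Sp (n + 1))) =
    volume.withDensity fun y => ENNReal.ofReal (C.area y) := by
  set μ₁ := Measure.comap C.gr (μHE[n] : Measure (Sp (n + 1))) with hμ₁
  set μ₂ := (volume : Measure (Sp n)).withDensity fun y => ENNReal.ofReal (C.area y) with hμ₂
  have a1 : ∀ A, MeasurableSet A → μ₁ A = (μHE[n] : Measure (Sp (n + 1))) (C.gr '' A) :=
    fun A hA => C.measurableEmbedding_gr.comap_apply _ _
  have a2 : ∀ A, MeasurableSet A → μ₂ A = ∫⁻ y in A, ENNReal.ofReal (C.area y) :=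
    fun A hA => withDensity_apply _ hA
  have null1 : ∀ A, volume A = 0 → μ₁ A = 0 := fun A hA => by
    have hl : LipschitzOnWith (1 + C.K) C.gr A := LipschitzOnWith.of_dist_le_mul fun y _ z _ => by
      simpa using C.dist_gr_le y z
    have := hl.euclideanHausdorffMeasure_image_le n
    rw [EuclideanSpace.euclideanHausdorffMeasure_eq_volume, hA, mul_zero] at this
    rw [C.measurableEmbedding_gr.comap_apply]
    exact le_antisymm this bot_le
  have null2 : ∀ A, volume A = 0 → μ₂ A = 0 := fun A hA => withDensity_absolutelyContinuous _ _ hA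
  have key : ∀ ε : NNReal, 0 < ε → ∀ A, MeasurableSet A →
      μ₁ A ≤ ((1 + ε : NNReal) : ENNReal) ^ (n + 1) * μ₂ A ∧
        μ₂ A ≤ ((1 + ε : NNReal) : ENNReal) ^ (n + 1) * μ₁ A := by
    intro ε hε A hA
    obtain ⟨S, Sm, S0, hS⟩ := C.exists_cover_area hε
    exact ⟨measure_le_of_cover Sm (null1 _ S0) (fun i B hB hBm => by
        rw [a1 B hBm, a2 B hBm]; exact (hS i B hB hBm).1) hA,
      measure_le_of_cover Sm (null2 _ S0) (fun i B hB hBm => by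
        rw [a1 B hBm, a2 B hBm]; exact (hS i B hB hBm).2) hA⟩
  have lim : ∀ x : ENNReal, Tendsto (fun j : ℕ =>
      ((1 + (1 / ((j : NNReal) + 1)) : NNReal) : ENNReal) ^ (n + 1) * x) atTop (𝓝 x) := by
    intro x
    have h1 : Tendsto (fun j : ℕ => (1 + (1 / ((j : NNReal) + 1)) : NNReal) ^ (n + 1)) atTop
        (𝓝 1) := by
      have := ((tendsto_one_div_add_atTop_nhds_zero_nat (𝕜 := NNReal)).const_add 1).pow (n + 1)
      simpa using this
    have h2 := ENNReal.tendsto_coe.2 h1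
    have h3 := ENNReal.Tendsto.mul_const (b := x) h2 (Or.inl (by simp))
    simpa using h3
  ext A hA
  refine le_antisymm ?_ ?_
  · exact ge_of_tendsto' (lim _) fun j => (key _ (by positivity) A hA).1
  · exact ge_of_tendsto' (lim _) fun j => (key _ (by positivity) A hA).2

/-- The surface measure on a Lipschitz graph is the image of the Lebesgue measure weighted with
the area element. -/
theorem restrict_range_gr : (μHE[n] : Measure (Sp (n + 1))).restrict (range C.gr) =
    (volume.withDensity fun y => ENNReal.ofReal (C.area y)).map C.gr := by
  rw [← comap_gr, C.measurableEmbedding_gr.map_comap]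

end GraphChart

/-! ### Traces on a Lipschitz graph -/

theorem stronglyMeasurable_setIntegral_Ioc {Y : Type*} [MeasurableSpace Y] {W : Y × ℝ → ℝ}
    (hW : StronglyMeasurable W) :
    StronglyMeasurable fun z : Y × ℝ => ∫ σ in Ioc 0 z.2, W (z.1, σ) := by
  have h1 : StronglyMeasurable (fun q : (Y × ℝ) × ℝ =>
      ({q : (Y × ℝ) × ℝ | 0 < q.2 ∧ q.2 ≤ q.1.2}).indicator (fun q => W (q.1.1, q.2)) q) := by
    refine StronglyMeasurable.indicator (hW.comp_measurable (by fun_prop)) ?_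
    exact (measurableSet_lt measurable_const measurable_snd).inter
      (measurableSet_le measurable_snd (by fun_prop))
  have h2 := StronglyMeasurable.integral_prod_right (ν := (volume : Measure ℝ))
    (f := fun (z : Y × ℝ) σ => ({q : (Y × ℝ) × ℝ | 0 < q.2 ∧ q.2 ≤ q.1.2}).indicator
      (fun q => W (q.1.1, q.2)) (z, σ)) h1
  convert h2 using 2 with z
  rw [← integral_indicator measurableSet_Ioc]
  rfl

/-- Jensen's inequality for the square, for a finite measure. -/
theorem sq_integral_le {X : Type*} [MeasurableSpace X] {ν : Measure X} [IsFiniteMeasure ν]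
    {f : X → ℝ} (hf : MemLp f 2 ν) : (∫ x, f x ∂ν) ^ 2 ≤ ν.real univ * ∫ x, f x ^ 2 ∂ν := by
  set M := ν.real univ with hM
  set I := ∫ x, f x ∂ν with hI
  have hM0 : 0 ≤ M := measureReal_nonneg
  have i1 : Integrable f ν := hf.integrable (by norm_num)
  have i2 := hf.integrable_sq
  have h1 : 0 ≤ ∫ x, (M * f x - I) ^ 2 ∂ν := integral_nonneg fun x => sq_nonneg _
  have h2 : ∫ x, (M * f x - I) ^ 2 ∂ν = M * (M * (∫ x, f x ^ 2 ∂ν) - I ^ 2) := by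
    have e : ∀ x, (M * f x - I) ^ 2 = (M ^ 2 * f x ^ 2 - 2 * M * I * f x) + I ^ 2 := fun x => by ring
    simp_rw [e]
    have j1 : Integrable (fun x => M ^ 2 * f x ^ 2) ν := i2.const_mul _
    have j2 : Integrable (fun x => 2 * M * I * f x) ν := i1.const_mul _
    have j3 : Integrable (fun x => M ^ 2 * f x ^ 2 - 2 * M * I * f x) ν := j1.sub j2
    rw [integral_add j3 (integrable_const _), integral_sub j1 j2, integral_const_mul,
      integral_const_mul, integral_const, smul_eq_mul, ← hI, ← hM]
    ring
  rcases hM0.eq_or_lt with h0 | h0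
  · have : ν = 0 := by
      rw [← Measure.measure_univ_eq_zero]
      exact (measureReal_eq_zero_iff (measure_ne_top _ _)).1 (hM ▸ h0.symm)
    simp [hI, this]
  · rw [h2] at h1
    have := nonneg_of_mul_nonneg_right h1 h0
    linarith

/-- A function that is, on almost every vertical segment of length `r` over `B`, up to a constant
an integral of `W` whenever two of its points have a fixed distance, is on almost every vertical
segment an integral of `W`. -/
theorem exists_eq_add_integral {Y : Type*} [MeasurableSpace Y] {μ : Measure Y} [SFinite μ]
    {F W : Y × ℝ → ℝ} (hF : StronglyMeasurable F) (hW : StronglyMeasurable W)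
    (iW : Integrable W (μ.prod volume)) {B : Set Y} (hB : MeasurableSet B) {r : ℝ} (hr : 0 < r)
    (h : ∀ h, 0 < h → h < r → ∀ᵐ z ∂μ.prod volume, z.1 ∈ B → 0 < z.2 → z.2 + h < r →
      F (z.1, z.2 + h) - F z = ∫ σ in Ioc 0 h, W (z.1, z.2 + σ)) :
    ∃ g : Y → ℝ, StronglyMeasurable g ∧ ∀ᵐ y ∂μ, y ∈ B → ∀ᵐ s, 0 < s → s < r / 2 →
      F (y, s) = g y + ∫ σ in Ioc 0 s, W (y, σ) := by
  set H : Y × ℝ → ℝ := fun z => F z - ∫ σ in Ioc 0 z.2, W (z.1, σ) with hH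
  have Hm : StronglyMeasurable H := hF.sub (stronglyMeasurable_setIntegral_Ioc hW)
  have Wae : ∀ᵐ z ∂μ.prod (volume : Measure ℝ), Integrable (fun σ => W (z.1, σ)) :=
    Measure.quasiMeasurePreserving_fst.ae iW.prod_right_ae
  have step : ∀ᵐ h : ℝ, ∀ᵐ z ∂μ.prod volume, (z.1 ∈ B ∧ 0 < z.2 ∧ 0 < h ∧ z.2 + h < r) →
      H (z.1, z.2 + h) = H z := by
    refine ae_of_all _ fun t => ?_
    by_cases ht : 0 < t ∧ t < r
    · filter_upwards [h t ht.1 ht.2, Wae] with z hz hi hc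
      have h1 := hz hc.1 hc.2.1 hc.2.2.2
      have h2 : ∫ σ in Ioc 0 t, W (z.1, z.2 + σ) = ∫ σ in Ioc z.2 (z.2 + t), W (z.1, σ) := by
        rw [← intervalIntegral.integral_of_le ht.1.le,
          ← intervalIntegral.integral_of_le (by linarith),
          intervalIntegral.integral_comp_add_left (fun σ => W (z.1, σ))]
        simp
      have h3 : ∫ σ in Ioc 0 (z.2 + t), W (z.1, σ) =
          (∫ σ in Ioc 0 z.2, W (z.1, σ)) + ∫ σ in Ioc z.2 (z.2 + t), W (z.1, σ) := by
        rw [← intervalIntegral.integral_of_le (by linarith),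
          ← intervalIntegral.integral_of_le hc.2.1.le,
          ← intervalIntegral.integral_of_le (by linarith),
          intervalIntegral.integral_add_adjacent_intervals hi.intervalIntegrable
            hi.intervalIntegrable]
      simp only [hH]
      rw [h3]
      have h4 : F (z.1, z.2) = F z := rfl
      linarith [h1, h2]
    · refine ae_of_all _ fun z hc => absurd ⟨hc.2.2.1, ?_⟩ ht
      linarith [hc.2.1, hc.2.2.2]
  have meas : MeasurableSet {x : ℝ × (Y × ℝ) | (x.2.1 ∈ B ∧ 0 < x.2.2 ∧ 0 < x.1 ∧ x.2.2 + x.1 < r) →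
      H (x.2.1, x.2.2 + x.1) = H x.2} := by
    have m1 : MeasurableSet {x : ℝ × (Y × ℝ) |
        (x.2.1 ∈ B ∧ 0 < x.2.2 ∧ 0 < x.1 ∧ x.2.2 + x.1 < r)} := by
      refine (hB.preimage (by fun_prop : Measurable fun x : ℝ × (Y × ℝ) => x.2.1)).inter
        ((measurableSet_lt measurable_const
          (by fun_prop : Measurable fun x : ℝ × (Y × ℝ) => x.2.2)).inter
        ((measurableSet_lt measurable_const
          (by fun_prop : Measurable fun x : ℝ × (Y × ℝ) => x.1)).inter
        (measurableSet_lt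
          (by fun_prop : Measurable fun x : ℝ × (Y × ℝ) => x.2.2 + x.1) measurable_const)))
    have m2 : MeasurableSet {x : ℝ × (Y × ℝ) | H (x.2.1, x.2.2 + x.1) = H x.2} :=
      measurableSet_eq_fun (Hm.measurable.comp (by fun_prop)) (Hm.measurable.comp (by fun_prop))
    exact m1.imp m2
  have swap := Measure.ae_ae_of_ae_prod ((Measure.ae_ae_comm meas).1 step)
  refine ⟨fun y => (r / 2)⁻¹ * ∫ t in Ioo (r / 2) r, H (y, t), ?_, ?_⟩
  · exact (StronglyMeasurable.integral_prod_right (ν := volume.restrict (Ioo (r / 2) r))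
      (f := fun y t => H (y, t)) Hm).const_mul _
  · filter_upwards [swap] with y hy hyB
    filter_upwards [hy] with s hs hs0 hsr
    have h1 : ∀ᵐ t : ℝ, s < t → t < r → H (y, t) = H (y, s) := by
      have := (measurePreserving_sub_right (volume : Measure ℝ) s).quasiMeasurePreserving.ae hs
      filter_upwards [this] with t ht hst htr
      have := ht ⟨hyB, hs0, by linarith, by simpa using htr⟩
      simpa using this
    have h2 : ∫ t in Ioo (r / 2) r, H (y, t) = ∫ t in Ioo (r / 2) r, H (y, s) := by
      refine setIntegral_congr_ae measurableSet_Ioo ?_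
      filter_upwards [h1] with t ht htI
      exact ht (by linarith [htI.1]) htI.2
    rw [h2, setIntegral_const]
    have h3 : (volume : Measure ℝ).real (Ioo (r / 2) r) = r / 2 := by
      rw [Real.volume_real_Ioo_of_le (by linarith)]
      ring
    rw [h3, smul_eq_mul, inv_mul_cancel_left₀ (by positivity)]
    simp [hH]

/-- The initial values `g` are square integrable: on a suitable level `s` they are the difference
of the square integrable functions `F (·, s)` and `∫₀ˢ W (·, σ) dσ`. -/
theorem memLp_of_eq_add_integral {Y : Type*} [MeasurableSpace Y] {μ : Measure Y} [SFinite μ]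
    {F W : Y × ℝ → ℝ} (hF : StronglyMeasurable F) (hW : StronglyMeasurable W)
    (lF : MemLp F 2 (μ.prod volume)) (lW : MemLp W 2 (μ.prod volume)) {B : Set Y}
    (hB : MeasurableSet B) {r : ℝ} (hr : 0 < r) {g : Y → ℝ} (hg : StronglyMeasurable g)
    (h : ∀ᵐ y ∂μ, y ∈ B → ∀ᵐ s, 0 < s → s < r → F (y, s) = g y + ∫ σ in Ioc 0 s, W (y, σ)) :
    MemLp g 2 (μ.restrict B) := by
  have Im := stronglyMeasurable_setIntegral_Ioc hW
  have meas : MeasurableSet {x : Y × ℝ | (x.1 ∈ B ∧ 0 < x.2 ∧ x.2 < r) →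
      F x = g x.1 + ∫ σ in Ioc 0 x.2, W (x.1, σ)} := by
    have m1 : MeasurableSet {x : Y × ℝ | (x.1 ∈ B ∧ 0 < x.2 ∧ x.2 < r)} :=
      (hB.preimage measurable_fst).inter ((measurableSet_lt measurable_const measurable_snd).inter
        (measurableSet_lt measurable_snd measurable_const))
    have m2 : MeasurableSet {x : Y × ℝ | F x = g x.1 + ∫ σ in Ioc 0 x.2, W (x.1, σ)} :=
      measurableSet_eq_fun hF.measurable ((hg.measurable.comp measurable_fst).add Im.measurable)
    exact m1.imp m2
  have h' : ∀ᵐ y ∂μ, ∀ᵐ s : ℝ, (y ∈ B ∧ 0 < s ∧ s < r) →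
      F (y, s) = g y + ∫ σ in Ioc 0 s, W (y, σ) := by
    filter_upwards [h] with y hy
    by_cases hyB : y ∈ B
    · filter_upwards [hy hyB] with s hs hc
      exact hs hc.2.1 hc.2.2
    · exact ae_of_all _ fun s hc => absurd hc.1 hyB
  have h2 := (Measure.ae_ae_comm (p := fun y s => (y ∈ B ∧ 0 < s ∧ s < r) →
      F (y, s) = g y + ∫ σ in Ioc 0 s, W (y, σ)) meas).1 h'
  have h3 := lF.integrable_sq.prod_left_ae
  have hpos : ∃ᵐ s : ℝ, s ∈ Ioo 0 r := by
    rw [frequently_ae_iff]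
    change volume (Ioo 0 r) ≠ 0
    simp [hr]
  obtain ⟨s, hs, hs2, hs3⟩ := (hpos.and_eventually (h2.and h3)).exists
  have lF' : MemLp (fun y => F (y, s)) 2 μ :=
    (memLp_two_iff_integrable_sq (hF.comp_measurable (by fun_prop)).aestronglyMeasurable).2 hs3
  have lI : MemLp (fun y => ∫ σ in Ioc 0 s, W (y, σ)) 2 μ := by
    have mI : StronglyMeasurable (fun y => ∫ σ in Ioc 0 s, W (y, σ)) :=
      Im.comp_measurable (g := fun y : Y => (y, s)) (by fun_prop)
    refine (memLp_two_iff_integrable_sq mI.aestronglyMeasurable).2 ?_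
    have i1 : Integrable (fun y => s * ∫ σ, W (y, σ) ^ 2) μ :=
      (lW.integrable_sq.integral_prod_left).const_mul s
    refine i1.mono' (mI.aestronglyMeasurable.pow 2) ?_
    filter_upwards [lW.integrable_sq.prod_right_ae] with y hy
    rw [Real.norm_of_nonneg (sq_nonneg _)]
    have l1 : MemLp (fun σ => W (y, σ)) 2 volume :=
      (memLp_two_iff_integrable_sq (hW.comp_measurable (by fun_prop)).aestronglyMeasurable).2 hy
    refine (sq_integral_le (l1.restrict (Ioc 0 s))).trans ?_
    have e1 : (volume.restrict (Ioc 0 s)).real univ = s := by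
      rw [measureReal_restrict_apply_univ, Real.volume_real_Ioc_of_le hs.1.le, sub_zero]
    rw [e1]
    refine mul_le_mul_of_nonneg_left ?_ hs.1.le
    exact setIntegral_le_integral hy (ae_of_all _ fun σ => sq_nonneg _)
  refine ((lF'.sub lI).restrict B).ae_eq ?_
  rw [Filter.EventuallyEq, ae_restrict_iff' hB]
  filter_upwards [hs2] with y hy hyB
  simp [hy ⟨hyB, hs.1, hs.2⟩]

namespace GraphChart

variable {n : ℕ} (C : GraphChart n) {U : Set (Sp (n + 1))} {u w : Sp (n + 1) → ℝ}

/-- `g` gives the boundary values on the graph of a function `u` with vertical derivative `w`: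
on almost every vertical segment, `u` is the integral of `w` with initial value `g`. -/
def IsLineTrace (u w : Sp (n + 1) → ℝ) (g : Sp n → ℝ) : Prop :=
  ∀ᵐ y, y ∈ Metric.ball C.b C.r → ∀ᵐ s, 0 < s → s < C.r / 2 →
    u (C.pt (y, s)) = g y + ∫ σ in Ioc 0 s, w (C.pt (y, σ))

/-- Almost everywhere the difference of the values of `u` at two points of a vertical segment is
the integral of `w` between them, which determines the boundary values. -/
theorem exists_isLineTrace (hfit : C.Fits U) (H : WeakDerivOn U C.up u w)
    (mu : StronglyMeasurable u) (mw : StronglyMeasurable w) (iu : Integrable u)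
    (iw : Integrable w) (lu : MemLp u 2) (lw : MemLp w 2) :
    ∃ g : Sp n → ℝ, StronglyMeasurable g ∧ MemLp g 2 (volume.restrict (Metric.ball C.b C.r)) ∧
      C.IsLineTrace u w g := by
  have mF : StronglyMeasurable fun z => u (C.pt z) :=
    mu.comp_measurable C.continuous_pt.measurable
  have mW : StronglyMeasurable fun z => w (C.pt z) :=
    mw.comp_measurable C.continuous_pt.measurable
  have iW : Integrable (fun z => w (C.pt z)) ((volume : Measure (Sp n)).prod volume) :=
    C.measurePreserving_pt.integrable_comp_of_integrable iw
  obtain ⟨g, hg, hgl⟩ := exists_eq_add_integral (μ := (volume : Measure (Sp n))) mF mW iW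
    (B := Metric.ball C.b C.r) measurableSet_ball C.r_pos (by
      intro h hh hhr
      have T := H.ae_sub_eq_integral iu iw
        (V := {x | C.base x ∈ Metric.ball C.b C.r ∧ 0 < C.height x ∧ C.height x < C.r - h})
        ((Metric.isOpen_ball.preimage C.base.continuous).inter
          ((isOpen_lt continuous_const C.continuous_height).inter
            (isOpen_lt C.continuous_height continuous_const))) hh.le ?_
      · have T' := C.measurePreserving_pt.quasiMeasurePreserving.ae T
        filter_upwards [T'] with z hz hzB hz0 hzr
        have := hz ⟨by simpa using hzB, by simpa using hz0, by simp; linarith⟩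
        have e : ∀ σ, C.pt z + σ • C.up = C.pt (z.1, z.2 + σ) := fun σ => C.pt_add_up z.1 z.2 σ
        simpa only [e] using this
      · rintro x ⟨hx1, hx2, hx3⟩ σ hσ
        have e : x + σ • C.up = C.pt (C.base x, C.height x + σ) := by
          rw [← pt_add_up, pt_base_height]
        have hpos : 0 < C.height x + σ := by linarith [hσ.1]
        rw [e, hfit _ ⟨by simpa using hx1, ?_⟩]
        · simpa using hpos
        · rw [height_pt, abs_of_pos hpos]
          linarith [hσ.2])
  have lF : MemLp (fun z => u (C.pt z)) 2 ((volume : Measure (Sp n)).prod volume) :=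
    lu.comp_measurePreserving C.measurePreserving_pt
  have lW : MemLp (fun z => w (C.pt z)) 2 ((volume : Measure (Sp n)).prod volume) :=
    lw.comp_measurePreserving C.measurePreserving_pt
  exact ⟨g, hg, memLp_of_eq_add_integral mF mW lF lW measurableSet_ball (half_pos C.r_pos) hg hgl,
    hgl⟩

/-- The integral of the absolute value of `w` over the vertical segment of length `δ`; it bounds
the variation along the segment of a function with vertical derivative `w`. -/
def seg (w : Sp (n + 1) → ℝ) (δ : ℝ) (y : Sp n) : ℝ := ∫ σ in Ioc 0 δ, ‖w (C.pt (y, σ))‖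

theorem seg_nonneg (w : Sp (n + 1) → ℝ) (δ : ℝ) (y : Sp n) : 0 ≤ C.seg w δ y :=
  integral_nonneg fun _ => norm_nonneg _

theorem integrable_pt (iw : Integrable w) :
    Integrable (fun z => w (C.pt z)) ((volume : Measure (Sp n)).prod volume) :=
  C.measurePreserving_pt.integrable_comp_of_integrable iw

theorem integrable_seg (iw : Integrable w) (δ : ℝ) : Integrable (C.seg w δ) := by
  have h1 := (C.integrable_pt iw).norm
  have h2 : Integrable (fun z => ‖w (C.pt z)‖)
      ((volume : Measure (Sp n)).prod (volume.restrict (Ioc 0 δ))) := by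
    have := h1.restrict (s := univ ×ˢ Ioc 0 δ)
    rwa [← Measure.prod_restrict, Measure.restrict_univ] at this
  exact h2.integral_prod_left

theorem IsLineTrace.norm_sub_le {g : Sp n → ℝ} (h : C.IsLineTrace u w g) (iw : Integrable w)
    {δ : ℝ} (hδ : δ < C.r / 2) :
    ∀ᵐ y, y ∈ Metric.ball C.b C.r → ∀ᵐ s, 0 < s → s ≤ δ →
      ‖u (C.pt (y, s)) - g y‖ ≤ C.seg w δ y := by
  filter_upwards [h, (C.integrable_pt iw).prod_right_ae] with y hy hi hyB
  filter_upwards [hy hyB] with s hs hs0 hsδ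
  rw [hs hs0 (by linarith), add_sub_cancel_left]
  refine (norm_integral_le_integral_norm _).trans ?_
  refine setIntegral_mono_set hi.norm.integrableOn (ae_of_all _ fun _ => norm_nonneg _) ?_
  exact (Ioc_subset_Ioc_right hsδ).eventuallyLE

theorem tendsto_seg_zero (iw : Integrable w) :
    ∀ᵐ y, Tendsto (fun m : ℕ => C.seg w (1 / ((m : ℝ) + 1)) y) atTop (𝓝 0) := by
  filter_upwards [(C.integrable_pt iw).prod_right_ae] with y hi
  have h1 := tendsto_setIntegral_of_antitone (μ := (volume : Measure ℝ))
    (s := fun m : ℕ => Ioc (0 : ℝ) (1 / ((m : ℝ) + 1)))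
    (f := fun σ => ‖w (C.pt (y, σ))‖) (fun _ => measurableSet_Ioc)
    (fun i j hij => Ioc_subset_Ioc_right (Nat.one_div_le_one_div hij)) ⟨0, hi.norm.integrableOn⟩
  have h2 : (⋂ m : ℕ, Ioc (0 : ℝ) (1 / ((m : ℝ) + 1))) = ∅ := by
    ext s
    simp only [mem_iInter, mem_empty_iff_false, iff_false, not_forall]
    by_cases hs : 0 < s
    · obtain ⟨m, hm⟩ := exists_nat_one_div_lt hs
      exact ⟨m, fun h => absurd h.2 (not_le.2 hm)⟩
    · exact ⟨0, fun h => hs h.1⟩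
  rw [h2] at h1
  simpa [seg] using h1

/-- At almost every point of the graph, the averages of `u` over small half balls converge to the
boundary value: at a common Lebesgue point of the boundary values and of the vertical variations
of `u`, the average deviation is controlled by averages over balls in the base. -/
theorem IsLineTrace.hasTrace {g : Sp n → ℝ} (h : C.IsLineTrace u w g) (hfit : C.Fits U)
    (iu : Integrable u) (iw : Integrable w) (hg : IntegrableOn g (Metric.ball C.b C.r)) :
    ∀ᵐ y, y ∈ Metric.ball C.b C.r → HasTrace U u (C.gr y) (g y) := by
  set B := Metric.ball C.b C.r with hB
  set g₁ := B.indicator g with hg₁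
  have ig₁ : Integrable g₁ := hg.integrable_indicator measurableSet_ball
  set δ : ℕ → ℝ := fun m => min (1 / ((m : ℝ) + 1)) (C.r / 4) with hδ
  have δpos : ∀ m, 0 < δ m := fun m => lt_min (by positivity) (by have := C.r_pos; positivity)
  have L1 := IsUnifLocDoublingMeasure.ae_tendsto_average_norm_sub (volume : Measure (Sp n))
    ig₁.locallyIntegrable 1
  have L2 := ae_all_iff.2 fun m => IsUnifLocDoublingMeasure.ae_tendsto_average
    (volume : Measure (Sp n)) (C.integrable_seg iw (δ m)).locallyIntegrable 1
  have L3 := ae_all_iff.2 fun m => h.norm_sub_le C iw (δ := δ m)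
    ((min_le_right _ _).trans_lt (by have := C.r_pos; linarith))
  have L3' : ∀ m, ∀ᵐ y ∂volume.restrict B, ∀ᵐ s, 0 < s → s ≤ δ m →
      ‖u (C.pt (y, s)) - g y‖ ≤ C.seg w (δ m) y := fun m => by
    rw [ae_restrict_iff' measurableSet_ball]
    exact ae_all_iff.1 L3 m
  filter_upwards [L1, L2, C.tendsto_seg_zero iw] with y₀ h1 h2 h3 hy₀
  set M : ℝ := 1 + C.K with hM
  have hM1 : 1 ≤ M := by simp [hM]
  set κ : ℝ := 1 / (3 + C.K) with hκ
  have hκ0 : 0 < κ := by positivity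
  set A : ℝ := M / κ ^ (n + 1) with hA
  have hA0 : 0 < A := by positivity
  have bound : ∀ m, ∀ᶠ ρ in 𝓝[>] (0 : ℝ),
      ‖(⨍ x in Metric.ball (C.gr y₀) ρ ∩ U, u x) - g y₀‖ ≤
        A * ((⨍ y in Metric.closedBall y₀ ρ, ‖g₁ y - g₁ y₀‖) +
          ⨍ y in Metric.closedBall y₀ ρ, C.seg w (δ m) y) := by
    intro m
    have e1 : ∀ᶠ ρ in 𝓝[>] (0 : ℝ), Metric.closedBall y₀ ρ ⊆ B := by
      obtain ⟨ε, hε, hb⟩ := Metric.isOpen_iff.1 Metric.isOpen_ball y₀ hy₀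
      filter_upwards [Ioo_mem_nhdsGT hε] with ρ hρ
      exact (Metric.closedBall_subset_ball hρ.2).trans hb
    have e2 : ∀ᶠ ρ in 𝓝[>] (0 : ℝ), Metric.ball (C.gr y₀) ρ ⊆ C.box := by
      obtain ⟨ε, hε, hb⟩ := Metric.isOpen_iff.1 C.isOpen_box _ (C.gr_mem_box hy₀)
      filter_upwards [Ioo_mem_nhdsGT hε] with ρ hρ
      exact (Metric.ball_subset_ball hρ.2.le).trans hb
    have e3 : ∀ᶠ ρ in 𝓝[>] (0 : ℝ), M * ρ ≤ δ m := by
      filter_upwards [Ioo_mem_nhdsGT (div_pos (δpos m) (one_pos.trans_le hM1))] with ρ hρ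
      rw [mul_comm, ← le_div_iff₀ (by linarith)]
      exact hρ.2.le
    filter_upwards [e1, e2, e3, self_mem_nhdsWithin] with ρ hρB hρbox hρδ (hρ : 0 < ρ)
    set S := Metric.ball (C.gr y₀) ρ ∩ U with hS
    set c := g y₀ with hc
    set cB := Metric.closedBall y₀ ρ with hcB
    have hMρ : 0 < M * ρ := by positivity
    have Seq : S = Metric.ball (C.gr y₀) ρ ∩ {x | 0 < C.height x} := by
      ext x
      exact and_congr_right fun hx => hfit x (hρbox hx)
    have Sm : MeasurableSet S := by
      rw [Seq]
      exact measurableSet_ball.inter (measurableSet_lt measurable_const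
        C.continuous_height.measurable)
    -- the half ball lies over the ball `cB`, below height `M ρ`
    have sub1 : C.pt ⁻¹' S ⊆ cB ×ˢ Ioc 0 (M * ρ) := by
      rintro z hz
      rw [Seq] at hz
      have hz1 : dist (C.pt z) (C.gr y₀) < ρ := hz.1
      have hz2 : 0 < C.height (C.pt z) := hz.2
      rw [height_pt] at hz2
      refine ⟨?_, hz2, ?_⟩
      · have := C.dist_base_le (C.pt z) (C.gr y₀)
        rw [base_pt, base_gr] at this
        exact this.trans hz1.le
      · have := C.lipschitz_height.dist_le_mul (C.pt z) (C.gr y₀)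
        rw [height_pt, height_gr, Real.dist_eq, sub_zero, abs_of_pos hz2] at this
        refine this.trans ?_
        push_cast
        gcongr
    -- the half ball contains a cylinder of comparable size
    have sub2 : Metric.closedBall y₀ (κ * ρ) ×ˢ Ioo 0 (κ * ρ) ⊆ C.pt ⁻¹' S := by
      rintro z ⟨hz1, hz2⟩
      rw [Seq]
      refine ⟨?_, ?_⟩
      · have k1 := C.dist_pt_le z (y₀, 0)
        rw [pt_zero] at k1
        simp only [sub_zero, abs_of_pos hz2.1] at k1
        have k2 : dist z.1 y₀ ≤ κ * ρ := hz1
        have k3 : (1 + (C.K : ℝ)) * dist z.1 y₀ ≤ (1 + C.K) * (κ * ρ) := by gcongr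
        have k4 : (3 + (C.K : ℝ)) * (κ * ρ) = ρ := by simp only [hκ]; field_simp
        have k5 : 0 < κ * ρ := by positivity
        rw [Metric.mem_ball]
        have := hz2.2
        nlinarith
      · change 0 < C.height (C.pt z)
        rw [height_pt]
        exact hz2.1
    have Sfin : volume S ≠ ⊤ := ((measure_mono inter_subset_left).trans_lt measure_ball_lt_top).ne
    have volS : κ ^ (n + 1) * ρ * volume.real cB ≤ volume.real S := by
      have v1 : volume S = volume (C.pt ⁻¹' S) :=
        (C.measurePreserving_pt.measure_preimage Sm.nullMeasurableSet).symm
      have v2 : (volume.real S) = volume.real (C.pt ⁻¹' S) := by rw [Measure.real, v1, Measure.real]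
      have v3 : volume.real (Metric.closedBall y₀ (κ * ρ) ×ˢ Ioo 0 (κ * ρ)) ≤
          volume.real (C.pt ⁻¹' S) := measureReal_mono sub2 (by rw [← v1]; exact Sfin)
      have v4 : volume.real (Metric.closedBall y₀ (κ * ρ) ×ˢ Ioo 0 (κ * ρ)) =
          κ ^ (n + 1) * ρ * volume.real cB := by
        rw [Measure.volume_eq_prod, measureReal_prod_prod, Real.volume_real_Ioo_of_le (by positivity),
          hcB, Measure.addHaar_real_closedBall _ _ (by positivity),
          Measure.addHaar_real_closedBall _ _ hρ.le, finrank_euclideanSpace_fin]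
        ring
      rw [v2, ← v4]
      exact v3
    have cBpos : 0 < volume.real cB :=
      ENNReal.toReal_pos (Metric.measure_closedBall_pos _ _ hρ).ne' measure_closedBall_lt_top.ne
    have Spos : 0 < volume.real S := lt_of_lt_of_le (by positivity) volS
    have avg : (⨍ x in S, u x) - c = (volume.real S)⁻¹ * ∫ x in S, (u x - c) := by
      rw [setAverage_eq, integral_sub iu.integrableOn (integrableOn_const Sfin), setIntegral_const,
        smul_eq_mul, smul_eq_mul, mul_sub, inv_mul_cancel_left₀ Spos.ne']
    have iR : IntegrableOn (fun z => ‖u (C.pt z) - c‖) (cB ×ˢ Ioc 0 (M * ρ)) := by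
      refine Integrable.norm (Integrable.sub (C.integrable_pt iu).integrableOn ?_)
      refine integrableOn_const ?_
      rw [Measure.volume_eq_prod, Measure.prod_prod]
      exact (ENNReal.mul_lt_top measure_closedBall_lt_top measure_Ioc_lt_top).ne
    have icB : IntegrableOn (fun y => ‖g₁ y - g₁ y₀‖ + C.seg w (δ m) y) cB :=
      ((ig₁.integrableOn.sub (integrableOn_const measure_closedBall_lt_top.ne)).norm).add
        (C.integrable_seg iw _).integrableOn
    have est : ∫ x in S, ‖u x - c‖ ≤
        M * ρ * ∫ y in cB, (‖g₁ y - g₁ y₀‖ + C.seg w (δ m) y) := by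
      rw [← C.measurePreserving_pt.setIntegral_preimage_emb C.measurableEmbedding_pt]
      calc ∫ z in C.pt ⁻¹' S, ‖u (C.pt z) - c‖
          ≤ ∫ z in cB ×ˢ Ioc 0 (M * ρ), ‖u (C.pt z) - c‖ :=
            setIntegral_mono_set iR (ae_of_all _ fun _ => norm_nonneg _) sub1.eventuallyLE
        _ = ∫ y in cB, ∫ s in Ioc 0 (M * ρ), ‖u (C.pt (y, s)) - c‖ := setIntegral_prod _ iR
        _ ≤ ∫ y in cB, M * ρ * (‖g₁ y - g₁ y₀‖ + C.seg w (δ m) y) := by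
            refine integral_mono_of_nonneg (ae_of_all _ fun y => ?_) (icB.const_mul _) ?_
            · exact integral_nonneg fun _ => norm_nonneg _
            · filter_upwards [ae_restrict_of_ae_restrict_of_subset hρB (L3' m),
                ae_restrict_mem Metric.isClosed_closedBall.measurableSet] with y hy hyc
              have v : volume.real (Ioc 0 (M * ρ)) = M * ρ := by
                rw [Real.volume_real_Ioc_of_le hMρ.le, sub_zero]
              refine (integral_mono_of_nonneg (ae_of_all _ fun _ => norm_nonneg _)
                (integrable_const (‖g₁ y - g₁ y₀‖ + C.seg w (δ m) y)) ?_).trans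
                (by rw [integral_const, measureReal_restrict_apply_univ, v, smul_eq_mul])
              rw [Filter.EventuallyLE, ae_restrict_iff' measurableSet_Ioc]
              filter_upwards [hy] with s hs hsI
              have q1 := hs hsI.1 (hsI.2.trans hρδ)
              have q2 : g₁ y = g y := indicator_of_mem (hρB hyc) g
              have q3 : g₁ y₀ = c := indicator_of_mem hy₀ g
              rw [q2, q3]
              calc ‖u (C.pt (y, s)) - c‖ = ‖(g y - c) + (u (C.pt (y, s)) - g y)‖ := by
                    congr 1; ring
                _ ≤ _ := (norm_add_le _ _).trans (by gcongr)
        _ = _ := integral_const_mul _ _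
    rw [avg, norm_mul, Real.norm_of_nonneg (by positivity)]
    have i1 : IntegrableOn (fun y => ‖g₁ y - g₁ y₀‖) cB :=
      (ig₁.integrableOn.sub (integrableOn_const measure_closedBall_lt_top.ne)).norm
    rw [setAverage_eq, setAverage_eq, smul_eq_mul, smul_eq_mul, ← mul_add,
      ← integral_add i1 (C.integrable_seg iw _).integrableOn]
    set Q := ∫ y in cB, (‖g₁ y - g₁ y₀‖ + C.seg w (δ m) y) with hQ
    have Q0 : 0 ≤ Q := integral_nonneg fun y => add_nonneg (norm_nonneg _) (C.seg_nonneg _ _ _)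
    calc (volume.real S)⁻¹ * ‖∫ x in S, (u x - c)‖
        ≤ (κ ^ (n + 1) * ρ * volume.real cB)⁻¹ * (M * ρ * Q) := by
          gcongr
          exact (norm_integral_le_integral_norm _).trans est
      _ = A * ((volume.real cB)⁻¹ * Q) := by
          simp only [hA]
          field_simp
  have lim1 := h1 (fun _ : ℝ => y₀) (fun ρ : ℝ => ρ) (l := 𝓝[>] 0) tendsto_id
    (by
      filter_upwards [self_mem_nhdsWithin] with ρ (hρ : 0 < ρ)
      rw [one_mul]
      exact Metric.mem_closedBall_self hρ.le)
  have lim2 := fun m => h2 m (fun _ : ℝ => y₀) (fun ρ : ℝ => ρ) (l := 𝓝[>] 0) tendsto_id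
    (by
      filter_upwards [self_mem_nhdsWithin] with ρ (hρ : 0 < ρ)
      rw [one_mul]
      exact Metric.mem_closedBall_self hρ.le)
  rw [HasTrace, tendsto_iff_norm_sub_tendsto_zero]
  rw [Metric.tendsto_nhds]
  intro ε hε
  have h3' : Tendsto (fun m : ℕ => A * C.seg w (1 / ((m : ℝ) + 1)) y₀) atTop (𝓝 0) := by
    simpa using h3.const_mul A
  have hδev : ∀ᶠ m : ℕ in atTop, δ m = 1 / ((m : ℝ) + 1) := by
    have := (tendsto_one_div_add_atTop_nhds_zero_nat (𝕜 := ℝ)).eventually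
      (gt_mem_nhds (show (0 : ℝ) < C.r / 4 by have := C.r_pos; positivity))
    filter_upwards [this] with m hm
    exact min_eq_left hm.le
  obtain ⟨m, hm1, hm2⟩ := ((h3'.eventually (gt_mem_nhds hε)).and hδev).exists
  have lim := ((lim1.add (lim2 m)).const_mul A)
  rw [zero_add, hm2] at lim
  have hbm := bound m
  rw [hm2] at hbm
  filter_upwards [hbm, lim.eventually (gt_mem_nhds hm1)] with ρ hρ1 hρ2
  rw [dist_zero_right, norm_norm]
  exact hρ1.trans_lt hρ2

end GraphChart

/-! ### Integration by parts above a Lipschitz graph -/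

namespace GraphChart

variable {n : ℕ} (C : GraphChart n) {U : Set (Sp (n + 1))} {u w : Sp (n + 1) → ℝ}

theorem measurable_dheight (v : Sp (n + 1)) : Measurable fun y => C.dheight y v := by
  simp only [dheight, _root_.sub_apply, ContinuousLinearMap.comp_apply]
  exact measurable_const.sub (measurable_fderiv_apply_const ℝ _ _)

theorem dheight_eq (y : Sp n) (v : Sp (n + 1)) :
    C.dheight y v = -(C.area y * inner ℝ (C.nu y) v) := by
  rw [inner_nu, mul_neg, neg_neg, mul_inv_cancel_left₀ (C.area_pos y).ne']

theorem abs_dheight_le (y : Sp n) (v : Sp (n + 1)) : |C.dheight y v| ≤ (1 + C.K) * ‖v‖ := by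
  rw [dheight_eq, abs_neg, abs_mul, abs_of_pos (C.area_pos y)]
  have h1 := abs_real_inner_le_norm (C.nu y) v
  rw [C.norm_nu, one_mul] at h1
  exact mul_le_mul (C.area_le y) h1 (abs_nonneg _) (by positivity)

theorem ae_height_ne (c : ℝ) : ∀ᵐ x, C.height x ≠ c := by
  have h1 : ∀ᵐ z ∂(volume : Measure (Sp n)).prod (volume : Measure ℝ), z.2 ≠ c :=
    Measure.quasiMeasurePreserving_snd.ae (Measure.ae_ne volume c)
  rw [← C.measurePreserving_pt.map_eq, C.measurableEmbedding_pt.ae_map_iff]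
  filter_upwards [h1] with z hz
  simpa using hz

theorem ae_differentiableAt_base : ∀ᵐ x, DifferentiableAt ℝ C.ψ (C.base x) := by
  have h1 : ∀ᵐ z ∂(volume : Measure (Sp n)).prod (volume : Measure ℝ),
      DifferentiableAt ℝ C.ψ z.1 :=
    Measure.quasiMeasurePreserving_fst.ae C.lip.ae_differentiableAt
  rw [← C.measurePreserving_pt.map_eq, C.measurableEmbedding_pt.ae_map_iff]
  filter_upwards [h1] with z hz
  simpa using hz

/-- A Lipschitz function that increases from `0` on the graph to `1` at height `ε`. -/
def ramp (ε : ℝ) (x : Sp (n + 1)) : ℝ := max 0 (min 1 (ε⁻¹ * C.height x))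

theorem ramp_nonneg (ε : ℝ) (x : Sp (n + 1)) : 0 ≤ C.ramp ε x := le_max_left _ _

theorem ramp_le_one (ε : ℝ) (x : Sp (n + 1)) : C.ramp ε x ≤ 1 :=
  max_le zero_le_one (min_le_left _ _)

theorem norm_ramp_le (ε : ℝ) (x : Sp (n + 1)) : ‖C.ramp ε x‖ ≤ 1 := by
  rw [Real.norm_of_nonneg (C.ramp_nonneg ε x)]
  exact C.ramp_le_one ε x

theorem ramp_eq_zero {ε : ℝ} (hε : 0 < ε) {x : Sp (n + 1)} (hx : C.height x ≤ 0) :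
    C.ramp ε x = 0 :=
  max_eq_left ((min_le_right _ _).trans (mul_nonpos_of_nonneg_of_nonpos (by positivity) hx))

theorem ramp_eq_one {ε : ℝ} (hε : 0 < ε) {x : Sp (n + 1)} (hx : ε ≤ C.height x) :
    C.ramp ε x = 1 := by
  have : 1 ≤ ε⁻¹ * C.height x := by rwa [← div_eq_inv_mul, one_le_div hε]
  rw [ramp, min_eq_left this, max_eq_right zero_le_one]

theorem ramp_eq {ε : ℝ} (hε : 0 < ε) {x : Sp (n + 1)} (h0 : 0 ≤ C.height x)
    (hx : C.height x ≤ ε) : C.ramp ε x = ε⁻¹ * C.height x := by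
  have : ε⁻¹ * C.height x ≤ 1 := by rwa [← div_eq_inv_mul, div_le_one hε]
  rw [ramp, min_eq_right this, max_eq_right (by positivity)]

theorem continuous_ramp (ε : ℝ) : Continuous (C.ramp ε) :=
  continuous_const.max (continuous_const.min (continuous_const.mul C.continuous_height))

theorem lipschitz_ramp (ε : ℝ) : ∃ L, LipschitzWith L (C.ramp ε) := by
  have h1 : LipschitzWith (‖ε⁻¹‖₊ * (1 + C.K)) fun x => ε⁻¹ * C.height x :=
    LipschitzWith.of_dist_le_mul fun x y => by
      rw [Real.dist_eq, ← mul_sub, abs_mul, NNReal.coe_mul, mul_assoc]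
      exact mul_le_mul_of_nonneg_left (C.lipschitz_height.dist_le_mul x y) (abs_nonneg _)
  exact ⟨_, (h1.const_min 1).const_max 0⟩

theorem hasFDerivAt_ramp {ε : ℝ} (hε : 0 < ε) {x : Sp (n + 1)}
    (hd : DifferentiableAt ℝ C.ψ (C.base x)) (h0 : C.height x ≠ 0) (h1 : C.height x ≠ ε) :
    HasFDerivAt (C.ramp ε)
      (((Ioo 0 ε).indicator (fun _ => ε⁻¹) (C.height x)) • C.dheight (C.base x)) x := by
  have hc := C.continuous_height.continuousAt (x := x)
  rcases lt_or_gt_of_ne h0 with h0 | h0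
  · rw [indicator_of_notMem (fun h => by linarith [h.1]), zero_smul]
    refine (hasFDerivAt_const (0 : ℝ) x).congr_of_eventuallyEq ?_
    filter_upwards [hc.eventually (gt_mem_nhds h0)] with y hy
    exact C.ramp_eq_zero hε hy.le
  · rcases lt_or_gt_of_ne h1 with h1 | h1
    · rw [indicator_of_mem (show C.height x ∈ Ioo 0 ε from ⟨h0, h1⟩)]
      refine ((C.hasFDerivAt_height hd).const_smul ε⁻¹).congr_of_eventuallyEq ?_
      filter_upwards [hc.eventually (gt_mem_nhds h1), hc.eventually (lt_mem_nhds h0)] with y hy hy'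
      exact C.ramp_eq hε hy'.le hy.le
    · rw [indicator_of_notMem (fun h => by linarith [h.2]), zero_smul]
      refine (hasFDerivAt_const (1 : ℝ) x).congr_of_eventuallyEq ?_
      filter_upwards [hc.eventually (lt_mem_nhds h1)] with y hy
      exact C.ramp_eq_one hε hy.le

theorem _root_.LipschitzWith.exists_mul_of_bounded {X : Type*} [PseudoMetricSpace X] {f g : X → ℝ}
    {K L : NNReal} (hf : LipschitzWith K f) (hg : LipschitzWith L g) {A B : ℝ}
    (hA : ∀ x, ‖f x‖ ≤ A) (hB : ∀ x, ‖g x‖ ≤ B) :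
    ∃ M, LipschitzWith M fun x => f x * g x := by
  refine ⟨Real.toNNReal (A * L + B * K), LipschitzWith.of_dist_le_mul fun x y => ?_⟩
  have hA0 : 0 ≤ A := (norm_nonneg _).trans (hA x)
  have hB0 : 0 ≤ B := (norm_nonneg _).trans (hB x)
  rw [Real.coe_toNNReal _ (by positivity), dist_eq_norm]
  have h1 := hf.dist_le_mul x y
  have h2 := hg.dist_le_mul x y
  rw [dist_eq_norm] at h1 h2
  calc ‖f x * g x - f y * g y‖ = ‖f x * (g x - g y) + g y * (f x - f y)‖ := by ring_nf
    _ ≤ ‖f x‖ * ‖g x - g y‖ + ‖g y‖ * ‖f x - f y‖ := by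
      rw [← norm_mul, ← norm_mul]
      exact norm_add_le _ _
    _ ≤ A * (L * dist x y) + B * (K * dist x y) := by
      gcongr
      exacts [hA x, hB y]
    _ = _ := by ring

/-- Integrals over thin layers above the graph, divided by their thickness, converge to integrals
of the boundary values. -/
theorem IsLineTrace.tendsto_layer {g : Sp n → ℝ} (h : C.IsLineTrace u w g)
    (iu : Integrable u) (iw : Integrable w) (hg : IntegrableOn g (Metric.ball C.b C.r))
    (v : Sp (n + 1)) {φ : Sp (n + 1) → ℝ} {L : NNReal} (hφ : LipschitzWith L φ)
    (hc : HasCompactSupport φ) (hbox : ∀ x ∉ C.box, φ x = 0) :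
    Tendsto (fun j : ℕ => ∫ x, u x * (φ x *
      ((Ioo 0 (1 / ((j : ℝ) + 1))).indicator (fun _ => (1 / ((j : ℝ) + 1))⁻¹) (C.height x) *
        C.dheight (C.base x) v))) atTop
      (𝓝 (∫ y in Metric.ball C.b C.r, g y * (φ (C.gr y) * C.dheight y v))) := by
  obtain ⟨M, hM⟩ := hφ.continuous.bounded_above_of_compact_support hc
  have hM0 : 0 ≤ M := (norm_nonneg _).trans (hM 0)
  set B := Metric.ball C.b C.r with hB
  set R : ℝ := (1 + C.K) * ‖v‖ with hR
  have hR0 : 0 ≤ R := by positivity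
  have hRb : ∀ y, ‖C.dheight y v‖ ≤ R := fun y => C.abs_dheight_le y v
  set ε : ℕ → ℝ := fun j => 1 / ((j : ℝ) + 1) with hε
  have εpos : ∀ j, 0 < ε j := fun j => by positivity
  have εle : ∀ j, ε j ≤ 1 := fun j => by
    rw [hε, div_le_one (by positivity)]
    simp
  have εlim : Tendsto ε atTop (𝓝 0) := tendsto_one_div_add_atTop_nhds_zero_nat
  set g₁ := B.indicator g with hg₁
  have ig₁ : Integrable g₁ := hg.integrable_indicator measurableSet_ball
  set Φ : ℕ → Sp n × ℝ → ℝ := fun j z => u (C.pt z) * (φ (C.pt z) *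
    ((Ioo 0 (ε j)).indicator (fun _ => (ε j)⁻¹) z.2 * C.dheight z.1 v)) with hΦ
  have md : Measurable fun z : Sp n × ℝ => C.dheight z.1 v :=
    (C.measurable_dheight v).comp measurable_fst
  have mΦ : ∀ j, AEStronglyMeasurable (fun z : Sp n × ℝ => φ (C.pt z) *
      ((Ioo 0 (ε j)).indicator (fun _ => (ε j)⁻¹) z.2 * C.dheight z.1 v))
      ((volume : Measure (Sp n)).prod volume) := fun j => by
    refine Measurable.aestronglyMeasurable ?_
    refine (hφ.continuous.comp C.continuous_pt).measurable.mul (Measurable.mul ?_ md)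
    exact (measurable_const.indicator measurableSet_Ioo).comp measurable_snd
  have indle : ∀ j s, ‖(Ioo 0 (ε j)).indicator (fun _ => (ε j)⁻¹) s‖ ≤ (ε j)⁻¹ := fun j s => by
    refine (norm_indicator_le_norm_self _ _).trans ?_
    rw [Real.norm_of_nonneg (inv_nonneg.2 (εpos j).le)]
  have iΦ : ∀ j, Integrable (Φ j) ((volume : Measure (Sp n)).prod volume) := fun j => by
    refine (C.integrable_pt iu).mul_bdd (c := M * ((ε j)⁻¹ * R)) (mΦ j) (ae_of_all _ fun z => ?_)
    rw [norm_mul, norm_mul]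
    exact mul_le_mul (hM _) (mul_le_mul (indle j _) (hRb _) (norm_nonneg _)
      (inv_nonneg.2 (εpos j).le)) (by positivity) hM0
  have e1 : ∀ j, (∫ x, u x * (φ x * ((Ioo 0 (ε j)).indicator (fun _ => (ε j)⁻¹) (C.height x) *
        C.dheight (C.base x) v))) = ∫ y, ∫ s, Φ j (y, s) := fun j => by
    rw [← integral_prod _ (iΦ j),
      ← C.measurePreserving_pt.integral_comp C.measurableEmbedding_pt]
    simp only [base_pt, height_pt, hΦ]
    rfl
  have e2 : (∫ y in B, g y * (φ (C.gr y) * C.dheight y v)) =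
      ∫ y, g₁ y * (φ (C.gr y) * C.dheight y v) := by
    rw [← integral_indicator measurableSet_ball]
    congr 1 with y
    by_cases hy : y ∈ B
    · simp [hg₁, hB.symm, hy]
    · simp [hg₁, hB.symm, hy]
  have key : ∀ᶠ j in atTop, ∀ᵐ y, ‖(∫ s, Φ j (y, s)) - g₁ y * (φ (C.gr y) * C.dheight y v)‖ ≤
      R * (M * C.seg w (ε j) y + ‖g₁ y‖ * (L * ε j)) := by
    have hr2 : (0 : ℝ) < C.r / 2 := by have := C.r_pos; positivity
    filter_upwards [εlim.eventually (gt_mem_nhds hr2)] with j hj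
    filter_upwards [h.norm_sub_le C iw hj, (C.integrable_pt iu).prod_right_ae] with y hy hyi
    have segn := C.seg_nonneg w (ε j) y
    by_cases hyB : y ∈ B
    · have q : g₁ y = g y := indicator_of_mem hyB g
      rw [q]
      set c := φ (C.gr y) * C.dheight y v with hcdef
      have a1 : ∫ s, Φ j (y, s) =
          ∫ s in Ioo 0 (ε j), (ε j)⁻¹ * (u (C.pt (y, s)) * (φ (C.pt (y, s)) * C.dheight y v)) := by
        rw [← integral_indicator measurableSet_Ioo]
        congr 1 with s
        by_cases hs : s ∈ Ioo 0 (ε j)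
        · simp only [hΦ, indicator_of_mem hs]
          ring
        · simp only [hΦ, indicator_of_notMem hs]
          ring
      have vε : (volume : Measure ℝ).real (Ioo 0 (ε j)) = ε j := by
        rw [Real.volume_real_Ioo_of_le (εpos j).le, sub_zero]
      have a2 : g y * c = ∫ s in Ioo 0 (ε j), (ε j)⁻¹ * (g y * c) := by
        rw [setIntegral_const, vε, smul_eq_mul, mul_inv_cancel_left₀ (εpos j).ne']
      have i1 : IntegrableOn
          (fun s => (ε j)⁻¹ * (u (C.pt (y, s)) * (φ (C.pt (y, s)) * C.dheight y v)))
          (Ioo 0 (ε j)) := by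
        refine Integrable.integrableOn (Integrable.const_mul ?_ _)
        refine hyi.mul_bdd (c := M * R) ?_ (ae_of_all _ fun s => ?_)
        · exact ((hφ.continuous.comp (C.continuous_pt.comp (by fun_prop))).mul
            continuous_const).aestronglyMeasurable
        · rw [norm_mul]
          exact mul_le_mul (hM _) (hRb y) (norm_nonneg _) hM0
      rw [a1, a2, ← integral_sub i1 (integrableOn_const measure_Ioo_lt_top.ne)]
      refine (norm_setIntegral_le_of_norm_le_const_ae (C := (ε j)⁻¹ *
        (R * (M * C.seg w (ε j) y + ‖g y‖ * (L * ε j)))) measure_Ioo_lt_top ?_).trans ?_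
      · rw [ae_restrict_iff' measurableSet_Ioo]
        filter_upwards [hy hyB] with s hs hsI
        have b1 := hs hsI.1 hsI.2.le
        have b2 : ‖φ (C.pt (y, s)) - φ (C.gr y)‖ ≤ L * ε j := by
          have := hφ.dist_le_mul (C.pt (y, s)) (C.pt (y, 0))
          rw [pt_zero, dist_eq_norm] at this
          refine this.trans (mul_le_mul_of_nonneg_left ?_ L.2)
          have := C.dist_pt_le (y, s) (y, 0)
          rw [pt_zero] at this
          simp only [dist_self, mul_zero, zero_add, sub_zero, abs_of_pos hsI.1] at this
          exact this.trans hsI.2.le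
        have b3 : (ε j)⁻¹ * (u (C.pt (y, s)) * (φ (C.pt (y, s)) * C.dheight y v)) -
            (ε j)⁻¹ * (g y * c) = (ε j)⁻¹ * (C.dheight y v *
              (φ (C.pt (y, s)) * (u (C.pt (y, s)) - g y) +
                g y * (φ (C.pt (y, s)) - φ (C.gr y)))) := by
          rw [hcdef]
          ring
        rw [b3, norm_mul, norm_mul, Real.norm_of_nonneg (inv_nonneg.2 (εpos j).le)]
        have hεi := inv_nonneg.2 (εpos j).le
        refine mul_le_mul_of_nonneg_left (mul_le_mul (hRb y) ?_ (norm_nonneg _) hR0) hεi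
        refine (norm_add_le _ _).trans ?_
        rw [norm_mul, norm_mul]
        exact add_le_add (mul_le_mul (hM _) b1 (norm_nonneg _) hM0)
          (mul_le_mul_of_nonneg_left b2 (norm_nonneg _))
      · rw [vε, mul_comm, mul_inv_cancel_left₀ (εpos j).ne']
    · have z1 : ∀ s, Φ j (y, s) = 0 := fun s => by
        have : φ (C.pt (y, s)) = 0 := hbox _ fun hx => hyB (by have := hx.1; rwa [base_pt] at this)
        simp [hΦ, this]
      have q : g₁ y = 0 := indicator_of_notMem hyB g
      simp only [z1, q]
      simp only [integral_zero, zero_mul, sub_zero, norm_zero, add_zero]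
      positivity
  have e1' : (fun j : ℕ => ∫ x, u x * (φ x *
      ((Ioo 0 (1 / ((j : ℝ) + 1))).indicator (fun _ => (1 / ((j : ℝ) + 1))⁻¹) (C.height x) *
        C.dheight (C.base x) v))) = fun j => ∫ y, ∫ s, Φ j (y, s) := funext e1
  rw [e1', e2]
  have iG : Integrable fun y => g₁ y * (φ (C.gr y) * C.dheight y v) := by
    refine ig₁.mul_bdd (c := M * R) ?_ (ae_of_all _ fun y => ?_)
    · exact ((hφ.continuous.comp C.continuous_gr).measurable.mul
        (C.measurable_dheight v)).aestronglyMeasurable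
    · rw [norm_mul]
      exact mul_le_mul (hM _) (hRb y) (norm_nonneg _) hM0
  refine tendsto_integral_filter_of_dominated_convergence
    (fun y => ‖g₁ y * (φ (C.gr y) * C.dheight y v)‖ + R * (M * C.seg w 1 y + ‖g₁ y‖ * L)) ?_ ?_ ?_ ?_
  · exact Eventually.of_forall fun j => (iΦ j).integral_prod_left.aestronglyMeasurable
  · filter_upwards [key] with j hj
    filter_upwards [hj, (C.integrable_pt iw).prod_right_ae] with y hy hyi
    have s1 : C.seg w (ε j) y ≤ C.seg w 1 y :=
      setIntegral_mono_set hyi.norm.integrableOn (ae_of_all _ fun _ => norm_nonneg _)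
        (Ioc_subset_Ioc_right (εle j)).eventuallyLE
    have s2 : ‖g₁ y‖ * (L * ε j) ≤ ‖g₁ y‖ * L := by
      refine mul_le_mul_of_nonneg_left ?_ (norm_nonneg _)
      exact mul_le_of_le_one_right L.2 (εle j)
    have s3 := norm_le_norm_add_norm_sub' (∫ s, Φ j (y, s)) (g₁ y * (φ (C.gr y) * C.dheight y v))
    refine s3.trans (add_le_add le_rfl (hy.trans ?_))
    gcongr
  · exact iG.norm.add ((((C.integrable_seg iw 1).const_mul M).add
      (ig₁.norm.mul_const _)).const_mul R)
  · obtain ⟨N, hN⟩ := eventually_atTop.1 key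
    have key' : ∀ᵐ y, ∀ j, N ≤ j → ‖(∫ s, Φ j (y, s)) - g₁ y * (φ (C.gr y) * C.dheight y v)‖ ≤
        R * (M * C.seg w (ε j) y + ‖g₁ y‖ * (L * ε j)) := by
      rw [ae_all_iff]
      intro j
      by_cases hj : N ≤ j
      · filter_upwards [hN j hj] with y hy _ using hy
      · exact ae_of_all _ fun y h' => absurd h' hj
    filter_upwards [key', C.tendsto_seg_zero iw] with y hy hs
    rw [tendsto_iff_norm_sub_tendsto_zero]
    have lim : Tendsto (fun j => R * (M * C.seg w (ε j) y + ‖g₁ y‖ * (L * ε j))) atTop (𝓝 0) := by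
      have := ((hs.const_mul M).add ((εlim.const_mul (L : ℝ)).const_mul ‖g₁ y‖)).const_mul R
      simp only [mul_zero, add_zero] at this
      exact this
    refine squeeze_zero' (Eventually.of_forall fun _ => norm_nonneg _) ?_ lim
    filter_upwards [eventually_ge_atTop N] with j hj using hy j hj

/-- The divergence theorem above a Lipschitz graph: the test function is cut off near the graph,
and the contribution of the cut-off layer converges to the boundary integral. -/
theorem IsLineTrace.integral_by_parts {g : Sp n → ℝ} (h : C.IsLineTrace u w g) (hfit : C.Fits U)
    (hU : IsOpen U) (iu : Integrable u) (iw : Integrable w)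
    (hg : IntegrableOn g (Metric.ball C.b C.r)) {v : Sp (n + 1)} {wv : Sp (n + 1) → ℝ}
    (iwv : Integrable wv) (H : WeakDerivOn U v u wv) {φ : Sp (n + 1) → ℝ} {L : NNReal}
    (hφ : LipschitzWith L φ) (hc : HasCompactSupport φ) (hbox : ∀ x ∉ C.box, φ x = 0) :
    (∫ x in U, u x * fderiv ℝ φ x v) + ∫ x in U, φ x * wv x =
      -∫ y in Metric.ball C.b C.r, g y * (φ (C.gr y) * C.dheight y v) := by
  obtain ⟨M, hM⟩ := hφ.continuous.bounded_above_of_compact_support hc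
  have hM0 : 0 ≤ M := (norm_nonneg _).trans (hM 0)
  set ε : ℕ → ℝ := fun j => 1 / ((j : ℝ) + 1) with hε
  have εpos : ∀ j, 0 < ε j := fun j => by positivity
  have εlim : Tendsto ε atTop (𝓝 0) := tendsto_one_div_add_atTop_nhds_zero_nat
  have rampLim : ∀ x, 0 < C.height x → Tendsto (fun j => C.ramp (ε j) x) atTop (𝓝 1) := by
    intro x hx
    refine tendsto_const_nhds.congr' ?_
    filter_upwards [εlim.eventually (gt_mem_nhds hx)] with j hj
    exact (C.ramp_eq_one (εpos j) hj.le).symm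
  have dfb : ∀ x, ‖fderiv ℝ φ x v‖ ≤ L * ‖v‖ := fun x =>
    ((fderiv ℝ φ x).le_opNorm v).trans
      (mul_le_mul_of_nonneg_right (norm_fderiv_le_of_lipschitz ℝ hφ) (norm_nonneg _))
  have mdf : AEStronglyMeasurable (fun x => fderiv ℝ φ x v) :=
    (measurable_fderiv_apply_const ℝ φ v).aestronglyMeasurable
  have id : Integrable fun x => u x * fderiv ℝ φ x v := iu.mul_bdd mdf (ae_of_all _ dfb)
  have iφw : Integrable fun x => φ x * wv x :=
    iwv.bdd_mul hφ.continuous.aestronglyMeasurable (ae_of_all _ hM)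
  -- multiplication with the cut-off functions converges to restriction to `U`
  have cutLim : ∀ f : Sp (n + 1) → ℝ, Integrable f → (∀ᵐ x, φ x = 0 → f x = 0) →
      Tendsto (fun j => ∫ x, C.ramp (ε j) x * f x) atTop (𝓝 (∫ x in U, f x)) := by
    intro f hf hf0
    rw [← integral_indicator hU.measurableSet]
    refine tendsto_integral_of_dominated_convergence (fun x => ‖f x‖) (fun j => ?_) hf.norm
      (fun j => ae_of_all _ fun x => ?_) ?_
    · exact (C.continuous_ramp _).aestronglyMeasurable.mul hf.1
    · rw [norm_mul]
      exact mul_le_of_le_one_left (norm_nonneg _) (C.norm_ramp_le _ _)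
    · filter_upwards [hf0] with x hx
      by_cases h0 : φ x = 0
      · by_cases hxU : x ∈ U <;> simp [hx h0, hxU]
      · have hxb : x ∈ C.box := by
          by_contra hxb
          exact h0 (hbox x hxb)
        by_cases hxU : x ∈ U
        · rw [indicator_of_mem hxU]
          simpa using (rampLim x ((hfit x hxb).1 hxU)).mul_const (f x)
        · rw [indicator_of_notMem hxU]
          have : C.height x ≤ 0 := not_lt.1 fun h' => hxU ((hfit x hxb).2 h')
          simp only [C.ramp_eq_zero (εpos _) this, zero_mul]
          exact tendsto_const_nhds
  have l1 := cutLim _ id (by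
    filter_upwards [ae_fderiv_eq_zero_of_eq_zero hφ] with x hx h0
    simp [hx h0])
  have l2 := cutLim _ iφw (ae_of_all _ fun x h0 => by simp [h0])
  have l3 := h.tendsto_layer C iu iw hg v hφ hc hbox
  have eq : ∀ j, (∫ x, C.ramp (ε j) x * (u x * fderiv ℝ φ x v)) + (∫ x, u x * (φ x *
      ((Ioo 0 (ε j)).indicator (fun _ => (ε j)⁻¹) (C.height x) * C.dheight (C.base x) v))) =
      -∫ x, C.ramp (ε j) x * (φ x * wv x) := by
    intro j
    obtain ⟨L₁, hL₁⟩ := C.lipschitz_ramp (ε j)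
    obtain ⟨L₂, hL₂⟩ := hφ.exists_mul_of_bounded hL₁ hM (C.norm_ramp_le (ε j))
    have key := H.integral_lipschitz hU iu iwv hL₂ (hc.mul_right) (fun x hx => by
      by_cases hxb : x ∈ C.box
      · rw [C.ramp_eq_zero (εpos j) (not_lt.1 fun h' => hx ((hfit x hxb).2 h')), mul_zero]
      · rw [hbox x hxb, zero_mul])
    have i1 : Integrable fun x => C.ramp (ε j) x * (u x * fderiv ℝ φ x v) :=
      id.bdd_mul (C.continuous_ramp _).aestronglyMeasurable (ae_of_all _ (C.norm_ramp_le _))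
    have i2 : Integrable fun x => u x * (φ x *
        ((Ioo 0 (ε j)).indicator (fun _ => (ε j)⁻¹) (C.height x) * C.dheight (C.base x) v)) := by
      refine iu.mul_bdd (c := M * ((ε j)⁻¹ * ((1 + C.K) * ‖v‖))) ?_ (ae_of_all _ fun x => ?_)
      · refine Measurable.aestronglyMeasurable (hφ.continuous.measurable.mul (Measurable.mul ?_ ?_))
        · exact (measurable_const.indicator measurableSet_Ioo).comp C.continuous_height.measurable
        · exact (C.measurable_dheight v).comp C.base.continuous.measurable
      · rw [norm_mul, norm_mul]
        have hi : 0 ≤ (ε j)⁻¹ := inv_nonneg.2 (εpos j).le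
        refine mul_le_mul (hM _) (mul_le_mul ?_ (C.abs_dheight_le _ _) (norm_nonneg _) hi)
          (by positivity) hM0
        refine (norm_indicator_le_norm_self _ _).trans ?_
        rw [Real.norm_of_nonneg hi]
    have e3 : (∫ x, C.ramp (ε j) x * (φ x * wv x)) = ∫ x, φ x * C.ramp (ε j) x * wv x := by
      congr 1 with x
      ring
    rw [← integral_add i1 i2, e3, ← key]
    refine integral_congr_ae ?_
    filter_upwards [hφ.ae_differentiableAt (μ := volume), C.ae_differentiableAt_base,
      C.ae_height_ne 0, C.ae_height_ne (ε j)] with x d1 d2 h0 h1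
    have := (d1.hasFDerivAt.mul (C.hasFDerivAt_ramp (εpos j) d2 h0 h1)).fderiv
    have e4 : fderiv ℝ (fun x => φ x * C.ramp (ε j) x) x = _ := this
    rw [e4]
    simp only [_root_.add_apply, _root_.smul_apply, smul_eq_mul]
    ring
  have lim := l1.add l3
  have lim' := lim.congr eq
  have := tendsto_nhds_unique lim' l2.neg
  linarith

end GraphChart

/-! ### Gluing Lipschitz functions -/

/-- A function on a normed space that is `K`-Lipschitz on each of finitely many closed sets that
cover the space is `K`-Lipschitz: the estimate is continued along segments. -/
theorem lipschitzWith_of_finite_closed_cover {E ι : Type*} [NormedAddCommGroup E] [NormedSpace ℝ E]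
    [Finite ι] {F : ι → Set E} (hF : ∀ i, IsClosed (F i)) (hcov : ∀ x, ∃ i, x ∈ F i)
    {f : E → ℝ} {K : NNReal} (hf : ∀ i, LipschitzOnWith K f (F i)) : LipschitzWith K f := by
  have hc : Continuous f :=
    (locallyFinite_of_finite F).continuous (iUnion_eq_univ_iff.2 hcov) hF fun i => (hf i).continuousOn
  refine LipschitzWith.of_dist_le_mul fun x y => ?_
  set γ : ℝ → E := fun t => x + t • (y - x) with hγ
  have hγc : Continuous γ := by fun_prop
  have hγd : ∀ s t, dist (γ s) (γ t) = |s - t| * dist x y := fun s t => by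
    rw [dist_eq_norm, dist_comm x y, dist_eq_norm, hγ]
    simp only [add_sub_add_left_eq_sub, ← sub_smul, norm_smul, Real.norm_eq_abs]
  have main : Icc (0 : ℝ) 1 ⊆ {t | dist (f (γ t)) (f x) ≤ K * (t * dist x y)} := by
    refine IsClosed.Icc_subset_of_forall_exists_gt ?_ ?_ ?_
    · exact (isClosed_le (by fun_prop) (by fun_prop)).inter isClosed_Icc
    · simp [hγ]
    · rintro t ⟨ht, -⟩ s hts
      have ev : ∀ᶠ r in 𝓝[>] t, ∀ i, γ t ∉ F i → γ r ∉ F i := by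
        rw [eventually_all]
        intro i
        by_cases h : γ t ∈ F i
        · exact Eventually.of_forall fun r h' => absurd h h'
        · have : ∀ᶠ r in 𝓝 t, γ r ∉ F i :=
            hγc.continuousAt.eventually ((hF i).isOpen_compl.mem_nhds h)
          filter_upwards [this.filter_mono nhdsWithin_le_nhds] with r hr _ using hr
      obtain ⟨r, hr, hrI⟩ := (ev.and (Ioc_mem_nhdsGT hts)).exists
      obtain ⟨i, hi⟩ := hcov (γ r)
      have hti : γ t ∈ F i := by
        by_contra h
        exact hr i h hi
      refine ⟨r, ?_, hrI⟩
      have h1 := (hf i).dist_le_mul _ hi _ hti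
      rw [hγd, abs_of_pos (sub_pos.2 hrI.1)] at h1
      have h2 : dist (f (γ t)) (f x) ≤ K * (t * dist x y) := ht
      calc dist (f (γ r)) (f x) ≤ dist (f (γ r)) (f (γ t)) + dist (f (γ t)) (f x) :=
            dist_triangle _ _ _
        _ ≤ K * ((r - t) * dist x y) + K * (t * dist x y) := add_le_add h1 h2
        _ = K * (r * dist x y) := by ring
  have := main (right_mem_Icc.2 zero_le_one)
  simpa [hγ, dist_comm] using this

/-! ### Polynomials -/

/-- The polynomial function of `p`. -/
def polyFun {m : ℕ} (p : MvPolynomial (Fin m) ℝ) (y : Sp m) : ℝ :=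
  MvPolynomial.eval (fun j => y j) p

theorem analyticOnNhd_polyFun {m : ℕ} (p : MvPolynomial (Fin m) ℝ) :
    AnalyticOnNhd ℝ (polyFun p) univ := by
  have h : ∀ j : Fin m, AnalyticOnNhd ℝ (fun y : Sp m => y j) univ := fun j =>
    (EuclideanSpace.proj j : Sp m →L[ℝ] ℝ).analyticOnNhd _
  exact AnalyticOnNhd.aeval_mvPolynomial h p

theorem contDiff_polyFun {m : ℕ} (p : MvPolynomial (Fin m) ℝ) {k : WithTop ℕ∞} :
    ContDiff ℝ k (polyFun p) :=
  contDiff_iff_contDiffAt.2 fun x => (analyticOnNhd_polyFun p x (mem_univ x)).contDiffAt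

theorem continuous_gradient {m : ℕ} {f : Sp m → ℝ} (hf : ContDiff ℝ 1 f) :
    Continuous (gradient f) :=
  (InnerProductSpace.toDual ℝ (Sp m)).symm.continuous.comp (hf.continuous_fderiv (by norm_num))

/-! ### The mesh -/

namespace InterfaceProblem

variable {n : ℕ} (P : InterfaceProblem n) {T T' : Finset (Sp (n + 1))}

theorem mem_elements : T ∈ P.elements ↔ T ∈ P.mesh.faces ∧ T.card = n + 2 := by
  simp [elements]

theorem isOpen_openElt (T : Finset (Sp (n + 1))) : IsOpen (openElt T) := isOpen_interior

/-- Distinct elements meet in the convex hull of fewer than `n + 2` points, which has no interior. -/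
theorem disjoint_openElt (hT : T ∈ P.elements) (hT' : T' ∈ P.elements) (h : T ≠ T') :
    Disjoint (openElt T) (openElt T') := by
  classical
  rw [mem_elements] at hT hT'
  rw [disjoint_iff_inter_eq_empty]
  by_contra hne
  have hne := nonempty_iff_ne_empty.2 hne
  rw [openElt, openElt, ← interior_inter, P.mesh.convexHull_inter_convexHull hT.1 hT'.1,
    interior_convexHull_nonempty_iff_affineSpan_eq_top] at hne
  have hcard : (T ∩ T').card ≤ n + 1 := by
    have : T ∩ T' ⊂ T := by
      refine Finset.inter_subset_left.ssubset_of_ne fun h' => ?_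
      exact h (Finset.eq_of_subset_of_card_le (Finset.inter_eq_left.1 h') (by omega))
    have := Finset.card_lt_card this
    omega
  have h1 := congrArg AffineSubspace.direction hne
  rw [direction_affineSpan, AffineSubspace.direction_top, ← Finset.coe_inter] at h1
  have hnon : (T ∩ T').Nonempty := by
    by_contra h0
    rw [Finset.not_nonempty_iff_eq_empty] at h0
    rw [← Finset.coe_inter, h0] at hne
    simp at hne
  have h2 := finrank_vectorSpan_image_finset_le ℝ (id : Sp (n + 1) → Sp (n + 1)) (T ∩ T')
    (n := (T ∩ T').card - 1) (by have := hnon.card_pos; omega)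
  rw [Finset.image_id, h1, finrank_top, finrank_euclideanSpace_fin] at h2
  omega

theorem closure_openElt (hT : T ∈ P.elements) :
    closure (openElt T) = convexHull ℝ (T : Set (Sp (n + 1))) := by
  rw [mem_elements] at hT
  have hind := P.mesh.indep hT.1
  have htop : affineSpan ℝ (T : Set (Sp (n + 1))) = ⊤ := by
    have := (hind.affineSpan_eq_top_iff_card_eq_finrank_add_one).2 (by simp [hT.2])
    simpa using this
  rw [openElt, (convex_convexHull ℝ _).closure_interior_eq_closure_of_nonempty_interior
    (interior_convexHull_nonempty_iff_affineSpan_eq_top.2 htop)]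
  exact (T.finite_toSet.isCompact_convexHull (𝕜 := ℝ)).isClosed.closure_eq

theorem isClosed_elt (T : Finset (Sp (n + 1))) : IsClosed (convexHull ℝ (T : Set (Sp (n + 1)))) :=
  (T.finite_toSet.isCompact_convexHull (𝕜 := ℝ)).isClosed

theorem elt_subset_space (hT : T ∈ P.elements) :
    convexHull ℝ (T : Set (Sp (n + 1))) ⊆ P.mesh.space :=
  P.mesh.convexHull_subset_space (P.mem_elements.1 hT).1

theorem space_eq : P.mesh.space = ⋃ T ∈ P.elements, convexHull ℝ (T : Set (Sp (n + 1))) := by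
  ext x
  rw [P.mesh.mem_space_iff, mem_iUnion₂]
  constructor
  · rintro ⟨s, hs, hx⟩
    obtain ⟨t, ht, hst, hcard⟩ := P.pure_mesh s hs
    exact ⟨t, P.mem_elements.2 ⟨ht, hcard⟩, convexHull_mono (by exact_mod_cast hst) hx⟩
  · rintro ⟨t, ht, hx⟩
    exact ⟨t, (P.mem_elements.1 ht).1, hx⟩

theorem isCompact_space : IsCompact P.mesh.space := by
  rw [space_eq]
  exact P.elements.isCompact_biUnion fun T _ => T.finite_toSet.isCompact_convexHull (𝕜 := ℝ)

theorem isOpen_Om : IsOpen P.Om := isOpen_interior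

theorem Om_subset_space : P.Om ⊆ P.mesh.space := interior_subset

theorem openElt_subset_Om (hT : T ∈ P.elements) : openElt T ⊆ P.Om :=
  interior_mono (P.elt_subset_space hT)

theorem closure_Om : closure P.Om = P.mesh.space := by
  refine Subset.antisymm (closure_minimal P.Om_subset_space P.isCompact_space.isClosed) ?_
  rw [space_eq]
  refine iUnion₂_subset fun T hT => ?_
  rw [← P.closure_openElt hT]
  exact closure_mono (P.openElt_subset_Om hT)

theorem volume_Om_lt_top : volume P.Om < ⊤ :=
  (measure_mono P.Om_subset_space).trans_lt P.isCompact_space.measure_lt_top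

theorem volume_sub_lt_top (i : Fin 2) : volume (P.sub i) < ⊤ :=
  (measure_mono (P.sub_subset i)).trans_lt P.volume_Om_lt_top

theorem mem_openElt_or_mem_frontier {x : Sp (n + 1)} (hx : x ∈ P.Om) :
    (∃ T ∈ P.elements, x ∈ openElt T) ∨
      ∃ T ∈ P.elements, x ∈ frontier (convexHull ℝ (T : Set (Sp (n + 1)))) := by
  have := P.Om_subset_space hx
  rw [space_eq, mem_iUnion₂] at this
  obtain ⟨T, hT, hxT⟩ := this
  by_cases h : x ∈ openElt T
  · exact Or.inl ⟨T, hT, h⟩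
  · exact Or.inr ⟨T, hT, subset_closure hxT, h⟩

theorem ae_mem_openElt : ∀ᵐ x, x ∈ P.Om → ∃ T ∈ P.elements, x ∈ openElt T := by
  have h : ∀ᵐ x : Sp (n + 1), ∀ T ∈ P.elements,
      x ∉ frontier (convexHull ℝ (T : Set (Sp (n + 1)))) := by
    rw [Finset.eventually_all]
    intro T _
    exact measure_eq_zero_iff_ae_notMem.1 ((convex_convexHull ℝ _).addHaar_frontier volume)
  filter_upwards [h] with x hx hxO
  rcases P.mem_openElt_or_mem_frontier hxO with h | ⟨T, hT, h⟩
  · exact h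
  · exact absurd h (hx T hT)

theorem isOpen_sub_union : IsOpen (P.sub 0 ∪ P.sub 1) := (P.isOpen_sub 0).union (P.isOpen_sub 1)

theorem measurableSet_Gam : MeasurableSet P.Gam :=
  P.isOpen_Om.measurableSet.diff P.isOpen_sub_union.measurableSet

theorem surf_ae_mem_Gam : ∀ᵐ x ∂P.surf, x ∈ P.Gam := ae_restrict_mem P.measurableSet_Gam

theorem surf_ae_mem_openElt : ∀ᵐ x ∂P.surf, ∃ T ∈ P.elements, x ∈ openElt T := by
  have h : ∀ᵐ x ∂P.surf, ∀ T ∈ P.elements,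
      x ∉ frontier (convexHull ℝ (T : Set (Sp (n + 1)))) := by
    rw [Finset.eventually_all]
    intro T hT
    rw [mem_elements] at hT
    rw [surf, ae_restrict_iff' P.measurableSet_Gam]
    have := measure_eq_zero_iff_ae_notMem.1 (P.unfitted T hT.1 hT.2)
    filter_upwards [this] with x hx hxG hxF using hx ⟨hxG, hxF⟩
  filter_upwards [h, P.surf_ae_mem_Gam] with x hx hxG
  rcases P.mem_openElt_or_mem_frontier hxG.1 with h | ⟨T, hT, h⟩
  · exact h
  · exact absurd h (hx T hT)

theorem disjoint_sub_of_ne {i j : Fin 2} (h : i ≠ j) : Disjoint (P.sub i) (P.sub j) := by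
  fin_cases i <;> fin_cases j
  · exact absurd rfl h
  · exact P.disjoint_sub
  · exact P.disjoint_sub.symm
  · exact absurd rfl h

theorem isOpen_part (T : Finset (Sp (n + 1))) (i : Fin 2) : IsOpen (P.part T i) :=
  (isOpen_openElt T).inter (P.isOpen_sub i)

theorem part_subset_openElt (T : Finset (Sp (n + 1))) (i : Fin 2) : P.part T i ⊆ openElt T :=
  inter_subset_left

theorem part_subset_sub (T : Finset (Sp (n + 1))) (i : Fin 2) : P.part T i ⊆ P.sub i :=
  inter_subset_right

theorem part_subset_Om (T : Finset (Sp (n + 1))) (i : Fin 2) : P.part T i ⊆ P.Om :=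
  (P.part_subset_sub T i).trans (P.sub_subset i)

theorem disjoint_part (hT : T ∈ P.elements) (hT' : T' ∈ P.elements) {i j : Fin 2}
    (h : T ≠ T' ∨ i ≠ j) : Disjoint (P.part T i) (P.part T' j) := by
  rcases h with h | h
  · exact (P.disjoint_openElt hT hT' h).mono (P.part_subset_openElt T i)
      (P.part_subset_openElt T' j)
  · exact (P.disjoint_sub_of_ne h).mono (P.part_subset_sub T i) (P.part_subset_sub T' j)

theorem mem_frontier_sub {x : Sp (n + 1)} (hx : x ∈ P.Om) (i : Fin 2) :
    x ∈ frontier (P.sub i) ↔ x ∈ P.Gam := by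
  constructor
  · intro hf
    refine ⟨hx, fun hU => ?_⟩
    have hi : x ∉ P.sub i := by
      rw [(P.isOpen_sub i).frontier_eq] at hf
      exact hf.2
    have hj : ∀ j, x ∈ P.sub j → False := fun j hxj => by
      rcases eq_or_ne i j with rfl | hij
      · exact hi hxj
      · exact ((P.disjoint_sub_of_ne hij).closure_left (P.isOpen_sub j)).ne_of_mem
          (frontier_subset_closure hf) hxj rfl
    rcases hU with h | h
    · exact hj 0 h
    · exact hj 1 h
  · exact fun h => P.interface_subset i h

theorem Gam_subset_frontier (i : Fin 2) : P.Gam ⊆ frontier (P.sub i) := P.interface_subset i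

theorem isCompact_closure_Gam : IsCompact (closure P.Gam) :=
  P.isCompact_space.of_isClosed_subset isClosed_closure
    (closure_minimal (sdiff_subset.trans P.Om_subset_space) P.isCompact_space.isClosed)

theorem closure_Gam_subset_frontier (i : Fin 2) : closure P.Gam ⊆ frontier (P.sub i) :=
  closure_minimal (P.Gam_subset_frontier i) isClosed_frontier

/-- Functions in `W_h`, extended by zero, are Lipschitz. -/
theorem MemW.lipschitz {k : ℕ} {w : Sp (n + 1) → ℝ} (hw : P.MemW k w) :
    ∃ K, LipschitzWith K (P.Om.indicator w) := by
  classical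
  have hT : ∀ T ∈ P.elements, ∃ K, LipschitzOnWith K (P.Om.indicator w)
      (convexHull ℝ (T : Set (Sp (n + 1)))) := by
    intro T hT
    obtain ⟨p, -, hp⟩ := hw.2.1 T hT
    have hc : IsCompact (convexHull ℝ (T : Set (Sp (n + 1)))) :=
      T.finite_toSet.isCompact_convexHull (𝕜 := ℝ)
    obtain ⟨M, hM⟩ := hc.exists_bound_of_continuousOn
      ((contDiff_polyFun p (k := 1)).continuous_fderiv (by norm_num)).continuousOn
    have h1 : LipschitzOnWith (Real.toNNReal M) (polyFun p)
        (convexHull ℝ (T : Set (Sp (n + 1)))) := by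
      refine (convex_convexHull ℝ _).lipschitzOnWith_of_nnnorm_fderiv_le (𝕜 := ℝ)
        (fun x _ => ((contDiff_polyFun p (k := 1)).differentiable (by norm_num)) x) fun x hx => ?_
      rw [← NNReal.coe_le_coe, coe_nnnorm]
      exact (hM x hx).trans (Real.le_coe_toNNReal M)
    refine ⟨Real.toNNReal M, fun x hx y hy => ?_⟩
    have e : ∀ z ∈ convexHull ℝ (T : Set (Sp (n + 1))), P.Om.indicator w z = polyFun p z := by
      intro z hz
      by_cases hzO : z ∈ P.Om
      · rw [indicator_of_mem hzO]
        exact hp z hz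
      · rw [indicator_of_notMem hzO, ← hw.2.2 z ?_]
        · exact hp z hz
        · rw [frontier, P.isOpen_Om.interior_eq, P.closure_Om]
          exact ⟨P.elt_subset_space hT hz, hzO⟩
    rw [e x hx, e y hy]
    exact h1 hx hy
  choose! K hK using hT
  set K₀ := P.elements.sup K with hK₀
  refine ⟨K₀, lipschitzWith_of_finite_closed_cover
    (F := fun o : Option P.elements => o.elim P.Omᶜ fun T => convexHull ℝ (T.1 : Set (Sp (n + 1))))
    ?_ ?_ ?_⟩
  · rintro (_ | T)
    · exact P.isOpen_Om.isClosed_compl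
    · exact isClosed_elt T.1
  · intro x
    by_cases hx : x ∈ P.Om
    · have := P.Om_subset_space hx
      rw [space_eq, mem_iUnion₂] at this
      obtain ⟨T, hT, hxT⟩ := this
      exact ⟨some ⟨T, hT⟩, hxT⟩
    · exact ⟨none, hx⟩
  · rintro (_ | T)
    · intro x hx y hy
      simp only [Option.elim_none, mem_compl_iff] at hx hy
      simp [hx, hy]
    · exact (hK T.1 T.2).weaken (Finset.le_sup T.2)

end InterfaceProblem

/-! ### Elementary properties of traces -/

section HasTrace

variable {m : ℕ} {F : Type*} [NormedAddCommGroup F] [NormedSpace ℝ F]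
  {U : Set (Sp m)} {u v : Sp m → F} {x : Sp m} {g g' : F}

theorem HasTrace.trace_eq (h : HasTrace U u x g) : trace U u x = g := h.limUnder_eq

theorem HasTrace.congr (h : HasTrace U u x g) (huv : ∀ᵐ y ∂volume.restrict U, u y = v y) :
    HasTrace U v x g := by
  refine Tendsto.congr (fun r => ?_) h
  rw [setAverage_eq, setAverage_eq]
  congr 1
  exact integral_congr_ae (ae_restrict_of_ae_restrict_of_subset inter_subset_right huv)

theorem HasTrace.add (h : HasTrace U u x g) (h' : HasTrace U v x g') (hu : IntegrableOn u U)
    (hv : IntegrableOn v U) : HasTrace U (u + v) x (g + g') := by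
  refine Tendsto.congr (fun r => ?_) (Tendsto.add h h')
  simp only [setAverage_eq, Pi.add_apply]
  rw [integral_add (hu.mono_set inter_subset_right) (hv.mono_set inter_subset_right), smul_add]

theorem HasTrace.smul (h : HasTrace U u x g) (c : ℝ) : HasTrace U (c • u) x (c • g) := by
  refine Tendsto.congr (fun r => ?_) (Tendsto.const_smul h c)
  simp only [setAverage_eq, Pi.smul_apply]
  rw [integral_smul, smul_comm]

theorem hasTrace_of_components {k : ℕ} {G : Sp m → Sp k} {g : Sp k} (hG : IntegrableOn G U)
    (h : ∀ j, HasTrace U (fun y => G y j) x (g j)) : HasTrace U G x g := by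
  have h1 : ∀ r : ℝ, ∀ j, (⨍ y in Metric.ball x r ∩ U, G y) j =
      ⨍ y in Metric.ball x r ∩ U, G y j := by
    intro r j
    rw [setAverage_eq, setAverage_eq, PiLp.smul_apply]
    congr 1
    exact ((EuclideanSpace.proj j : Sp k →L[ℝ] ℝ).integral_comp_comm
      (hG.mono_set inter_subset_right)).symm
  rw [HasTrace, (PiLp.homeomorph 2 (fun _ : Fin k => ℝ)).isInducing.tendsto_nhds_iff,
    tendsto_pi_nhds]
  intro j
  exact Tendsto.congr (fun r => (h1 r j).symm) (h j)

/-- The trace of a function that agrees near a boundary point with a continuous function. -/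
theorem hasTrace_of_continuous [CompleteSpace F] (hU : IsOpen U) (hx : x ∈ closure U)
    {W : Set (Sp m)}
    (hW : W ∈ 𝓝 x) (hv : Continuous v) (huv : ∀ᵐ y ∂volume.restrict (W ∩ U), u y = v y) :
    HasTrace U u x (v x) := by
  rw [HasTrace, Metric.tendsto_nhds]
  intro ε hε
  have h1 : ∀ᶠ y in 𝓝 x, y ∈ W ∧ dist (v y) (v x) ≤ ε / 2 := by
    filter_upwards [hW, hv.continuousAt.eventually (Metric.closedBall_mem_nhds (v x) (half_pos hε))] with y h h'
      using ⟨h, h'⟩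
  obtain ⟨ρ, hρ, hb⟩ := Metric.eventually_nhds_iff_ball.1 h1
  filter_upwards [Ioo_mem_nhdsGT hρ] with r hr
  set S := Metric.ball x r ∩ U with hS
  have hSW : S ⊆ W ∩ U := fun y hy => ⟨(hb y (Metric.ball_subset_ball hr.2.le hy.1)).1, hy.2⟩
  have hSm : MeasurableSet S := measurableSet_ball.inter hU.measurableSet
  have hSfin : volume S ≠ ⊤ := ((measure_mono inter_subset_left).trans_lt measure_ball_lt_top).ne
  have hSne : S.Nonempty := by
    obtain ⟨y, hyU, hy⟩ := Metric.mem_closure_iff.1 hx r hr.1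
    exact ⟨y, by rwa [Metric.mem_ball, dist_comm], hyU⟩
  have hSpos : volume S ≠ 0 := ((Metric.isOpen_ball.inter hU).measure_pos volume hSne).ne'
  have e : ∀ᵐ y ∂volume.restrict S, u y ∈ Metric.closedBall (v x) (ε / 2) := by
    filter_upwards [ae_restrict_of_ae_restrict_of_subset hSW huv, ae_restrict_mem hSm] with y hy hyS
    rw [hy]
    exact (hb y (Metric.ball_subset_ball hr.2.le hyS.1)).2
  have hi : IntegrableOn u S := by
    have h2 : IntegrableOn v S := (hv.continuousOn.integrableOn_compact
      (isCompact_closedBall x r)).mono_set (inter_subset_left.trans Metric.ball_subset_closedBall)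
    exact h2.congr ((ae_restrict_of_ae_restrict_of_subset hSW huv).mono fun y hy => hy.symm)
  have := (convex_closedBall (v x) (ε / 2)).set_average_mem Metric.isClosed_closedBall hSpos hSfin
    e hi
  exact lt_of_le_of_lt this (half_lt_self hε)

end HasTrace

/-! ### Surface patches -/

namespace GraphChart

variable {n : ℕ} (C : GraphChart n) {U : Set (Sp (n + 1))}

/-- The part of the graph over the base of the box. -/
def patch : Set (Sp (n + 1)) := C.gr '' Metric.ball C.b C.r

theorem mem_patch_iff (hfit : C.Fits U) {x : Sp (n + 1)} :
    x ∈ C.patch ↔ x ∈ frontier U ∧ x ∈ C.box := by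
  constructor
  · rintro ⟨y, hy, rfl⟩
    have hb := C.gr_mem_box hy
    exact ⟨(C.frontier_inter_box hfit hb).2 (by simp), hb⟩
  · rintro ⟨hf, hb⟩
    exact ⟨C.base x, hb.1, C.gr_base_of_height_eq_zero ((C.frontier_inter_box hfit hb).1 hf)⟩

theorem measurableSet_patch : MeasurableSet C.patch :=
  C.measurableEmbedding_gr.measurableSet_image.2 measurableSet_ball

/-- The measure on the base that corresponds to the surface measure on the patch. -/
def baseMeasure : Measure (Sp n) :=
  (volume.restrict (Metric.ball C.b C.r)).withDensity fun y => ENNReal.ofReal (C.area y)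

theorem restrict_patch :
    (μHE[n] : Measure (Sp (n + 1))).restrict C.patch = C.baseMeasure.map C.gr := by
  rw [patch, ← Measure.restrict_restrict_of_subset (image_subset_range C.gr (Metric.ball C.b C.r)),
    restrict_range_gr]
  change (Measure.map C.gr _).restrict (C.gr '' Metric.ball C.b C.r) = _
  rw [C.measurableEmbedding_gr.restrict_map, preimage_image_eq _ C.gr_injective,
    restrict_withDensity measurableSet_ball]
  rfl

theorem baseMeasure_le : C.baseMeasure ≤
    ENNReal.ofReal (1 + C.K) • volume.restrict (Metric.ball C.b C.r) := by
  rw [baseMeasure, ← withDensity_const]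
  exact withDensity_mono (ae_of_all _ fun y => ENNReal.ofReal_le_ofReal (C.area_le y))

theorem measure_patch_lt_top : (μHE[n] : Measure (Sp (n + 1))) C.patch < ⊤ := by
  rw [← Measure.restrict_apply_univ, restrict_patch, C.measurableEmbedding_gr.map_apply]
  refine (C.baseMeasure_le _).trans_lt ?_
  simp only [preimage_univ, Measure.smul_apply, Measure.restrict_apply_univ, smul_eq_mul]
  exact ENNReal.mul_lt_top ENNReal.ofReal_lt_top measure_ball_lt_top

theorem ae_patch {p : Sp (n + 1) → Prop}
    (h : ∀ᵐ y, y ∈ Metric.ball C.b C.r → p (C.gr y)) :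
    ∀ᵐ x ∂(μHE[n] : Measure (Sp (n + 1))).restrict C.patch, p x := by
  rw [restrict_patch, C.measurableEmbedding_gr.ae_map_iff]
  refine (withDensity_absolutelyContinuous _ _).ae_le ?_
  exact (ae_restrict_iff' measurableSet_ball).2 h

theorem aestronglyMeasurable_patch {F : Type*} [NormedAddCommGroup F] {f : Sp (n + 1) → F}
    {g : Sp n → F} (hg : AEStronglyMeasurable g (volume.restrict (Metric.ball C.b C.r)))
    (h : ∀ᵐ y, y ∈ Metric.ball C.b C.r → f (C.gr y) = g y) :
    AEStronglyMeasurable f ((μHE[n] : Measure (Sp (n + 1))).restrict C.patch) := by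
  rw [restrict_patch, C.measurableEmbedding_gr.aestronglyMeasurable_map_iff]
  refine (hg.congr ?_).mono_ac (withDensity_absolutelyContinuous _ _)
  rw [EventuallyEq, ae_restrict_iff' measurableSet_ball]
  filter_upwards [h] with y hy hyB using (hy hyB).symm

theorem memLp_patch {F : Type*} [NormedAddCommGroup F] {f : Sp (n + 1) → F}
    {g : Sp n → F} (hg : MemLp g 2 (volume.restrict (Metric.ball C.b C.r)))
    (h : ∀ᵐ y, y ∈ Metric.ball C.b C.r → f (C.gr y) = g y) :
    MemLp f 2 ((μHE[n] : Measure (Sp (n + 1))).restrict C.patch) := by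
  rw [restrict_patch, C.measurableEmbedding_gr.memLp_map_measure_iff]
  refine MemLp.of_measure_le_smul ENNReal.ofReal_ne_top C.baseMeasure_le (hg.ae_eq ?_)
  rw [EventuallyEq, ae_restrict_iff' measurableSet_ball]
  filter_upwards [h] with y hy hyB using (hy hyB).symm

theorem setIntegral_patch (f : Sp (n + 1) → ℝ) :
    ∫ x in C.patch, f x ∂(μHE[n] : Measure (Sp (n + 1))) =
      ∫ y in Metric.ball C.b C.r, C.area y * f (C.gr y) := by
  rw [restrict_patch, C.measurableEmbedding_gr.integral_map, baseMeasure,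
    integral_withDensity_eq_integral_toReal_smul C.measurable_area.ennreal_ofReal
      (ae_of_all _ fun _ => ENNReal.ofReal_lt_top)]
  congr 1 with y
  rw [ENNReal.toReal_ofReal (C.area_pos y).le, smul_eq_mul]

theorem ae_isOuterNormal (hfit : C.Fits U) :
    ∀ᵐ y, y ∈ Metric.ball C.b C.r → IsOuterNormal U (C.gr y) (C.nu y) := by
  filter_upwards [C.lip.ae_differentiableAt (μ := volume)] with y hd hy
  exact C.isOuterNormal_nu hfit hy hd

/-- Sobolev functions have square integrable boundary values on the graph, and integration by
parts holds for test functions supported in the box. -/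
theorem exists_trace (hfit : C.Fits U) (hU : IsOpen U) (hvol : volume U < ⊤)
    {u : Sp (n + 1) → ℝ} {G : Sp (n + 1) → Sp (n + 1)} (lu : MemLp u 2 (volume.restrict U))
    (hG : HasWeakGrad U u G) (lG : MemLp G 2 (volume.restrict U)) :
    ∃ g : Sp n → ℝ, MemLp g 2 (volume.restrict (Metric.ball C.b C.r)) ∧
      (∀ᵐ y, y ∈ Metric.ball C.b C.r → HasTrace U u (C.gr y) (g y)) ∧
      ∀ (v : Sp (n + 1)) (φ : Sp (n + 1) → ℝ) (L : NNReal), LipschitzWith L φ →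
        HasCompactSupport φ → (∀ x ∉ C.box, φ x = 0) →
        (∫ x in U, u x * fderiv ℝ φ x v) + ∫ x in U, φ x * inner ℝ (G x) v =
          -∫ y in Metric.ball C.b C.r, g y * (φ (C.gr y) * C.dheight y v) := by
  have : IsFiniteMeasure (volume.restrict U) := ⟨by rwa [Measure.restrict_apply_univ]⟩
  -- strongly measurable representatives that vanish outside of `U`
  have rep : ∀ f : Sp (n + 1) → ℝ, MemLp f 2 (volume.restrict U) → ∃ f' : Sp (n + 1) → ℝ,
      StronglyMeasurable f' ∧ MemLp f' 2 ∧ Integrable f' ∧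
        ∀ᵐ x ∂volume.restrict U, f x = f' x := by
    intro f hf
    have h1 : MemLp (U.indicator f) 2 := (memLp_indicator_iff_restrict hU.measurableSet).2 hf
    have h2 : Integrable (U.indicator f) :=
      (IntegrableOn.integrable_indicator (hf.integrable (by norm_num)) hU.measurableSet)
    refine ⟨h1.1.mk _, h1.1.stronglyMeasurable_mk, h1.ae_eq h1.1.ae_eq_mk,
      h2.congr h1.1.ae_eq_mk, ?_⟩
    filter_upwards [ae_restrict_of_ae h1.1.ae_eq_mk, ae_restrict_mem hU.measurableSet] with x hx hxU
    rw [← hx, indicator_of_mem hxU]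
  have lGv : ∀ v, MemLp (fun x => inner ℝ (G x) v) 2 (volume.restrict U) := fun v =>
    lG.inner_const v
  obtain ⟨u', mu, lu', iu, hu⟩ := rep u lu
  obtain ⟨w, mw, lw, iw, hw⟩ := rep _ (lGv C.up)
  obtain ⟨g, -, lg, hg⟩ := C.exists_isLineTrace hfit (hG.weakDerivOn hu hw) mu mw iu iw lu' lw
  have : IsFiniteMeasure (volume.restrict (Metric.ball C.b C.r)) :=
    ⟨by rw [Measure.restrict_apply_univ]; exact measure_ball_lt_top⟩
  have ig : IntegrableOn g (Metric.ball C.b C.r) := lg.integrable (by norm_num)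
  refine ⟨g, lg, ?_, ?_⟩
  · filter_upwards [hg.hasTrace C hfit iu iw ig] with y hy hyB
    exact (hy hyB).congr (hu.mono fun x hx => hx.symm)
  · intro v φ L hφ hc hbox
    obtain ⟨wv, -, -, iwv, hwv⟩ := rep _ (lGv v)
    rw [← hg.integral_by_parts C hfit hU iu iw ig iwv (hG.weakDerivOn hu hwv) hφ hc hbox]
    congr 1
    · exact integral_congr_ae (hu.mono fun x hx => by simp only [hx])
    · exact integral_congr_ae (hwv.mono fun x hx => by simp only [hx])

end GraphChart

/-! ### Traces and integration by parts on the sub-domains -/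

namespace InterfaceProblem

variable {n : ℕ} (P : InterfaceProblem n)

/-- The closure of the interface is compact, so finitely many charts cover it. -/
theorem exists_charts (i : Fin 2) : ∃ (N : ℕ) (C : Fin N → GraphChart n),
    (∀ j, (C j).Fits (P.sub i)) ∧ closure P.Gam ⊆ ⋃ j, (C j).box := by
  have h : ∀ x ∈ closure P.Gam, ∃ C : GraphChart n, x ∈ C.box ∧ C.Fits (P.sub i) := fun x hx =>
    (P.lipschitz_interface x hx i).exists_chart (P.closure_Gam_subset_frontier i hx)
  choose C hC hfit using h
  obtain ⟨t, hcov⟩ := P.isCompact_closure_Gam.elim_nhds_subcover' (fun x hx => (C x hx).box)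
    fun x hx => (C x hx).isOpen_box.mem_nhds (hC x hx)
  refine ⟨t.card, fun j => C (t.equivFin.symm j).1 (t.equivFin.symm j).1.2, fun j => hfit _ _,
    fun x hx => ?_⟩
  obtain ⟨y, hy, hxy⟩ := mem_iUnion₂.1 (hcov hx)
  exact mem_iUnion.2 ⟨t.equivFin ⟨y, hy⟩, by simpa using hxy⟩

theorem exists_patches (i : Fin 2) : ∃ (N : ℕ) (C : Fin N → GraphChart n),
    (∀ j, (C j).Fits (P.sub i)) ∧ P.Gam ⊆ ⋃ j, (C j).patch := by
  obtain ⟨N, C, hfit, hcov⟩ := P.exists_charts i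
  refine ⟨N, C, hfit, fun x hx => ?_⟩
  obtain ⟨j, hj⟩ := mem_iUnion.1 (hcov (subset_closure hx))
  exact mem_iUnion.2 ⟨j, ((C j).mem_patch_iff (hfit j)).2 ⟨P.Gam_subset_frontier i hx, hj⟩⟩

/-- A property holds almost everywhere on the interface if it does on every graph patch. -/
theorem surf_ae_of_patch (i : Fin 2) {p : Sp (n + 1) → Prop}
    (h : ∀ C : GraphChart n, C.Fits (P.sub i) →
      ∀ᵐ x ∂(μHE[n] : Measure (Sp (n + 1))).restrict C.patch, p x) : ∀ᵐ x ∂P.surf, p x := by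
  obtain ⟨N, C, hfit, hcov⟩ := P.exists_patches i
  refine ae_restrict_of_ae_restrict_of_subset hcov ?_
  rw [ae_restrict_iUnion_iff]
  exact fun j => h _ (hfit j)

theorem aestronglyMeasurable_surf_of_patch (i : Fin 2) {F : Type*} [NormedAddCommGroup F]
    {f : Sp (n + 1) → F} (h : ∀ C : GraphChart n, C.Fits (P.sub i) →
      AEStronglyMeasurable f ((μHE[n] : Measure (Sp (n + 1))).restrict C.patch)) :
    AEStronglyMeasurable f P.surf := by
  obtain ⟨N, C, hfit, hcov⟩ := P.exists_patches i
  refine AEStronglyMeasurable.mono_set hcov ?_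
  rw [aestronglyMeasurable_iUnion_iff]
  exact fun j => h _ (hfit j)

theorem memLp_surf_of_patch (i : Fin 2) {f : Sp (n + 1) → ℝ}
    (h : ∀ C : GraphChart n, C.Fits (P.sub i) →
      MemLp f 2 ((μHE[n] : Measure (Sp (n + 1))).restrict C.patch)) : MemLp f 2 P.surf := by
  have hm := P.aestronglyMeasurable_surf_of_patch i fun C hC => (h C hC).1
  obtain ⟨N, C, hfit, hcov⟩ := P.exists_patches i
  rw [memLp_two_iff_integrable_sq hm]
  refine IntegrableOn.mono_set (t := ⋃ j, (C j).patch) ?_ hcov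
  rw [integrableOn_finite_iUnion]
  exact fun j => (h _ (hfit j)).integrable_sq

instance : IsFiniteMeasure P.surf := by
  obtain ⟨N, C, hfit, hcov⟩ := P.exists_patches 0
  refine ⟨?_⟩
  rw [surf, Measure.restrict_apply_univ]
  refine (measure_mono hcov).trans_lt ((measure_iUnion_le _).trans_lt ?_)
  rw [tsum_fintype]
  exact ENNReal.sum_lt_top.2 fun j _ => (C j).measure_patch_lt_top

instance (i : Fin 2) : IsFiniteMeasure (volume.restrict (P.sub i)) :=
  ⟨by rw [Measure.restrict_apply_univ]; exact P.volume_sub_lt_top i⟩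

theorem ae_isOuterNormal (i : Fin 2) :
    ∀ᵐ x ∂P.surf, IsOuterNormal (P.sub i) x (outerNormal (P.sub i) x) := by
  refine P.surf_ae_of_patch i fun C hC => C.ae_patch ?_
  filter_upwards [C.ae_isOuterNormal hC] with y hy hyB
  rw [(hy hyB).outerNormal_eq]
  exact hy hyB

theorem aestronglyMeasurable_outerNormal (i : Fin 2) :
    AEStronglyMeasurable (outerNormal (P.sub i)) P.surf := by
  refine P.aestronglyMeasurable_surf_of_patch i fun C hC =>
    C.aestronglyMeasurable_patch C.measurable_nu.aestronglyMeasurable ?_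
  filter_upwards [C.ae_isOuterNormal hC] with y hy hyB
  exact (hy hyB).outerNormal_eq

theorem aestronglyMeasurable_normal : AEStronglyMeasurable P.normal P.surf :=
  P.aestronglyMeasurable_outerNormal 0

theorem ae_norm_normal : ∀ᵐ x ∂P.surf, ‖P.normal x‖ = 1 := by
  filter_upwards [P.ae_isOuterNormal 0] with x hx using hx.1

/-- `1` for the first and `-1` for the second sub-domain. -/
def side (i : Fin 2) : ℝ := if i = 0 then 1 else -1

theorem ae_outerNormal_eq (i : Fin 2) :
    ∀ᵐ x ∂P.surf, outerNormal (P.sub i) x = side i • P.normal x := by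
  fin_cases i
  · exact ae_of_all _ fun x => by simp [side, normal]
  · filter_upwards [P.ae_isOuterNormal 0, P.ae_isOuterNormal 1] with x h0 h1
    simpa [side, normal] using h0.eq_neg h1 P.disjoint_sub

variable {u : Sp (n + 1) → ℝ} {i : Fin 2}

theorem ae_hasTrace_of_memH1 (hu : MemH1 (P.sub i) u) :
    ∀ᵐ x ∂P.surf, HasTrace (P.sub i) u x (trace (P.sub i) u x) := by
  obtain ⟨lu, G, hG, lG⟩ := hu
  refine P.surf_ae_of_patch i fun C hC => C.ae_patch ?_
  obtain ⟨g, -, hg, -⟩ := C.exists_trace hC (P.isOpen_sub i) (P.volume_sub_lt_top i) lu hG lG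
  filter_upwards [hg] with y hy hyB
  rw [(hy hyB).trace_eq]
  exact hy hyB

theorem memLp_trace_of_memH1 (hu : MemH1 (P.sub i) u) : MemLp (trace (P.sub i) u) 2 P.surf := by
  obtain ⟨lu, G, hG, lG⟩ := hu
  refine P.memLp_surf_of_patch i fun C hC => ?_
  obtain ⟨g, lg, hg, -⟩ := C.exists_trace hC (P.isOpen_sub i) (P.volume_sub_lt_top i) lu hG lG
  refine C.memLp_patch lg ?_
  filter_upwards [hg] with y hy hyB using (hy hyB).trace_eq

theorem hasCompactSupport_of_eq_zero {φ : Sp (n + 1) → ℝ} (h : ∀ x ∉ P.Om, φ x = 0) :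
    HasCompactSupport φ :=
  HasCompactSupport.intro P.isCompact_space fun x hx => h x fun hO => hx (P.Om_subset_space hO)

/-- Integration by parts for test functions supported in the box of a chart. -/
theorem integral_by_parts_of_chart {C : GraphChart n} (hfit : C.Fits (P.sub i))
    (lu : MemLp u 2 (volume.restrict (P.sub i))) {G : Sp (n + 1) → Sp (n + 1)}
    (hG : HasWeakGrad (P.sub i) u G) (lG : MemLp G 2 (volume.restrict (P.sub i)))
    (v : Sp (n + 1)) {φ : Sp (n + 1) → ℝ} {L : NNReal} (hφ : LipschitzWith L φ)
    (hO : ∀ x ∉ P.Om, φ x = 0) (hbox : ∀ x ∉ C.box, φ x = 0) :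
    (∫ x in P.sub i, u x * fderiv ℝ φ x v) + ∫ x in P.sub i, φ x * inner ℝ (G x) v =
      ∫ x, trace (P.sub i) u x * (φ x * inner ℝ (outerNormal (P.sub i) x) v) ∂P.surf := by
  obtain ⟨g, lg, hg, H⟩ := C.exists_trace hfit (P.isOpen_sub i) (P.volume_sub_lt_top i) lu hG lG
  rw [H v φ L hφ (P.hasCompactSupport_of_eq_zero hO) hbox]
  set f : Sp (n + 1) → ℝ :=
    fun x => trace (P.sub i) u x * (φ x * inner ℝ (outerNormal (P.sub i) x) v) with hf
  have e1 : ∫ x, f x ∂P.surf = ∫ x in C.patch, f x ∂(μHE[n] : Measure (Sp (n + 1))) := by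
    rw [surf, ← integral_indicator P.measurableSet_Gam, ← integral_indicator C.measurableSet_patch]
    congr 1 with x
    by_cases h0 : φ x = 0
    · have : f x = 0 := by simp [hf, h0]
      rw [indicator_apply_eq_zero.2 fun _ => this, indicator_apply_eq_zero.2 fun _ => this]
    · have hxO : x ∈ P.Om := by
        by_contra h
        exact h0 (hO x h)
      have hxb : x ∈ C.box := by
        by_contra h
        exact h0 (hbox x h)
      have : x ∈ P.Gam ↔ x ∈ C.patch := by
        rw [C.mem_patch_iff hfit, P.mem_frontier_sub hxO]
        exact ⟨fun h => ⟨h, hxb⟩, fun h => h.1⟩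
      by_cases hG : x ∈ P.Gam
      · rw [indicator_of_mem hG, indicator_of_mem (this.1 hG)]
      · rw [indicator_of_notMem hG, indicator_of_notMem (fun h => hG (this.2 h))]
  rw [e1, C.setIntegral_patch, ← integral_neg]
  refine setIntegral_congr_ae measurableSet_ball ?_
  filter_upwards [hg, C.ae_isOuterNormal hfit] with y h1 h2 hy
  simp only [hf]
  rw [(h1 hy).trace_eq, (h2 hy).outerNormal_eq, C.dheight_eq]
  ring

/-- Integration by parts for test functions that vanish on the interface. -/
theorem integral_by_parts_of_eq_zero
    (lu : MemLp u 2 (volume.restrict (P.sub i))) {G : Sp (n + 1) → Sp (n + 1)}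
    (hG : HasWeakGrad (P.sub i) u G) (lG : MemLp G 2 (volume.restrict (P.sub i)))
    (v : Sp (n + 1)) {φ : Sp (n + 1) → ℝ} {L : NNReal} (hφ : LipschitzWith L φ)
    (hO : ∀ x ∉ P.Om, φ x = 0) (hΓ : ∀ x ∈ P.Gam, φ x = 0) :
    (∫ x in P.sub i, u x * fderiv ℝ φ x v) + ∫ x in P.sub i, φ x * inner ℝ (G x) v = 0 := by
  classical
  have hm := (P.isOpen_sub i).measurableSet
  set φ' := (P.sub i).indicator φ with hφ'
  have hφL : LipschitzWith L φ' := by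
    refine lipschitzWith_of_finite_closed_cover
      (F := fun b : Bool => cond b (closure (P.sub i)) (P.sub i)ᶜ) ?_ ?_ ?_
    · rintro (_ | _)
      · exact (P.isOpen_sub i).isClosed_compl
      · exact isClosed_closure
    · intro x
      by_cases hx : x ∈ P.sub i
      · exact ⟨true, subset_closure hx⟩
      · exact ⟨false, hx⟩
    · rintro (_ | _)
      · intro x hx y hy
        have hx' : x ∉ P.sub i := hx
        have hy' : y ∉ P.sub i := hy
        simp [hφ', hx', hy']
      · have e : ∀ x ∈ closure (P.sub i), φ' x = φ x := fun x hx => by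
          by_cases hxi : x ∈ P.sub i
          · exact indicator_of_mem hxi φ
          · rw [hφ', indicator_of_notMem hxi]
            by_cases hxO : x ∈ P.Om
            · refine (hΓ x ((P.mem_frontier_sub hxO i).1 ?_)).symm
              rw [(P.isOpen_sub i).frontier_eq]
              exact ⟨hx, hxi⟩
            · exact (hO x hxO).symm
        intro x hx y hy
        have hx' : x ∈ closure (P.sub i) := hx
        have hy' : y ∈ closure (P.sub i) := hy
        rw [e x hx', e y hy']
        exact hφ x y
  have iu : Integrable ((P.sub i).indicator u) :=
    IntegrableOn.integrable_indicator (lu.integrable (by norm_num)) hm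
  have iG : Integrable ((P.sub i).indicator fun x => (inner ℝ (G x) v : ℝ)) :=
    IntegrableOn.integrable_indicator ((lG.inner_const v).integrable (by norm_num)) hm
  have H : WeakDerivOn (P.sub i) v ((P.sub i).indicator u)
      ((P.sub i).indicator fun x => (inner ℝ (G x) v : ℝ)) := by
    refine hG.weakDerivOn ?_ ?_ <;>
    · filter_upwards [ae_restrict_mem hm] with x hx
      rw [indicator_of_mem hx]
  have key := H.integral_lipschitz (P.isOpen_sub i) iu iG hφL
    (P.hasCompactSupport_of_eq_zero fun x hx => indicator_of_notMem (fun h => hx (P.sub_subset i h)) φ)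
    (fun x hx => indicator_of_notMem hx φ)
  rw [← integral_indicator hm, ← integral_indicator hm]
  have e1 : (∫ x, (P.sub i).indicator (fun x => u x * fderiv ℝ φ x v) x) =
      ∫ x, (P.sub i).indicator u x * fderiv ℝ φ' x v := by
    congr 1 with x
    by_cases hx : x ∈ P.sub i
    · have : φ' =ᶠ[𝓝 x] φ := by
        filter_upwards [(P.isOpen_sub i).mem_nhds hx] with y hy using indicator_of_mem hy φ
      rw [indicator_of_mem hx, indicator_of_mem hx, this.fderiv_eq]
    · rw [indicator_of_notMem hx, indicator_of_notMem hx, zero_mul]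
  have e2 : (∫ x, (P.sub i).indicator (fun x => φ x * inner ℝ (G x) v) x) =
      ∫ x, φ' x * (P.sub i).indicator (fun x => (inner ℝ (G x) v : ℝ)) x := by
    congr 1 with x
    by_cases hx : x ∈ P.sub i
    · rw [indicator_of_mem hx, indicator_of_mem hx, hφ', indicator_of_mem hx]
    · rw [indicator_of_notMem hx, indicator_of_notMem hx, mul_zero]
  rw [e1, e2, key, neg_add_cancel]

/-- The integration by parts formula on a sub-domain, for Lipschitz test functions that vanish
outside of `Ω`. The test function is split into functions supported in the boxes of finitely many
charts and a function that vanishes on the interface. -/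
theorem integral_by_parts
    (lu : MemLp u 2 (volume.restrict (P.sub i))) {G : Sp (n + 1) → Sp (n + 1)}
    (hG : HasWeakGrad (P.sub i) u G) (lG : MemLp G 2 (volume.restrict (P.sub i)))
    (v : Sp (n + 1)) {φ : Sp (n + 1) → ℝ} {L : NNReal} (hφ : LipschitzWith L φ)
    (hO : ∀ x ∉ P.Om, φ x = 0) :
    (∫ x in P.sub i, u x * fderiv ℝ φ x v) + ∫ x in P.sub i, φ x * inner ℝ (G x) v =
      ∫ x, trace (P.sub i) u x * (φ x * inner ℝ (outerNormal (P.sub i) x) v) ∂P.surf := by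
  classical
  obtain ⟨N, C, hfit, hcov⟩ := P.exists_charts i
  obtain ⟨δ, hδ, hleb⟩ := lebesgue_number_lemma_of_metric P.isCompact_closure_Gam
    (fun j => (C j).isOpen_box) hcov
  have lt := P.memLp_trace_of_memH1 ⟨lu, G, hG, lG⟩
  -- both sides are additive in the test function
  have iu : IntegrableOn u (P.sub i) := lu.integrable (by norm_num)
  have iG : IntegrableOn (fun x => (inner ℝ (G x) v : ℝ)) (P.sub i) :=
    (lG.inner_const v).integrable (by norm_num)
  have i1 : ∀ (ψ : Sp (n + 1) → ℝ) (K : NNReal), LipschitzWith K ψ →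
      IntegrableOn (fun x => u x * fderiv ℝ ψ x v) (P.sub i) := fun ψ K hψ =>
    Integrable.mul_bdd (c := K * ‖v‖) iu (measurable_fderiv_apply_const ℝ ψ v).aestronglyMeasurable
      (ae_of_all _ fun x => ((fderiv ℝ ψ x).le_opNorm v).trans
        (mul_le_mul_of_nonneg_right (norm_fderiv_le_of_lipschitz ℝ hψ) (norm_nonneg _)))
  have bd : ∀ (ψ : Sp (n + 1) → ℝ) (K : NNReal), LipschitzWith K ψ → (∀ x ∉ P.Om, ψ x = 0) →
      ∃ M, 0 ≤ M ∧ ∀ x, ‖ψ x‖ ≤ M := fun ψ K hψ h0 => by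
    obtain ⟨M, hM⟩ := hψ.continuous.bounded_above_of_compact_support
      (P.hasCompactSupport_of_eq_zero h0)
    exact ⟨M, (norm_nonneg _).trans (hM 0), hM⟩
  have i2 : ∀ (ψ : Sp (n + 1) → ℝ) (K : NNReal), LipschitzWith K ψ → (∀ x ∉ P.Om, ψ x = 0) →
      IntegrableOn (fun x => ψ x * inner ℝ (G x) v) (P.sub i) := fun ψ K hψ h0 => by
    obtain ⟨M, -, hM⟩ := bd ψ K hψ h0
    exact Integrable.bdd_mul (c := M) iG hψ.continuous.aestronglyMeasurable (ae_of_all _ hM)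
  have i3 : ∀ (ψ : Sp (n + 1) → ℝ) (K : NNReal), LipschitzWith K ψ → (∀ x ∉ P.Om, ψ x = 0) →
      Integrable (fun x => trace (P.sub i) u x * (ψ x * inner ℝ (outerNormal (P.sub i) x) v))
        P.surf := fun ψ K hψ h0 => by
    obtain ⟨M, hM0, hM⟩ := bd ψ K hψ h0
    refine Integrable.mul_bdd (c := M * ‖v‖) (lt.integrable (by norm_num)) ?_ ?_
    · exact hψ.continuous.aestronglyMeasurable.mul
        ((P.aestronglyMeasurable_outerNormal i).inner_const)
    · filter_upwards [P.ae_isOuterNormal i] with x hx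
      rw [norm_mul]
      refine mul_le_mul (hM x) ?_ (norm_nonneg _) hM0
      have := abs_real_inner_le_norm (outerNormal (P.sub i) x) v
      rwa [hx.1, one_mul] at this
  -- induction on the number of charts that are needed to cover the support on the interface
  have main : ∀ (s : Finset (Fin N)) (ψ : Sp (n + 1) → ℝ) (K : NNReal), LipschitzWith K ψ →
      (∀ x ∉ P.Om, ψ x = 0) →
      (∀ x ∈ P.Gam, ψ x ≠ 0 → ∃ j ∈ s, Metric.ball x δ ⊆ (C j).box) →
      (∫ x in P.sub i, u x * fderiv ℝ ψ x v) + ∫ x in P.sub i, ψ x * inner ℝ (G x) v =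
        ∫ x, trace (P.sub i) u x * (ψ x * inner ℝ (outerNormal (P.sub i) x) v) ∂P.surf := by
    intro s
    induction s using Finset.induction_on with
    | empty =>
      intro ψ K hψ h0 hs
      have hz : ∀ x ∈ P.Gam, ψ x = 0 := fun x hx => by
        by_contra h
        obtain ⟨j, hj, -⟩ := hs x hx h
        simp at hj
      rw [P.integral_by_parts_of_eq_zero lu hG lG v hψ h0 hz]
      symm
      refine integral_eq_zero_of_ae ?_
      filter_upwards [P.surf_ae_mem_Gam] with x hx
      simp [hz x hx]
    | insert j s hj ih =>
      intro ψ K hψ h0 hs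
      set θ : Sp (n + 1) → ℝ := fun x => min 1 (δ⁻¹ * Metric.infDist x (C j).boxᶜ) with hθ
      have hne : ((C j).boxᶜ).Nonempty := by
        refine ⟨(C j).pt ((C j).b, (C j).r), fun h => ?_⟩
        have := h.2
        rw [GraphChart.height_pt, abs_of_pos (C j).r_pos] at this
        exact lt_irrefl _ this
      have θ0 : ∀ x, 0 ≤ θ x := fun x =>
        le_min zero_le_one (mul_nonneg (inv_nonneg.2 hδ.le) Metric.infDist_nonneg)
      have θ1 : ∀ x, θ x ≤ 1 := fun x => min_le_left _ _
      have θb : ∀ x, ‖θ x‖ ≤ 1 := fun x => by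
        rw [Real.norm_of_nonneg (θ0 x)]
        exact θ1 x
      have θbox : ∀ x ∉ (C j).box, θ x = 0 := fun x hx => by
        simp [hθ, Metric.infDist_zero_of_mem (show x ∈ (C j).boxᶜ from hx)]
      have θone : ∀ x, Metric.ball x δ ⊆ (C j).box → θ x = 1 := fun x hx => by
        refine min_eq_left ?_
        rw [← div_eq_inv_mul, one_le_div hδ, Metric.le_infDist hne]
        intro y hy
        by_contra hlt
        exact hy (hx (by rw [Metric.mem_ball, dist_comm]; exact not_le.1 hlt))
      have θL : LipschitzWith (Real.toNNReal δ⁻¹) θ := by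
        refine LipschitzWith.const_min ?_ 1
        refine LipschitzWith.of_dist_le_mul fun x y => ?_
        rw [Real.dist_eq, ← mul_sub, abs_mul, abs_of_pos (inv_pos.2 hδ),
          Real.coe_toNNReal _ (inv_nonneg.2 hδ.le)]
        refine mul_le_mul_of_nonneg_left ?_ (inv_nonneg.2 hδ.le)
        have := (Metric.lipschitz_infDist_pt (C j).boxᶜ).dist_le_mul x y
        rwa [NNReal.coe_one, one_mul, Real.dist_eq] at this
      obtain ⟨M, -, hM⟩ := bd ψ K hψ h0
      obtain ⟨K₁, hK₁⟩ := hψ.exists_mul_of_bounded θL hM θb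
      have hK₂ : LipschitzWith (K + K₁) fun x => ψ x - ψ x * θ x := hψ.sub hK₁
      have z1 : ∀ x ∉ P.Om, ψ x * θ x = 0 := fun x hx => by rw [h0 x hx, zero_mul]
      have z2 : ∀ x ∉ P.Om, ψ x - ψ x * θ x = 0 := fun x hx => by rw [h0 x hx]; simp
      have r1 := P.integral_by_parts_of_chart (hfit j) lu hG lG v hK₁ z1
        (fun x hx => by rw [θbox x hx, mul_zero])
      have r2 := ih (fun x => ψ x - ψ x * θ x) _ hK₂ z2 (fun x hx hx0 => by
        have hψx : ψ x ≠ 0 := fun h => hx0 (by rw [h]; simp)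
        obtain ⟨l, hl, hb⟩ := hs x hx hψx
        rcases Finset.mem_insert.1 hl with rfl | hl
        · exact absurd (by rw [θone x hb]; simp) hx0
        · exact ⟨l, hl, hb⟩)
      have s1 : (∫ x in P.sub i, u x * fderiv ℝ ψ x v) =
          (∫ x in P.sub i, u x * fderiv ℝ (fun x => ψ x * θ x) x v) +
            ∫ x in P.sub i, u x * fderiv ℝ (fun x => ψ x - ψ x * θ x) x v := by
        rw [← integral_add (i1 _ _ hK₁) (i1 _ _ hK₂)]
        refine integral_congr_ae (ae_restrict_of_ae ?_)
        filter_upwards [hψ.ae_differentiableAt (μ := volume),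
          hK₁.ae_differentiableAt (μ := volume)] with x d1 d2
        have : fderiv ℝ (fun x => ψ x - ψ x * θ x) x =
          fderiv ℝ ψ x - fderiv ℝ (fun x => ψ x * θ x) x := (d1.hasFDerivAt.sub d2.hasFDerivAt).fderiv
        rw [this, _root_.sub_apply]
        ring
      have s2 : (∫ x in P.sub i, ψ x * inner ℝ (G x) v) =
          (∫ x in P.sub i, ψ x * θ x * inner ℝ (G x) v) +
            ∫ x in P.sub i, (ψ x - ψ x * θ x) * inner ℝ (G x) v := by
        rw [← integral_add (i2 _ _ hK₁ z1) (i2 _ _ hK₂ z2)]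
        congr 1 with x
        ring
      have s3 : (∫ x, trace (P.sub i) u x * (ψ x * inner ℝ (outerNormal (P.sub i) x) v) ∂P.surf) =
          (∫ x, trace (P.sub i) u x * (ψ x * θ x * inner ℝ (outerNormal (P.sub i) x) v) ∂P.surf) +
            ∫ x, trace (P.sub i) u x *
              ((ψ x - ψ x * θ x) * inner ℝ (outerNormal (P.sub i) x) v) ∂P.surf := by
        rw [← integral_add (i3 _ _ hK₁ z1) (i3 _ _ hK₂ z2)]
        congr 1 with x
        ring
      rw [s1, s2, s3]
      linarith
  refine main Finset.univ φ L hφ hO fun x hx _ => ?_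
  obtain ⟨j, hj⟩ := hleb x (subset_closure hx)
  exact ⟨j, Finset.mem_univ j, hj⟩

end InterfaceProblem

/-! ### Broken gradients -/

namespace InterfaceProblem

variable {n : ℕ} (P : InterfaceProblem n) {T : Finset (Sp (n + 1))} {i : Fin 2}

/-- The union of all sub-elements. -/
def dom : Set (Sp (n + 1)) := ⋃ T ∈ P.elements, ⋃ i, P.part T i

theorem mem_dom {x : Sp (n + 1)} : x ∈ P.dom ↔ ∃ T ∈ P.elements, ∃ i, x ∈ P.part T i := by
  simp [dom]

theorem dom_eq : P.dom = ⋃ q : P.elements × Fin 2, P.part q.1 q.2 := by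
  ext x
  simp [mem_dom]

theorem isOpen_dom : IsOpen P.dom := by
  rw [dom_eq]
  exact isOpen_iUnion fun q => P.isOpen_part _ _

theorem part_subset_dom (hT : T ∈ P.elements) (i : Fin 2) : P.part T i ⊆ P.dom :=
  fun _ hx => P.mem_dom.2 ⟨T, hT, i, hx⟩

theorem dom_subset_Om : P.dom ⊆ P.Om := fun x hx => by
  obtain ⟨T, -, i, hx⟩ := P.mem_dom.1 hx
  exact P.part_subset_Om T i hx

instance : IsFiniteMeasure (volume.restrict P.Om) :=
  ⟨by rw [Measure.restrict_apply_univ]; exact P.volume_Om_lt_top⟩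

instance : IsFiniteMeasure (volume.restrict P.dom) :=
  ⟨by
    rw [Measure.restrict_apply_univ]
    exact (measure_mono P.dom_subset_Om).trans_lt P.volume_Om_lt_top⟩

theorem volume_Gam : volume P.Gam = 0 := by
  obtain ⟨N, C, hfit, hcov⟩ := P.exists_patches 0
  refine measure_mono_null hcov (measure_iUnion_null fun j => ?_)
  refine measure_mono_null ?_ (measure_eq_zero_iff_ae_notMem.2 ((C j).ae_height_ne 0))
  rintro x ⟨y, -, rfl⟩
  exact (C j).height_gr y

theorem ae_mem_dom : ∀ᵐ x, x ∈ P.Om → x ∈ P.dom := by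
  filter_upwards [P.ae_mem_openElt, measure_eq_zero_iff_ae_notMem.1 P.volume_Gam] with x h1 h2 hx
  obtain ⟨T, hT, hxT⟩ := h1 hx
  have : x ∈ P.sub 0 ∪ P.sub 1 := by
    by_contra h
    exact h2 ⟨hx, h⟩
  rcases this with h | h
  · exact P.mem_dom.2 ⟨T, hT, 0, hxT, h⟩
  · exact P.mem_dom.2 ⟨T, hT, 1, hxT, h⟩

/-- The element boundaries and the interface have volume zero. -/
theorem restrict_dom : volume.restrict P.dom = volume.restrict P.Om := by
  refine Measure.restrict_congr_set ?_
  filter_upwards [P.ae_mem_dom] with x hx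
  exact propext ⟨fun h => P.dom_subset_Om h, hx⟩

theorem ae_dom_of_part {p : Sp (n + 1) → Prop}
    (h : ∀ T ∈ P.elements, ∀ i, ∀ᵐ x ∂volume.restrict (P.part T i), p x) :
    ∀ᵐ x ∂volume.restrict P.dom, p x := by
  rw [dom_eq, ae_restrict_iUnion_iff]
  exact fun q => h _ q.1.2 _

theorem ae_part_of_dom {p : Sp (n + 1) → Prop} (h : ∀ᵐ x ∂volume.restrict P.dom, p x)
    (hT : T ∈ P.elements) (i : Fin 2) : ∀ᵐ x ∂volume.restrict (P.part T i), p x :=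
  ae_restrict_of_ae_restrict_of_subset (P.part_subset_dom hT i) h

theorem ae_sub_of_dom {p : Sp (n + 1) → Prop} (h : ∀ᵐ x ∂volume.restrict P.dom, p x)
    (i : Fin 2) : ∀ᵐ x ∂volume.restrict (P.sub i), p x := by
  rw [restrict_dom] at h
  exact ae_restrict_of_ae_restrict_of_subset (P.sub_subset i) h

theorem iUnion_part_ae_eq (i : Fin 2) :
    (⋃ T ∈ P.elements, P.part T i : Set (Sp (n + 1))) =ᵐ[volume] P.sub i := by
  filter_upwards [P.ae_mem_openElt] with x hx
  refine propext ⟨fun h => ?_, fun h => ?_⟩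
  · obtain ⟨T, -, h⟩ := mem_iUnion₂.1 h
    exact h.2
  · obtain ⟨T, hT, hxT⟩ := hx (P.sub_subset i h)
    exact mem_iUnion₂.2 ⟨T, hT, hxT, h⟩

theorem setIntegral_sub_eq_sum {f : Sp (n + 1) → ℝ} (hf : IntegrableOn f (P.sub i)) :
    ∫ x in P.sub i, f x = ∑ T ∈ P.elements, ∫ x in P.part T i, f x := by
  rw [← setIntegral_congr_set (P.iUnion_part_ae_eq i)]
  refine integral_biUnion_finset _ (fun T _ => (P.isOpen_part T i).measurableSet) ?_
    fun T _ => hf.mono_set (P.part_subset_sub T i)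
  intro T hT T' hT' hne
  exact P.disjoint_part hT hT' (Or.inl hne)

theorem setIntegral_Om_eq_sum {f : Sp (n + 1) → ℝ} (hf : ∀ i, IntegrableOn f (P.sub i)) :
    ∫ x in P.Om, f x = ∑ i, ∫ x in P.sub i, f x := by
  have h : (P.sub 0 ∪ P.sub 1 : Set (Sp (n + 1))) =ᵐ[volume] P.Om := by
    filter_upwards [measure_eq_zero_iff_ae_notMem.1 P.volume_Gam] with x hx
    refine propext ⟨fun h => h.elim (fun h => P.sub_subset 0 h) fun h => P.sub_subset 1 h,
      fun h => ?_⟩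
    by_contra h'
    exact hx ⟨h, h'⟩
  rw [← setIntegral_congr_set h, setIntegral_union P.disjoint_sub (P.isOpen_sub 1).measurableSet
    (hf 0) (hf 1), Fin.sum_univ_two]

theorem sum_indicator_part {F : Type*} [AddCommMonoid F]
    (f : Finset (Sp (n + 1)) → Fin 2 → Sp (n + 1) → F) (hT : T ∈ P.elements) {x : Sp (n + 1)}
    (hx : x ∈ P.part T i) :
    ∑ T' ∈ P.elements, ∑ j, (P.part T' j).indicator (f T' j) x = f T i x := by
  rw [Finset.sum_eq_single T, Finset.sum_eq_single i, indicator_of_mem hx]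
  · intro j _ hj
    exact indicator_of_notMem
      (fun h => (P.disjoint_part hT hT (Or.inr hj)).ne_of_mem h hx rfl) _
  · simp
  · intro T' hT' hne
    refine Finset.sum_eq_zero fun j _ => indicator_of_notMem
      (fun h => (P.disjoint_part hT' hT (Or.inl hne)).ne_of_mem h hx rfl) _
  · exact fun h => absurd hT h

/-- Weak gradients on the sub-elements are combined to a broken gradient. -/
theorem hasWeakGrad_dom {u : Sp (n + 1) → ℝ}
    {G : Finset (Sp (n + 1)) → Fin 2 → Sp (n + 1) → Sp (n + 1)}
    (h : ∀ T ∈ P.elements, ∀ i, HasWeakGrad (P.part T i) u (G T i)) :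
    HasWeakGrad P.dom u fun x => ∑ T ∈ P.elements, ∑ i, (P.part T i).indicator (G T i) x := by
  rw [dom_eq]
  refine HasWeakGrad.iUnion (fun q => P.isOpen_part _ _) ?_ fun q => ?_
  · intro q q' hne
    refine P.disjoint_part q.1.2 q'.1.2 ?_
    by_contra! h'
    exact hne (Prod.ext (Subtype.ext h'.1) h'.2)
  · refine (h _ q.1.2 q.2).congr (ae_of_all _ fun _ => rfl) ?_
    filter_upwards [ae_restrict_mem (P.isOpen_part _ _).measurableSet] with x hx
    exact (P.sum_indicator_part G q.1.2 hx).symm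

theorem hasWeakGrad_grad {u : Sp (n + 1) → ℝ}
    {G : Finset (Sp (n + 1)) → Fin 2 → Sp (n + 1) → Sp (n + 1)}
    (h : ∀ T ∈ P.elements, ∀ i, HasWeakGrad (P.part T i) u (G T i)) :
    HasWeakGrad P.dom u (P.grad u) :=
  hasWeakGrad_weakGrad (P.hasWeakGrad_dom h)

theorem grad_ae_eq {u : Sp (n + 1) → ℝ}
    {G : Finset (Sp (n + 1)) → Fin 2 → Sp (n + 1) → Sp (n + 1)}
    (h : ∀ T ∈ P.elements, ∀ i, HasWeakGrad (P.part T i) u (G T i)) (hT : T ∈ P.elements)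
    (i : Fin 2) : ∀ᵐ x ∂volume.restrict (P.part T i), P.grad u x = G T i x := by
  filter_upwards [P.ae_part_of_dom ((P.hasWeakGrad_dom h).weakGrad_ae_eq P.isOpen_dom) hT i,
    ae_restrict_mem (P.isOpen_part _ _).measurableSet] with x hx hxp
  rw [P.sum_indicator_part G hT hxp] at hx
  exact hx

theorem memLp_dom_of_sub {F : Type*} [NormedAddCommGroup F] {f : Sp (n + 1) → F}
    (h : ∀ i, MemLp f 2 (volume.restrict (P.sub i))) : MemLp f 2 (volume.restrict P.dom) := by
  have hs : P.dom ⊆ P.sub 0 ∪ P.sub 1 := fun x hx => by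
    obtain ⟨T, -, i, hx⟩ := P.mem_dom.1 hx
    fin_cases i
    · exact Or.inl hx.2
    · exact Or.inr hx.2
  have hm : AEStronglyMeasurable f (volume.restrict P.dom) :=
    (aestronglyMeasurable_union_iff.2 ⟨(h 0).1, (h 1).1⟩).mono_set hs
  rw [memLp_two_iff_integrable_sq_norm hm]
  have h' := fun i => (memLp_two_iff_integrable_sq_norm (h i).1).1 (h i)
  exact IntegrableOn.mono_set (IntegrableOn.union (h' 0) (h' 1)) hs

end InterfaceProblem

/-! ### Sobolev spaces -/

section Sobolev

variable {m : ℕ} {U : Set (Sp m)} {u v : Sp m → ℝ}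

theorem MemH1.hasWeakGrad (h : MemH1 U u) : HasWeakGrad U u (weakGrad U u) := by
  obtain ⟨-, G, hG, -⟩ := h
  exact hasWeakGrad_weakGrad hG

theorem MemH1.memLp_weakGrad (hU : IsOpen U) (h : MemH1 U u) :
    MemLp (weakGrad U u) 2 (volume.restrict U) := by
  obtain ⟨-, G, hG, lG⟩ := h
  exact lG.ae_eq ((hG.weakGrad_ae_eq hU).mono fun x hx => hx.symm)

theorem MemH1.add (hu : MemH1 U u) (hv : MemH1 U v) : MemH1 U (u + v) := by
  obtain ⟨lu, G, hG, lG⟩ := hu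
  obtain ⟨lv, H, hH, lH⟩ := hv
  exact ⟨lu.add lv, G + H, hG.add hH, lG.add lH⟩

theorem MemH1.smul (hu : MemH1 U u) (r : ℝ) : MemH1 U (r • u) := by
  obtain ⟨lu, G, hG, lG⟩ := hu
  exact ⟨lu.const_smul r, r • G, hG.smul r, lG.const_smul r⟩

end Sobolev

/-! ### Functions with a square integrable broken gradient -/

namespace InterfaceProblem

variable {n : ℕ} (P : InterfaceProblem n) {T : Finset (Sp (n + 1))} {i : Fin 2} {k : ℕ}
  {u v : Sp (n + 1) → ℝ}

/-- `u` has a square integrable broken gradient. -/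
structure IsBroken (u : Sp (n + 1) → ℝ) : Prop where
  hasWeakGrad : HasWeakGrad P.dom u (P.grad u)
  memLp_grad : MemLp (P.grad u) 2 (volume.restrict P.dom)

/-- `u` has a square integrable broken gradient, which has square integrable traces on the
interface from both sides. -/
structure HasFlux (u : Sp (n + 1) → ℝ) : Prop extends P.IsBroken u where
  hasTrace : ∀ i, ∀ᵐ x ∂P.surf, HasTrace (P.sub i) (P.grad u) x (trace (P.sub i) (P.grad u) x)
  memLp_trace : ∀ i, MemLp (trace (P.sub i) (P.grad u)) 2 P.surf

variable {P}

theorem IsBroken.grad_smul_add (hu : P.IsBroken u) (hv : P.IsBroken v) (r : ℝ) :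
    ∀ᵐ x ∂volume.restrict P.dom, P.grad (r • u + v) x = r • P.grad u x + P.grad v x :=
  ((hu.hasWeakGrad.smul r).add hv.hasWeakGrad).weakGrad_ae_eq P.isOpen_dom

theorem IsBroken.smul_add (hu : P.IsBroken u) (hv : P.IsBroken v) (r : ℝ) :
    P.IsBroken (r • u + v) := by
  refine ⟨hasWeakGrad_weakGrad ((hu.hasWeakGrad.smul r).add hv.hasWeakGrad), ?_⟩
  exact ((hu.memLp_grad.const_smul r).add hv.memLp_grad).ae_eq
    ((hu.grad_smul_add hv r).mono fun x hx => hx.symm)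

theorem IsBroken.integrableOn_grad (hu : P.IsBroken u) (i : Fin 2) :
    IntegrableOn (P.grad u) (P.sub i) := by
  have h : IntegrableOn (P.grad u) P.Om := by
    rw [IntegrableOn, ← P.restrict_dom]
    exact hu.memLp_grad.integrable (by norm_num)
  exact h.mono_set (P.sub_subset i)

theorem HasFlux.hasTrace_smul_add (hu : P.HasFlux u) (hv : P.HasFlux v) (r : ℝ) (i : Fin 2) :
    ∀ᵐ x ∂P.surf, HasTrace (P.sub i) (P.grad (r • u + v)) x
      (r • trace (P.sub i) (P.grad u) x + trace (P.sub i) (P.grad v) x) := by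
  filter_upwards [hu.hasTrace i, hv.hasTrace i] with x h1 h2
  refine ((h1.smul r).add h2 ((hu.integrableOn_grad i).smul r) (hv.integrableOn_grad i)).congr ?_
  refine (P.ae_sub_of_dom (hu.toIsBroken.grad_smul_add hv.toIsBroken r) i).mono fun y hy => ?_
  rw [hy]
  rfl

theorem HasFlux.trace_smul_add (hu : P.HasFlux u) (hv : P.HasFlux v) (r : ℝ) (i : Fin 2) :
    ∀ᵐ x ∂P.surf, trace (P.sub i) (P.grad (r • u + v)) x =
      r • trace (P.sub i) (P.grad u) x + trace (P.sub i) (P.grad v) x :=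
  (hu.hasTrace_smul_add hv r i).mono fun _ hx => hx.trace_eq

theorem HasFlux.smul_add (hu : P.HasFlux u) (hv : P.HasFlux v) (r : ℝ) :
    P.HasFlux (r • u + v) where
  toIsBroken := hu.toIsBroken.smul_add hv.toIsBroken r
  hasTrace i := by
    filter_upwards [hu.hasTrace_smul_add hv r i] with x hx
    rw [hx.trace_eq]
    exact hx
  memLp_trace i := (((hu.memLp_trace i).const_smul r).add (hv.memLp_trace i)).ae_eq
    ((hu.trace_smul_add hv r i).mono fun _ hx => hx.symm)

theorem MemH1Sub.smul_add (hu : P.MemH1Sub u) (hv : P.MemH1Sub v) (r : ℝ) :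
    P.MemH1Sub (r • u + v) := fun i => ((hu i).smul r).add (hv i)

theorem MemH1Sub.trace_smul_add (hu : P.MemH1Sub u) (hv : P.MemH1Sub v) (r : ℝ) (i : Fin 2) :
    ∀ᵐ x ∂P.surf, trace (P.sub i) (r • u + v) x =
      r * trace (P.sub i) u x + trace (P.sub i) v x := by
  filter_upwards [P.ae_hasTrace_of_memH1 (hu i), P.ae_hasTrace_of_memH1 (hv i)] with x h1 h2
  exact ((h1.smul r).add h2 (Integrable.smul r ((hu i).1.integrable (by norm_num)))
    ((hv i).1.integrable (by norm_num))).trace_eq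

theorem MemH1Sub.jump_smul_add (hu : P.MemH1Sub u) (hv : P.MemH1Sub v) (r : ℝ) :
    ∀ᵐ x ∂P.surf, P.jump (r • u + v) x = r * P.jump u x + P.jump v x := by
  filter_upwards [hu.trace_smul_add hv r 0, hu.trace_smul_add hv r 1] with x h0 h1
  rw [jump, h0, h1, jump, jump]
  ring

theorem MemH1Sub.memLp_jump (hu : P.MemH1Sub u) : MemLp (P.jump u) 2 P.surf :=
  (P.memLp_trace_of_memH1 (hu 0)).sub (P.memLp_trace_of_memH1 (hu 1))

theorem MemH1Sub.hasWeakGrad_part (hu : P.MemH1Sub u) :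
    ∀ T ∈ P.elements, ∀ i, HasWeakGrad (P.part T i) u (weakGrad (P.sub i) u) :=
  fun T _ i => (hu i).hasWeakGrad.mono (P.part_subset_sub T i)

/-- On functions in `H¹(Ω₁ ∪ Ω₂)` the element boundaries do not matter for the broken gradient. -/
theorem MemH1Sub.grad_ae_eq (hu : P.MemH1Sub u) (i : Fin 2) :
    ∀ᵐ x ∂volume.restrict (P.sub i), P.grad u x = weakGrad (P.sub i) u x := by
  have h : ∀ᵐ x ∂volume.restrict P.dom, ∀ j, x ∈ P.sub j → P.grad u x = weakGrad (P.sub j) u x := by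
    refine P.ae_dom_of_part fun T hT l => ?_
    filter_upwards [P.grad_ae_eq (G := fun _ i => weakGrad (P.sub i) u) hu.hasWeakGrad_part hT l,
      ae_restrict_mem (P.isOpen_part T l).measurableSet] with x hx hxl j hxj
    have : l = j := by
      by_contra hne
      exact (P.disjoint_sub_of_ne hne).ne_of_mem hxl.2 hxj rfl
    rw [hx, this]
  filter_upwards [P.ae_sub_of_dom h i, ae_restrict_mem (P.isOpen_sub i).measurableSet] with x hx hxi
  exact hx i hxi

theorem MemH1Sub.isBroken (hu : P.MemH1Sub u) : P.IsBroken u where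
  hasWeakGrad := P.hasWeakGrad_grad (G := fun _ i => weakGrad (P.sub i) u) hu.hasWeakGrad_part
  memLp_grad := P.memLp_dom_of_sub fun i =>
    ((hu i).memLp_weakGrad (P.isOpen_sub i)).ae_eq ((hu.grad_ae_eq i).mono fun _ hx => hx.symm)

theorem MemVreg.memH1Sub (hu : P.MemVreg u) : P.MemH1Sub u := fun i => (hu i).1

/-- The trace of the broken gradient of a function in `V_reg` consists of the traces of the weak
derivatives. -/
theorem MemVreg.hasTrace_grad (hu : P.MemVreg u) (i : Fin 2) :
    ∀ᵐ x ∂P.surf, HasTrace (P.sub i) (P.grad u) x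
      (WithLp.toLp 2 fun j => trace (P.sub i) (fun y => weakGrad (P.sub i) u y j) x) := by
  have h : ∀ᵐ x ∂P.surf, ∀ j, HasTrace (P.sub i) (fun y => weakGrad (P.sub i) u y j) x
      (trace (P.sub i) (fun y => weakGrad (P.sub i) u y j) x) :=
    ae_all_iff.2 fun j => P.ae_hasTrace_of_memH1 ((hu i).2 j)
  filter_upwards [h] with x hx
  refine (hasTrace_of_components (G := weakGrad (P.sub i) u) ?_ hx).congr
    ((hu.memH1Sub.grad_ae_eq i).mono fun _ h => h.symm)
  exact ((hu i).1.memLp_weakGrad (P.isOpen_sub i)).integrable (by norm_num)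

theorem MemVreg.hasFlux (hu : P.MemVreg u) : P.HasFlux u where
  toIsBroken := hu.memH1Sub.isBroken
  hasTrace i := by
    filter_upwards [hu.hasTrace_grad i] with x hx
    rw [hx.trace_eq]
    exact hx
  memLp_trace i := by
    have h : MemLp (fun x => ∑ j, trace (P.sub i) (fun y => weakGrad (P.sub i) u y j) x •
        EuclideanSpace.single j (1 : ℝ)) 2 P.surf :=
      memLp_finsetSum _ fun j _ =>
        (ContinuousLinearMap.toSpanSingleton ℝ (EuclideanSpace.single j (1 : ℝ))).comp_memLp'
          (P.memLp_trace_of_memH1 ((hu i).2 j))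
    refine h.ae_eq ?_
    filter_upwards [hu.hasTrace_grad i] with x hx
    rw [hx.trace_eq]
    ext l
    simp [Pi.single_apply]

/-! ### Broken polynomials -/

/-- `u` is on each sub-element a polynomial of degree at most `k`. -/
def IsBrokenPoly (P : InterfaceProblem n) (k : ℕ) (u : Sp (n + 1) → ℝ) : Prop :=
  ∀ T ∈ P.elements, ∀ i, IsPolyOn k (P.part T i) u

theorem hasWeakGrad_of_polyFun {p : MvPolynomial (Fin (n + 1)) ℝ}
    (h : ∀ x ∈ P.part T i, u x = polyFun p x) :
    HasWeakGrad (P.part T i) u (gradient (polyFun p)) := by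
  refine (hasWeakGrad_of_contDiff (contDiff_polyFun p) _).congr ?_ (ae_of_all _ fun _ => rfl)
  filter_upwards [ae_restrict_mem (P.isOpen_part T i).measurableSet] with x hx using (h x hx).symm

theorem exists_bound_gradient (T : Finset (Sp (n + 1))) (p : MvPolynomial (Fin (n + 1)) ℝ) :
    ∃ M, ∀ x ∈ openElt T, ‖gradient (polyFun p) x‖ ≤ M := by
  obtain ⟨M, hM⟩ := (T.finite_toSet.isCompact_convexHull (𝕜 := ℝ)).exists_bound_of_continuousOn
    (continuous_gradient (contDiff_polyFun p)).continuousOn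
  exact ⟨M, fun x hx => hM x (interior_subset hx)⟩

/-- The trace at an interior point of an element of a broken gradient that agrees on a sub-element
with the gradient of a polynomial. -/
theorem hasTrace_grad_of_part {p : MvPolynomial (Fin (n + 1)) ℝ}
    (h : ∀ᵐ x ∂volume.restrict (P.part T i), P.grad u x = gradient (polyFun p) x)
    {x : Sp (n + 1)} (hx : x ∈ P.Gam) (hxT : x ∈ openElt T) :
    HasTrace (P.sub i) (P.grad u) x (gradient (polyFun p) x) :=
  hasTrace_of_continuous (P.isOpen_sub i) (frontier_subset_closure (P.Gam_subset_frontier i hx))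
    ((isOpen_openElt T).mem_nhds hxT) (continuous_gradient (contDiff_polyFun p)) h

theorem memLp_indicator_gradient (T : Finset (Sp (n + 1))) (p : MvPolynomial (Fin (n + 1)) ℝ)
    {S : Set (Sp (n + 1))} (hS : MeasurableSet S) (hST : S ⊆ openElt T)
    {μ : Measure (Sp (n + 1))} [IsFiniteMeasure μ] :
    MemLp (S.indicator (gradient (polyFun p))) 2 μ := by
  obtain ⟨M, hM⟩ := exists_bound_gradient T p
  refine MemLp.of_bound (C := max M 0)
    (((continuous_gradient (contDiff_polyFun p)).stronglyMeasurable.indicator hS).aestronglyMeasurable)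
    (ae_of_all _ fun x => ?_)
  by_cases hx : x ∈ S
  · rw [indicator_of_mem hx]
    exact (hM x (hST hx)).trans (le_max_left _ _)
  · rw [indicator_of_notMem hx, norm_zero]
    exact le_max_right _ _

/-- The polynomials that describe a broken polynomial, its broken gradient, and the traces of the
broken gradient. -/
theorem IsBrokenPoly.exists_poly (hu : P.IsBrokenPoly k u) :
    ∃ p : Finset (Sp (n + 1)) → Fin 2 → MvPolynomial (Fin (n + 1)) ℝ,
      ∀ T ∈ P.elements, ∀ i, (p T i).totalDegree ≤ k ∧
        (∀ x ∈ P.part T i, u x = polyFun (p T i) x) ∧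
        HasWeakGrad (P.part T i) u (gradient (polyFun (p T i))) ∧
        (∀ᵐ x ∂volume.restrict (P.part T i), P.grad u x = gradient (polyFun (p T i)) x) ∧
        ∀ x ∈ P.Gam, x ∈ openElt T →
          HasTrace (P.sub i) (P.grad u) x (gradient (polyFun (p T i)) x) := by
  have h : ∀ T, ∃ q : Fin 2 → MvPolynomial (Fin (n + 1)) ℝ, T ∈ P.elements → ∀ i,
      (q i).totalDegree ≤ k ∧ ∀ x ∈ P.part T i, u x = polyFun (q i) x := fun T => by
    by_cases hT : T ∈ P.elements
    · choose q hq using hu T hT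
      exact ⟨q, fun _ => hq⟩
    · exact ⟨0, fun h => absurd h hT⟩
  choose p hp using h
  have hw : ∀ T ∈ P.elements, ∀ i, HasWeakGrad (P.part T i) u (gradient (polyFun (p T i))) :=
    fun T hT i => hasWeakGrad_of_polyFun (hp T hT i).2
  have hg := fun T (hT : T ∈ P.elements) i =>
    P.grad_ae_eq (G := fun T i => gradient (polyFun (p T i))) hw hT i
  exact ⟨p, fun T hT i => ⟨(hp T hT i).1, (hp T hT i).2, hw T hT i, hg T hT i,
    fun x hx hxT => hasTrace_grad_of_part (hg T hT i) hx hxT⟩⟩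

/-- At a point of the interface inside of an element, the broken gradient of a broken polynomial is
on either side the gradient of a polynomial, and the remaining points have surface measure
zero. No continuity across the element boundaries is needed. -/
theorem IsBrokenPoly.hasFlux (hu : P.IsBrokenPoly k u) : P.HasFlux u := by
  obtain ⟨p, hp⟩ := hu.exists_poly
  have tr : ∀ i, ∀ᵐ x ∂P.surf,
      HasTrace (P.sub i) (P.grad u) x (trace (P.sub i) (P.grad u) x) := fun i => by
    filter_upwards [P.surf_ae_mem_Gam, P.surf_ae_mem_openElt] with x hx hxT
    obtain ⟨T, hT, hxT⟩ := hxT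
    have := (hp T hT i).2.2.2.2 x hx hxT
    rw [this.trace_eq]
    exact this
  refine ⟨⟨P.hasWeakGrad_grad fun T hT i => (hp T hT i).2.2.1, ?_⟩, tr, fun i => ?_⟩
  · have h : MemLp (fun x => ∑ T ∈ P.elements, ∑ i,
        (P.part T i).indicator (gradient (polyFun (p T i))) x) 2 (volume.restrict P.dom) :=
      memLp_finsetSum _ fun T _ => memLp_finsetSum _ fun i _ =>
        memLp_indicator_gradient T _ (P.isOpen_part T i).measurableSet (P.part_subset_openElt T i)
    refine h.ae_eq (P.ae_dom_of_part fun T hT i => ?_)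
    filter_upwards [(hp T hT i).2.2.2.1, ae_restrict_mem (P.isOpen_part T i).measurableSet]
      with x hx hxT
    rw [P.sum_indicator_part (fun T i => gradient (polyFun (p T i))) hT hxT, hx]
  · have h : MemLp (fun x => ∑ T ∈ P.elements,
        (openElt T).indicator (gradient (polyFun (p T i))) x) 2 P.surf :=
      memLp_finsetSum _ fun T _ =>
        memLp_indicator_gradient T _ (isOpen_openElt T).measurableSet subset_rfl
    refine h.ae_eq ?_
    filter_upwards [P.surf_ae_mem_Gam, P.surf_ae_mem_openElt] with x hx hxT
    obtain ⟨T, hT, hxT⟩ := hxT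
    rw [((hp T hT i).2.2.2.2 x hx hxT).trace_eq, Finset.sum_eq_single T, indicator_of_mem hxT]
    · intro T' hT' hne
      exact indicator_of_notMem
        (fun h => (P.disjoint_openElt hT' hT hne).ne_of_mem h hxT rfl) _
    · exact fun h => absurd hT h

theorem MemVh.isBrokenPoly (hu : P.MemVh k u) : P.IsBrokenPoly k u := by
  intro T hT i
  obtain ⟨w, hw, hwu⟩ := hu i
  obtain ⟨p, hpk, hp⟩ := hw.2.1 T hT
  exact ⟨p, hpk, fun x hx => by rw [hwu x hx.2, hp x (interior_subset hx.1)]⟩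

/-- On each sub-domain, a function in `V_h` agrees with a Lipschitz function that vanishes outside
of `Ω`. -/
theorem MemVh.exists_lipschitz (hu : P.MemVh k u) (i : Fin 2) :
    ∃ (w : Sp (n + 1) → ℝ) (K : NNReal), LipschitzWith K w ∧ (∀ x ∉ P.Om, w x = 0) ∧
      ∀ x ∈ P.sub i, u x = w x := by
  obtain ⟨w, hw, hwu⟩ := hu i
  obtain ⟨K, hK⟩ := hw.lipschitz
  refine ⟨_, K, hK, fun x hx => indicator_of_notMem hx w, fun x hx => ?_⟩
  rw [indicator_of_mem (show x ∈ P.Om from P.sub_subset i hx), hwu x hx]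

theorem MemVh.memH1Sub (hu : P.MemVh k u) : P.MemH1Sub u := by
  intro i
  obtain ⟨w, K, hK, hw, hwu⟩ := hu.exists_lipschitz i
  have hae : ∀ᵐ x ∂volume.restrict (P.sub i), w x = u x := by
    filter_upwards [ae_restrict_mem (P.isOpen_sub i).measurableSet] with x hx using (hwu x hx).symm
  refine ⟨?_, gradient w, (hasWeakGrad_of_lipschitz hK _).congr hae (ae_of_all _ fun _ => rfl), ?_⟩
  · exact ((hK.continuous.memLp_of_hasCompactSupport (P.hasCompactSupport_of_eq_zero hw)).restrict
      _).ae_eq hae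
  · refine MemLp.of_bound (C := K) ?_ (ae_of_all _ fun x => ?_)
    · exact ((InnerProductSpace.toDual ℝ (Sp (n + 1))).symm.continuous.measurable.comp
        (measurable_fderiv ℝ w)).aestronglyMeasurable
    · rw [gradient, LinearIsometryEquiv.norm_map]
      exact norm_fderiv_le_of_lipschitz ℝ hK

theorem MemVh.hasFlux (hu : P.MemVh k u) : P.HasFlux u := hu.isBrokenPoly.hasFlux

theorem MemSum.memH1Sub (hu : P.MemSum k u) : P.MemH1Sub u := by
  obtain ⟨v, w, hv, hw, rfl⟩ := hu
  simpa using hv.memH1Sub.smul_add hw.memH1Sub 1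

theorem MemSum.hasFlux (hu : P.MemSum k u) : P.HasFlux u := by
  obtain ⟨v, w, hv, hw, rfl⟩ := hu
  simpa using hv.hasFlux.smul_add hw.hasFlux 1

end InterfaceProblem

/-! ### The bilinear forms -/

theorem sq_le_mul_of_quadratic_nonneg {A B D : ℝ}
    (h : ∀ t : ℝ, 0 ≤ A * t ^ 2 + 2 * B * t + D) : B ^ 2 ≤ A * D := by
  have := discrim_le_zero (a := A) (b := 2 * B) (c := D) fun t => by
    have := h t
    nlinarith
  rw [discrim] at this
  linarith

theorem integrable_mul_of_memLp {X : Type*} [MeasurableSpace X] {μ : Measure X} {f g : X → ℝ}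
    (hf : MemLp f 2 μ) (hg : MemLp g 2 μ) : Integrable (fun x => f x * g x) μ :=
  hf.integrable_mul hg

theorem sq_integral_mul_le {X : Type*} [MeasurableSpace X] {μ : Measure X} {f g : X → ℝ}
    (hf : MemLp f 2 μ) (hg : MemLp g 2 μ) :
    (∫ x, f x * g x ∂μ) ^ 2 ≤ (∫ x, f x ^ 2 ∂μ) * ∫ x, g x ^ 2 ∂μ := by
  refine sq_le_mul_of_quadratic_nonneg fun t => ?_
  have i1 : Integrable (fun x => t ^ 2 * f x ^ 2) μ := hf.integrable_sq.const_mul _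
  have i2 : Integrable (fun x => 2 * t * (f x * g x)) μ := (integrable_mul_of_memLp hf hg).const_mul _
  have e : (∫ x, f x ^ 2 ∂μ) * t ^ 2 + 2 * (∫ x, f x * g x ∂μ) * t + ∫ x, g x ^ 2 ∂μ =
      ∫ x, (t ^ 2 * f x ^ 2 + 2 * t * (f x * g x)) + g x ^ 2 ∂μ := by
    have i3 : Integrable (fun x => t ^ 2 * f x ^ 2 + 2 * t * (f x * g x)) μ := i1.add i2
    rw [integral_add i3 hg.integrable_sq, integral_add i1 i2, integral_const_mul,
      integral_const_mul]
    ring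
  rw [e]
  refine integral_nonneg fun x => ?_
  change 0 ≤ t ^ 2 * f x ^ 2 + 2 * t * (f x * g x) + g x ^ 2
  nlinarith [sq_nonneg (t * f x + g x)]

namespace InterfaceProblem

variable {n : ℕ} {P : InterfaceProblem n} {T : Finset (Sp (n + 1))} {i : Fin 2} {k : ℕ}
  {u v w : Sp (n + 1) → ℝ}

variable (P) in
theorem aT_comm (T : Finset (Sp (n + 1))) (u v : Sp (n + 1) → ℝ) : P.aT T u v = P.aT T v u := by
  simp only [aT, real_inner_comm]

variable (P) in
theorem a_comm (u v : Sp (n + 1) → ℝ) : P.a u v = P.a v u :=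
  Finset.sum_congr rfl fun T _ => P.aT_comm T u v

variable (P) in
theorem aT_self (T : Finset (Sp (n + 1))) (u : Sp (n + 1) → ℝ) :
    P.aT T u u = ∑ i, P.alpha i * ∫ x in P.part T i, ‖P.grad u x‖ ^ 2 := by
  simp only [aT, real_inner_self_eq_norm_sq]

variable (P) in
theorem aT_nonneg (T : Finset (Sp (n + 1))) (u : Sp (n + 1) → ℝ) : 0 ≤ P.aT T u u := by
  rw [aT_self]
  exact Finset.sum_nonneg fun i _ => mul_nonneg (P.alpha_pos i).le
    (integral_nonneg fun _ => sq_nonneg _)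

variable (P) in
theorem a_nonneg (u : Sp (n + 1) → ℝ) : 0 ≤ P.a u u :=
  Finset.sum_nonneg fun T _ => P.aT_nonneg T u

theorem aT_congr_left (h : ∀ i, ∀ᵐ x ∂volume.restrict (P.part T i), P.grad u x = P.grad v x)
    (w : Sp (n + 1) → ℝ) : P.aT T u w = P.aT T v w := by
  refine Finset.sum_congr rfl fun i _ => ?_
  rw [integral_congr_ae]
  filter_upwards [h i] with x hx
  rw [hx]

theorem IsBroken.memLp_part (hu : P.IsBroken u) (hT : T ∈ P.elements) (i : Fin 2) :
    MemLp (P.grad u) 2 (volume.restrict (P.part T i)) :=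
  hu.memLp_grad.mono_measure (Measure.restrict_mono (P.part_subset_dom hT i) le_rfl)

theorem integrable_inner_of_memLp {X : Type*} [MeasurableSpace X] {μ : Measure X}
    {F : Type*} [NormedAddCommGroup F] [InnerProductSpace ℝ F] {f g : X → F} (hf : MemLp f 2 μ)
    (hg : MemLp g 2 μ) : Integrable (fun x => (inner ℝ (f x) (g x) : ℝ)) μ := by
  refine (hf.norm.integrable_mul hg.norm).mono' (hf.1.inner hg.1) (ae_of_all _ fun x => ?_)
  exact norm_inner_le_norm _ _

theorem IsBroken.aT_smul_add (hu : P.IsBroken u) (hv : P.IsBroken v) (hw : P.IsBroken w)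
    (hT : T ∈ P.elements) (r : ℝ) : P.aT T (r • u + v) w = r * P.aT T u w + P.aT T v w := by
  simp only [aT, Finset.mul_sum, ← Finset.sum_add_distrib]
  refine Finset.sum_congr rfl fun i _ => ?_
  have i1 := integrable_inner_of_memLp (hu.memLp_part hT i) (hw.memLp_part hT i)
  have i2 := integrable_inner_of_memLp (hv.memLp_part hT i) (hw.memLp_part hT i)
  have e : ∫ x in P.part T i, inner ℝ (P.grad (r • u + v) x) (P.grad w x) =
      r * (∫ x in P.part T i, inner ℝ (P.grad u x) (P.grad w x)) +
        ∫ x in P.part T i, inner ℝ (P.grad v x) (P.grad w x) := by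
    rw [← integral_const_mul, ← integral_add (i1.const_mul r) i2]
    refine integral_congr_ae ?_
    filter_upwards [P.ae_part_of_dom (hu.grad_smul_add hv r) hT i] with x hx
    rw [hx, inner_add_left, real_inner_smul_left]
  rw [e]
  ring

theorem IsBroken.a_smul_add (hu : P.IsBroken u) (hv : P.IsBroken v) (hw : P.IsBroken w) (r : ℝ) :
    P.a (r • u + v) w = r * P.a u w + P.a v w := by
  simp only [a, Finset.mul_sum, ← Finset.sum_add_distrib]
  exact Finset.sum_congr rfl fun T hT => hu.aT_smul_add hv hw hT r

theorem IsBroken.a_smul_add_self (hu : P.IsBroken u) (hv : P.IsBroken v) (r : ℝ) :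
    P.a (r • u + v) (r • u + v) = r ^ 2 * P.a u u + 2 * r * P.a u v + P.a v v := by
  rw [hu.a_smul_add hv (hu.smul_add hv r), P.a_comm u, P.a_comm v, hu.a_smul_add hv hu,
    hu.a_smul_add hv hv, P.a_comm v u]
  ring

theorem IsBroken.sq_a_le (hu : P.IsBroken u) (hv : P.IsBroken v) :
    P.a u v ^ 2 ≤ P.a u u * P.a v v :=
  sq_le_mul_of_quadratic_nonneg fun t => by
    have := P.a_nonneg (t • u + v)
    rw [hu.a_smul_add_self hv] at this
    linarith

/-! ### Averages on the interface -/

variable (P) in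
/-- The weighted average of `β ∇u` on the interface. -/
def avg (β : Fin 2 → ℝ) (u : Sp (n + 1) → ℝ) (x : Sp (n + 1)) : Sp (n + 1) :=
  ∑ T ∈ P.elements, (openElt T).indicator (P.avgGrad β T u) x

theorem avg_eq (β : Fin 2 → ℝ) (u : Sp (n + 1) → ℝ) (hT : T ∈ P.elements) {x : Sp (n + 1)}
    (hx : x ∈ openElt T) : P.avg β u x = P.avgGrad β T u x := by
  rw [avg, Finset.sum_eq_single T, indicator_of_mem hx]
  · intro T' hT' hne
    exact indicator_of_notMem (fun h => (P.disjoint_openElt hT' hT hne).ne_of_mem h hx rfl) _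
  · exact fun h => absurd hT h

/-- Integrals over the interface are sums of integrals over the elements. -/
theorem sum_setIntegral_openElt {f : Sp (n + 1) → ℝ} (hf : Integrable f P.surf) :
    ∑ T ∈ P.elements, ∫ x in openElt T, f x ∂P.surf = ∫ x, f x ∂P.surf := by
  rw [← integral_biUnion_finset _ (fun T _ => (isOpen_openElt T).measurableSet)
    (fun T hT T' hT' hne => P.disjoint_openElt hT hT' hne) fun T _ => hf.integrableOn]
  rw [Measure.restrict_eq_self_of_ae_mem]
  filter_upwards [P.surf_ae_mem_openElt] with x hx
  simpa using hx

theorem HasFlux.memLp_avgGrad (hu : P.HasFlux u) (β : Fin 2 → ℝ) (T : Finset (Sp (n + 1))) :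
    MemLp (P.avgGrad β T u) 2 P.surf :=
  memLp_finsetSum _ fun i _ => (hu.memLp_trace i).const_smul (P.kappa T i * β i)

theorem HasFlux.memLp_avg (hu : P.HasFlux u) (β : Fin 2 → ℝ) : MemLp (P.avg β u) 2 P.surf :=
  memLp_finsetSum _ fun T _ => (hu.memLp_avgGrad β T).indicator (isOpen_openElt T).measurableSet

theorem HasFlux.memLp_inner_normal (hu : P.HasFlux u) (β : Fin 2 → ℝ) :
    MemLp (fun x => -inner ℝ (P.avg β u x) (P.normal x)) 2 P.surf := by
  refine (hu.memLp_avg β).of_le ((hu.memLp_avg β).1.inner P.aestronglyMeasurable_normal).neg ?_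
  filter_upwards [P.ae_norm_normal] with x hx
  rw [norm_neg]
  refine (norm_inner_le_norm _ _).trans ?_
  rw [hx, mul_one]

theorem HasFlux.sum_avgGrad (hu : P.HasFlux u) (β : Fin 2 → ℝ) :
    ∑ T ∈ P.elements, ∫ x in openElt T, ‖P.avgGrad β T u x‖ ^ 2 ∂P.surf =
      ∫ x, ‖P.avg β u x‖ ^ 2 ∂P.surf := by
  rw [← sum_setIntegral_openElt ((memLp_two_iff_integrable_sq_norm (hu.memLp_avg β).1).1
    (hu.memLp_avg β))]
  refine Finset.sum_congr rfl fun T hT => setIntegral_congr_fun (isOpen_openElt T).measurableSet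
    fun x hx => ?_
  change _ = ‖P.avg β u x‖ ^ 2
  rw [avg_eq β u hT hx]

theorem HasFlux.Nc_eq (hu : P.HasFlux u) (hv : MemLp (P.jump v) 2 P.surf) :
    P.Nc u v = ∫ x, -inner ℝ (P.avg P.alpha u x) (P.normal x) * P.jump v x ∂P.surf := by
  rw [← sum_setIntegral_openElt (integrable_mul_of_memLp (hu.memLp_inner_normal P.alpha) hv)]
  refine Finset.sum_congr rfl fun T hT => setIntegral_congr_fun (isOpen_openElt T).measurableSet
    fun x hx => ?_
  rw [avg_eq P.alpha u hT hx]

theorem HasFlux.avgGrad_smul_add (hu : P.HasFlux u) (hv : P.HasFlux v) (β : Fin 2 → ℝ) (r : ℝ)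
    (T : Finset (Sp (n + 1))) : ∀ᵐ x ∂P.surf,
      P.avgGrad β T (r • u + v) x = r • P.avgGrad β T u x + P.avgGrad β T v x := by
  filter_upwards [hu.trace_smul_add hv r 0, hu.trace_smul_add hv r 1] with x h0 h1
  simp only [avgGrad, Fin.sum_univ_two, h0, h1]
  module

theorem HasFlux.NcT_smul_add (hu : P.HasFlux u) (hv : P.HasFlux v)
    (hw : MemLp (P.jump w) 2 (P.surf.restrict (openElt T))) (r : ℝ) :
    P.NcT T (r • u + v) w = r * P.NcT T u w + P.NcT T v w := by
  have hm : ∀ {z}, P.HasFlux z → MemLp (fun x => -inner ℝ (P.avgGrad P.alpha T z x) (P.normal x)) 2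
      (P.surf.restrict (openElt T)) := fun {z} hz => by
    have h1 := hz.memLp_avgGrad P.alpha T
    refine MemLp.restrict _ (h1.of_le (h1.1.inner P.aestronglyMeasurable_normal).neg ?_)
    filter_upwards [P.ae_norm_normal] with x hx
    rw [norm_neg]
    refine (norm_inner_le_norm _ _).trans ?_
    rw [hx, mul_one]
  simp only [NcT]
  rw [← integral_const_mul, ← integral_add ((integrable_mul_of_memLp (hm hu) hw).const_mul r)
    (integrable_mul_of_memLp (hm hv) hw)]
  refine integral_congr_ae (ae_restrict_of_ae ?_)
  filter_upwards [hu.avgGrad_smul_add hv P.alpha r T] with x hx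
  rw [hx, inner_add_left, real_inner_smul_left]
  ring

theorem HasFlux.Nc_smul_add (hu : P.HasFlux u) (hv : P.HasFlux v)
    (hw : MemLp (P.jump w) 2 P.surf) (r : ℝ) :
    P.Nc (r • u + v) w = r * P.Nc u w + P.Nc v w := by
  simp only [Nc, Finset.mul_sum, ← Finset.sum_add_distrib]
  exact Finset.sum_congr rfl fun T _ => hu.NcT_smul_add hv (hw.restrict _) r

theorem HasFlux.Nc_smul_add_right (hw : P.HasFlux w) (hu : P.MemH1Sub u) (hv : P.MemH1Sub v)
    (r : ℝ) : P.Nc w (r • u + v) = r * P.Nc w u + P.Nc w v := by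
  rw [hw.Nc_eq hu.memLp_jump, hw.Nc_eq hv.memLp_jump, hw.Nc_eq (hu.smul_add hv r).memLp_jump,
    ← integral_const_mul, ← integral_add
      ((integrable_mul_of_memLp (hw.memLp_inner_normal P.alpha) hu.memLp_jump).const_mul r)
      (integrable_mul_of_memLp (hw.memLp_inner_normal P.alpha) hv.memLp_jump)]
  refine integral_congr_ae ?_
  filter_upwards [hu.jump_smul_add hv r] with x hx
  rw [hx]
  ring

theorem HasFlux.sq_Nc_le (hu : P.HasFlux u) (hv : MemLp (P.jump v) 2 P.surf) :
    P.Nc u v ^ 2 ≤ (∫ x, ‖P.avg P.alpha u x‖ ^ 2 ∂P.surf) * ∫ x, P.jump v x ^ 2 ∂P.surf := by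
  rw [hu.Nc_eq hv]
  refine (sq_integral_mul_le (hu.memLp_inner_normal P.alpha) hv).trans ?_
  refine mul_le_mul_of_nonneg_right ?_ (integral_nonneg fun _ => sq_nonneg _)
  refine integral_mono_ae (hu.memLp_inner_normal P.alpha).integrable_sq
    ((memLp_two_iff_integrable_sq_norm (hu.memLp_avg _).1).1 (hu.memLp_avg _)) ?_
  filter_upwards [P.ae_norm_normal] with x hx
  rw [neg_sq, ← sq_abs]
  refine pow_le_pow_left₀ (abs_nonneg _) ?_ 2
  refine (abs_real_inner_le_norm _ _).trans ?_
  rw [hx, mul_one]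

theorem Ns1_comm (u v : Sp (n + 1) → ℝ) : P.Ns1 u v = P.Ns1 v u := by
  simp only [Ns1, mul_comm]

theorem Ns1_self (u : Sp (n + 1) → ℝ) : P.Ns1 u u = P.h⁻¹ * ∫ x, P.jump u x ^ 2 ∂P.surf := by
  simp only [Ns1, sq]

theorem Ns1_nonneg (u : Sp (n + 1) → ℝ) : 0 ≤ P.Ns1 u u := by
  rw [Ns1_self]
  exact mul_nonneg (inv_nonneg.2 P.h_pos.le) (integral_nonneg fun _ => sq_nonneg _)

theorem MemH1Sub.Ns1_smul_add (hu : P.MemH1Sub u) (hv : P.MemH1Sub v) (hw : P.MemH1Sub w)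
    (r : ℝ) : P.Ns1 (r • u + v) w = r * P.Ns1 u w + P.Ns1 v w := by
  have e : ∫ x, P.jump (r • u + v) x * P.jump w x ∂P.surf =
      r * (∫ x, P.jump u x * P.jump w x ∂P.surf) + ∫ x, P.jump v x * P.jump w x ∂P.surf := by
    rw [← integral_const_mul, ← integral_add
      ((integrable_mul_of_memLp hu.memLp_jump hw.memLp_jump).const_mul r)
      (integrable_mul_of_memLp hv.memLp_jump hw.memLp_jump)]
    refine integral_congr_ae ?_
    filter_upwards [hu.jump_smul_add hv r] with x hx
    rw [hx]
    ring
  rw [Ns1, e, Ns1, Ns1]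
  ring

theorem MemH1Sub.sq_Ns1_le (hu : P.MemH1Sub u) (hv : P.MemH1Sub v) :
    P.Ns1 u v ^ 2 ≤ P.Ns1 u u * P.Ns1 v v := by
  rw [Ns1_self, Ns1_self, Ns1, mul_pow]
  have := mul_le_mul_of_nonneg_left (sq_integral_mul_le hu.memLp_jump hv.memLp_jump)
    (sq_nonneg P.h⁻¹)
  refine this.trans_eq ?_
  ring

/-- The weighted averages of broken polynomials are controlled by the energy, if the weighting is
stable. -/
theorem StableWeighting.avg_le {c : ℝ} (hs : P.StableWeighting k c) (hv : P.IsBrokenPoly k v)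
    {β : Fin 2 → ℝ} {M : ℝ} (hβ : ∀ i, β i ^ 2 ≤ M ^ 2 * P.alpha i ^ 2) :
    P.h * ∫ x, ‖P.avg β v x‖ ^ 2 ∂P.surf ≤ 2 * c * M ^ 2 * P.a v v := by
  obtain ⟨p, hp⟩ := hv.exists_poly
  rw [← hv.hasFlux.sum_avgGrad β, a, Finset.mul_sum, Finset.mul_sum]
  refine Finset.sum_le_sum fun T hT => ?_
  set I : Fin 2 → ℝ := fun i => ∫ x in openElt T, ‖gradient (polyFun (p T i)) x‖ ^ 2 ∂P.surf with hI
  have iI : ∀ i, IntegrableOn (fun x => ‖gradient (polyFun (p T i)) x‖ ^ 2) (openElt T) P.surf := by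
    intro i
    have h1 := memLp_indicator_gradient T (p T i) (isOpen_openElt T).measurableSet subset_rfl
      (μ := P.surf)
    rw [memLp_indicator_iff_restrict (isOpen_openElt T).measurableSet] at h1
    exact (memLp_two_iff_integrable_sq_norm h1.1).1 h1
  have e1 : ∫ x in openElt T, ‖P.avgGrad β T v x‖ ^ 2 ∂P.surf ≤
      2 * ((P.kappa T 0 * β 0) ^ 2 * I 0 + (P.kappa T 1 * β 1) ^ 2 * I 1) := by
    rw [hI]
    simp only
    rw [← integral_const_mul, ← integral_const_mul,
      ← integral_add ((iI 0).const_mul _) ((iI 1).const_mul _), ← integral_const_mul]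
    refine integral_mono_of_nonneg (ae_of_all _ fun _ => sq_nonneg _)
      ((((iI 0).const_mul _).add ((iI 1).const_mul _)).const_mul 2) ?_
    filter_upwards [ae_restrict_of_ae P.surf_ae_mem_Gam,
      ae_restrict_mem (isOpen_openElt T).measurableSet] with x hx hxT
    have t := fun i => ((hp T hT i).2.2.2.2 x hx hxT).trace_eq
    simp only [avgGrad, Fin.sum_univ_two, t]
    refine (pow_le_pow_left₀ (norm_nonneg _) (norm_add_le _ _) 2).trans ?_
    rw [norm_smul, norm_smul]
    refine add_sq_le.trans (le_of_eq ?_)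
    rw [mul_pow, mul_pow, Real.norm_eq_abs, Real.norm_eq_abs, sq_abs, sq_abs]
  have e2 : ∀ i, P.h * ((P.kappa T i * β i) ^ 2 * I i) ≤
      M ^ 2 * (c * (P.alpha i * ∫ x in P.part T i, ‖P.grad v x‖ ^ 2)) := by
    intro i
    have h1 := hs T hT i (p T i) (hp T hT i).1
    have h2 : ∫ x in P.part T i, ‖P.grad v x‖ ^ 2 =
        ∫ x in P.part T i, ‖gradient (polyFun (p T i)) x‖ ^ 2 := by
      refine integral_congr_ae ?_
      filter_upwards [(hp T hT i).2.2.2.1] with x hx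
      rw [hx]
    rw [h2]
    have I0 : 0 ≤ I i := integral_nonneg fun _ => sq_nonneg _
    calc P.h * ((P.kappa T i * β i) ^ 2 * I i)
        = (P.h * P.kappa T i ^ 2 * I i) * β i ^ 2 := by ring
      _ ≤ (P.h * P.kappa T i ^ 2 * I i) * (M ^ 2 * P.alpha i ^ 2) :=
        mul_le_mul_of_nonneg_left (hβ i)
          (mul_nonneg (mul_nonneg P.h_pos.le (sq_nonneg _)) I0)
      _ = M ^ 2 * (P.alpha i ^ 2 * P.kappa T i ^ 2 * P.h * I i) := by ring
      _ ≤ M ^ 2 * (c * P.alpha i * ∫ x in P.part T i, ‖gradient (polyFun (p T i)) x‖ ^ 2) :=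
        mul_le_mul_of_nonneg_left h1 (sq_nonneg _)
      _ = _ := by ring
  rw [aT_self, Fin.sum_univ_two]
  have := mul_le_mul_of_nonneg_left e1 P.h_pos.le
  have e20 := e2 0
  have e21 := e2 1
  linarith

end InterfaceProblem

/-! ### The lifting -/

section IsPolyOn

variable {m k : ℕ} {S : Set (Sp m)} {u v : Sp m → ℝ}

theorem IsPolyOn.congr (hu : IsPolyOn k S u) (h : ∀ x ∈ S, v x = u x) : IsPolyOn k S v := by
  obtain ⟨p, hpk, hp⟩ := hu
  exact ⟨p, hpk, fun x hx => (h x hx).trans (hp x hx)⟩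

theorem isPolyOn_const (c : ℝ) : IsPolyOn k S fun _ => c :=
  ⟨MvPolynomial.C c, by simp, fun x _ => by simp⟩

theorem IsPolyOn.add (hu : IsPolyOn k S u) (hv : IsPolyOn k S v) :
    IsPolyOn k S fun x => u x + v x := by
  obtain ⟨p, hpk, hp⟩ := hu
  obtain ⟨q, hqk, hq⟩ := hv
  exact ⟨p + q, (MvPolynomial.totalDegree_add p q).trans (max_le hpk hqk),
    fun x hx => by simp only [hp x hx, hq x hx, map_add]⟩

theorem IsPolyOn.const_mul (hu : IsPolyOn k S u) (r : ℝ) : IsPolyOn k S fun x => r * u x := by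
  obtain ⟨p, hpk, hp⟩ := hu
  exact ⟨r • p, (MvPolynomial.totalDegree_smul_le r p).trans hpk,
    fun x hx => by simp only [hp x hx, MvPolynomial.smul_eval]⟩

/-- A polynomial with vanishing gradient on a nonempty open set is constant. -/
theorem exists_const_of_gradient_eq_zero {p : MvPolynomial (Fin m) ℝ} (hS : IsOpen S)
    (hne : S.Nonempty) (h : ∀ x ∈ S, gradient (polyFun p) x = 0) : ∃ c, ∀ x, polyFun p x = c := by
  obtain ⟨x, hx⟩ := hne
  obtain ⟨ρ, hρ, hb⟩ := Metric.isOpen_iff.1 hS x hx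
  refine ⟨polyFun p x, fun y => ?_⟩
  have hd : ∀ y ∈ Metric.ball x ρ, fderiv ℝ (polyFun p) y = 0 := fun y hy => by
    have := h y (hb hy)
    rwa [gradient, LinearIsometryEquiv.map_eq_zero_iff] at this
  have he : polyFun p =ᶠ[𝓝 x] fun _ => polyFun p x := by
    filter_upwards [Metric.ball_mem_nhds x hρ] with y hy
    exact Metric.isOpen_ball.is_const_of_fderiv_eq_zero (convex_ball x ρ).isPreconnected
      (contDiff_polyFun p (k := 1)).differentiable_one.differentiableOn hd hy
      (Metric.mem_ball_self hρ)
  exact congrFun ((analyticOnNhd_polyFun p).eq_of_eventuallyEq analyticOnNhd_const he) y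

end IsPolyOn

namespace InterfaceProblem

variable {n : ℕ} {P : InterfaceProblem n} {T : Finset (Sp (n + 1))} {i : Fin 2} {k : ℕ}
  {u v w : Sp (n + 1) → ℝ}

theorem integrableOn_part_of_isPolyOn (h : IsPolyOn k (P.part T i) u) :
    IntegrableOn u (P.part T i) := by
  obtain ⟨p, -, hp⟩ := h
  have h1 : IntegrableOn (polyFun p) (P.part T i) :=
    ((contDiff_polyFun p (k := 0)).continuous.continuousOn.integrableOn_compact
      (T.finite_toSet.isCompact_convexHull (𝕜 := ℝ))).mono_set
      ((P.part_subset_openElt T i).trans interior_subset)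
  exact h1.congr_fun (fun x hx => (hp x hx).symm) (P.isOpen_part T i).measurableSet

theorem memP0_zero : P.MemP0 k T 0 :=
  ⟨fun i => ⟨isPolyOn_const 0, by simp⟩, fun _ _ => rfl⟩

theorem MemP0.smul_add (hu : P.MemP0 k T u) (hv : P.MemP0 k T v) (r : ℝ) :
    P.MemP0 k T (r • u + v) := by
  refine ⟨fun i => ⟨((hu.1 i).1.const_mul r).add (hv.1 i).1, ?_⟩, fun x hx => ?_⟩
  · simp only [Pi.add_apply, Pi.smul_apply, smul_eq_mul]
    rw [integral_add ((integrableOn_part_of_isPolyOn (hu.1 i).1).const_mul r)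
      (integrableOn_part_of_isPolyOn (hv.1 i).1), integral_const_mul, (hu.1 i).2, (hv.1 i).2]
    simp
  · simp [hu.2 x hx, hv.2 x hx]

theorem MemP0.eq_zero_of_notMem (hu : P.MemP0 k T u) {T' : Finset (Sp (n + 1))}
    (hT : T ∈ P.elements) (hT' : T' ∈ P.elements) (hne : T' ≠ T) {x : Sp (n + 1)}
    (hx : x ∈ P.part T' i) : u x = 0 :=
  hu.2 x fun _ hxj => (P.disjoint_part hT' hT (Or.inl hne)).ne_of_mem hx hxj rfl

theorem MemP0.isBrokenPoly (hu : P.MemP0 k T u) (hT : T ∈ P.elements) : P.IsBrokenPoly k u := by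
  intro T' hT' i
  by_cases hne : T' = T
  · rw [hne]
    exact (hu.1 i).1
  · exact (isPolyOn_const 0).congr fun x hx => hu.eq_zero_of_notMem hT hT' hne hx

theorem aT_zero (hT : T ∈ P.elements) (hw : P.IsBroken w) : P.aT T 0 w = 0 := by
  have h0 : P.IsBroken 0 := (memP0_zero (k := 0) (T := T)).isBrokenPoly hT |>.hasFlux.toIsBroken
  have := h0.aT_smul_add h0 hw hT 1
  rw [smul_zero, add_zero] at this
  linarith

/-- A broken polynomial of vanishing energy is constant on the sub-elements, and the constants are
zero because the means are. -/
theorem MemP0.eq_zero (hu : P.MemP0 k T u) (hT : T ∈ P.elements) (h : P.aT T u u = 0) : u = 0 := by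
  obtain ⟨p, hp⟩ := (hu.isBrokenPoly hT).exists_poly
  have hpart : ∀ i, ∀ x ∈ P.part T i, u x = 0 := by
    intro i x hx
    rw [aT_self, Finset.sum_eq_zero_iff_of_nonneg fun i _ => mul_nonneg (P.alpha_pos i).le
      (integral_nonneg fun _ => sq_nonneg _)] at h
    have h1 := (mul_eq_zero.1 (h i (Finset.mem_univ i))).resolve_left (P.alpha_pos i).ne'
    have hl := (hu.isBrokenPoly hT).hasFlux.toIsBroken.memLp_part hT i
    rw [integral_eq_zero_iff_of_nonneg (fun _ => sq_nonneg _)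
      ((memLp_two_iff_integrable_sq_norm hl.1).1 hl)] at h1
    have h2 : ∀ᵐ y ∂volume.restrict (P.part T i), gradient (polyFun (p T i)) y = 0 := by
      filter_upwards [h1, (hp T hT i).2.2.2.1] with y hy hy'
      rw [← hy']
      simpa using hy
    have h3 : EqOn (gradient (polyFun (p T i))) (fun _ => 0) (P.part T i) :=
      Measure.eqOn_open_of_ae_eq h2 (P.isOpen_part T i)
        (continuous_gradient (contDiff_polyFun _)).continuousOn continuousOn_const
    obtain ⟨c, hc⟩ := exists_const_of_gradient_eq_zero (P.isOpen_part T i) ⟨x, hx⟩ h3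
    have h4 : ∀ y ∈ P.part T i, u y = c := fun y hy => by rw [(hp T hT i).2.1 y hy, hc]
    have h5 := (hu.1 i).2
    rw [setIntegral_congr_fun (P.isOpen_part T i).measurableSet h4, setIntegral_const,
      smul_eq_mul] at h5
    rw [h4 x hx]
    refine (mul_eq_zero.1 h5).resolve_left (ENNReal.toReal_pos ?_ ?_).ne'
    · exact ((P.isOpen_part T i).measure_pos volume ⟨x, hx⟩).ne'
    · exact ((measure_mono (P.part_subset_sub T i)).trans_lt (P.volume_sub_lt_top i)).ne
  funext x
  by_cases hx : ∃ i, x ∈ P.part T i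
  · obtain ⟨i, hi⟩ := hx
    exact hpart i x hi
  · exact hu.2 x (not_exists.1 hx)

variable (P) in
/-- The space of broken polynomials of degree at most `k` on `T` with mean zero on the
sub-elements. -/
def spaceP0 (k : ℕ) (T : Finset (Sp (n + 1))) : Submodule ℝ (Sp (n + 1) → ℝ) where
  carrier := {v | P.MemP0 k T v}
  zero_mem' := memP0_zero
  add_mem' {u v} hu hv := by simpa using MemP0.smul_add hu hv 1
  smul_mem' r u hu := by simpa using MemP0.smul_add hu memP0_zero r

instance : FiniteDimensional ℝ (P.spaceP0 k T) := by
  let Φ : (Fin 2 → MvPolynomial.restrictTotalDegree (Fin (n + 1)) ℝ k) →ₗ[ℝ] (Sp (n + 1) → ℝ) :=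
    { toFun := fun q x => ∑ i, (P.part T i).indicator (polyFun (q i).1) x
      map_add' := fun q q' => by
        funext x
        rw [Pi.add_apply, ← Finset.sum_add_distrib]
        refine Finset.sum_congr rfl fun i _ => ?_
        by_cases hx : x ∈ P.part T i <;> simp [hx, polyFun]
      map_smul' := fun r q => by
        funext x
        rw [Pi.smul_apply, smul_eq_mul, Finset.mul_sum]
        refine Finset.sum_congr rfl fun i _ => ?_
        by_cases hx : x ∈ P.part T i <;> simp [hx, polyFun, MvPolynomial.smul_eval] }
  refine Submodule.finiteDimensional_of_le (S₂ := LinearMap.range Φ) ?_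
  intro v (hv : P.MemP0 k T v)
  choose q hq using fun i => (hv.1 i).1
  refine ⟨fun i => ⟨q i, (MvPolynomial.mem_restrictTotalDegree _ _ _).2 (hq i).1⟩, ?_⟩
  funext x
  change ∑ i, (P.part T i).indicator (polyFun (q i)) x = v x
  by_cases hx : ∃ i, x ∈ P.part T i
  · obtain ⟨i, hi⟩ := hx
    rw [Finset.sum_eq_single i, indicator_of_mem hi, (hq i).2 x hi, polyFun]
    · intro j _ hj
      exact indicator_of_notMem (fun h => (P.disjoint_sub_of_ne hj).ne_of_mem h.2 hi.2 rfl) _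
    · simp
  · rw [hv.2 x (not_exists.1 hx)]
    exact Finset.sum_eq_zero fun i _ => indicator_of_notMem (not_exists.1 hx i) _

theorem isLinearMap_of_smul_add {V : Submodule ℝ (Sp (n + 1) → ℝ)} {f : (Sp (n + 1) → ℝ) → ℝ}
    (h : ∀ u ∈ V, ∀ v ∈ V, ∀ r : ℝ, f (r • u + v) = r * f u + f v) :
    IsLinearMap ℝ fun v : V => f v := by
  have h0 : f 0 = 0 := by
    have := h 0 V.zero_mem 0 V.zero_mem 1
    rw [smul_zero, add_zero] at this
    linarith
  refine ⟨fun u v => ?_, fun r u => ?_⟩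
  · simpa using h u u.2 v v.2 1
  · simpa [h0] using h u u.2 0 V.zero_mem r

/-- The local lifting is well-defined: the form `a_T` is definite on the finite-dimensional space
of broken polynomials with mean zero, so that it represents all linear functionals. -/
theorem existsUnique_isLocalLift (hT : T ∈ P.elements)
    (hj : MemLp (P.jump u) 2 (P.surf.restrict (openElt T))) : ∃! w, P.IsLocalLift k T u w := by
  have hb : ∀ v ∈ P.spaceP0 k T, P.HasFlux v := fun v hv =>
    MemP0.isBrokenPoly (show P.MemP0 k T v from hv) hT |>.hasFlux
  have lin : ∀ w ∈ P.spaceP0 k T, IsLinearMap ℝ fun v : P.spaceP0 k T => P.aT T v w :=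
    fun w hw => isLinearMap_of_smul_add (f := fun v => P.aT T v w) fun u hu v hv r =>
      (hb u hu).toIsBroken.aT_smul_add (hb v hv).toIsBroken (hb w hw).toIsBroken hT r
  have lin' : ∀ w ∈ P.spaceP0 k T, IsLinearMap ℝ fun v : P.spaceP0 k T => P.aT T w v :=
    fun w hw => by
      simp only [P.aT_comm T w]
      exact lin w hw
  let B : P.spaceP0 k T →ₗ[ℝ] Module.Dual ℝ (P.spaceP0 k T) :=
    LinearMap.mk₂ ℝ (fun v w => P.aT T v w) (fun u v w => (lin w w.2).map_add u v)
      (fun r u w => (lin w w.2).map_smul r u) (fun w u v => (lin' w w.2).map_add u v)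
      (fun r w u => (lin' w w.2).map_smul r u)
  have hB : Function.Injective B := by
    rw [← LinearMap.ker_eq_bot, LinearMap.ker_eq_bot']
    intro v hv
    have h1 : P.aT T v v = 0 := LinearMap.congr_fun hv v
    exact Subtype.ext (MemP0.eq_zero v.2 hT h1)
  have hB' : Function.Surjective B :=
    (LinearMap.injective_iff_surjective_of_finrank_eq_finrank
      Subspace.dual_finrank_eq.symm).1 hB
  let ℓ : Module.Dual ℝ (P.spaceP0 k T) := IsLinearMap.mk' (fun v => P.NcT T v u)
    (isLinearMap_of_smul_add (f := fun v => P.NcT T v u) fun v hv w hw r =>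
      (hb v hv).NcT_smul_add (hb w hw) hj r)
  obtain ⟨w, hw⟩ := hB' ℓ
  refine ⟨w, ⟨w.2, fun v hv => LinearMap.congr_fun hw ⟨v, hv⟩⟩, fun w' hw' => ?_⟩
  have : B ⟨w', hw'.1⟩ = B w := by
    rw [hw]
    exact LinearMap.ext fun v => hw'.2 v v.2
  exact congrArg Subtype.val (hB this)

theorem isLocalLift_localLift (hT : T ∈ P.elements) (hcut : P.IsCut T)
    (hj : MemLp (P.jump u) 2 (P.surf.restrict (openElt T))) :
    P.IsLocalLift k T u (P.localLift k T u) := by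
  have h : P.IsCut T ∧ ∃ w, P.IsLocalLift k T u w :=
    ⟨hcut, (existsUnique_isLocalLift hT hj).exists⟩
  rw [localLift, dif_pos h]
  exact h.2.choose_spec

variable (P) in
theorem memP0_localLift (k : ℕ) (T : Finset (Sp (n + 1))) (u : Sp (n + 1) → ℝ) :
    P.MemP0 k T (P.localLift k T u) := by
  rw [localLift]
  split_ifs with h
  · exact h.2.choose_spec.1
  · exact memP0_zero

theorem lift_eq_localLift (hT : T ∈ P.elements) {x : Sp (n + 1)} (hx : x ∈ P.part T i) :
    P.lift k u x = P.localLift k T u x := by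
  rw [lift, Finset.sum_apply, Finset.sum_eq_single T]
  · intro T' hT' hne
    exact (P.memP0_localLift k T' u).eq_zero_of_notMem hT' hT hne.symm hx
  · exact fun h => absurd hT h

variable (P) in
theorem isBrokenPoly_lift (k : ℕ) (u : Sp (n + 1) → ℝ) : P.IsBrokenPoly k (P.lift k u) :=
  fun T hT i => ((P.memP0_localLift k T u).1 i).1.congr fun _ hx => lift_eq_localLift hT hx

/-- Functions that differ by constants on the sub-elements have the same broken gradient. -/
theorem grad_ae_eq_of_sub_const (hu : P.IsBroken u) (hv : P.IsBroken v) (hT : T ∈ P.elements)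
    (c : Fin 2 → ℝ) (h : ∀ i, ∀ x ∈ P.part T i, v x = u x - c i) (i : Fin 2) :
    ∀ᵐ x ∂volume.restrict (P.part T i), P.grad v x = P.grad u x := by
  have h1 := hu.hasWeakGrad.mono (P.part_subset_dom hT i)
  have h2 := hv.hasWeakGrad.mono (P.part_subset_dom hT i)
  have h3 : HasWeakGrad (P.part T i) (fun _ : Sp (n + 1) => -c i) (gradient fun _ => -c i) :=
    hasWeakGrad_of_contDiff contDiff_const _
  refine h2.ae_unique (P.isOpen_part T i) ((h1.add h3).congr ?_ (ae_of_all _ fun x => ?_))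
  · filter_upwards [ae_restrict_mem (P.isOpen_part T i).measurableSet] with x hx
    rw [h i x hx, Pi.add_apply, sub_eq_add_neg]
  · have : gradient (fun _ : Sp (n + 1) => -c i) x = 0 := gradient_const x (-c i)
    rw [Pi.add_apply, this, add_zero]

/-- Subtracting its means from a broken polynomial gives a test function for the local lifting. -/
theorem exists_memP0 (hv : P.IsBrokenPoly k v) (hT : T ∈ P.elements) :
    ∃ (v₀ : Sp (n + 1) → ℝ) (c : Fin 2 → ℝ), P.MemP0 k T v₀ ∧
      ∀ i, ∀ x ∈ P.part T i, v₀ x = v x - c i := by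
  set c : Fin 2 → ℝ := fun i => ⨍ x in P.part T i, v x with hc
  have hv₀ : ∀ i, ∀ x ∈ P.part T i,
      ∑ j, (P.part T j).indicator (fun x => v x - c j) x = v x - c i := by
    intro i x hx
    rw [Finset.sum_eq_single i, indicator_of_mem hx]
    · intro j _ hj
      exact indicator_of_notMem (fun h => (P.disjoint_sub_of_ne hj).ne_of_mem h.2 hx.2 rfl) _
    · simp
  refine ⟨fun x => ∑ j, (P.part T j).indicator (fun x => v x - c j) x, c,
    ⟨fun i => ⟨?_, ?_⟩, fun x hx => ?_⟩, hv₀⟩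
  · exact ((hv T hT i).add (isPolyOn_const (-c i))).congr fun x hx => by
      rw [hv₀ i x hx, sub_eq_add_neg]
  · have hfin : volume (P.part T i) ≠ ⊤ :=
      ((measure_mono (P.part_subset_sub T i)).trans_lt (P.volume_sub_lt_top i)).ne
    rw [setIntegral_congr_fun (P.isOpen_part T i).measurableSet (hv₀ i),
      integral_sub (integrableOn_part_of_isPolyOn (hv T hT i)) (integrableOn_const hfin),
      setIntegral_const, hc]
    have := measure_smul_setAverage v hfin
    rw [this, sub_self]
  · exact Finset.sum_eq_zero fun i _ => indicator_of_notMem (hx i) _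

/-- The form `N^c_T` depends on its first argument only through the broken gradient, the traces of
which are not affected by changes on null sets. -/
theorem NcT_congr (hu : P.IsBrokenPoly k u) (hT : T ∈ P.elements)
    (h : ∀ i, ∀ᵐ x ∂volume.restrict (P.part T i), P.grad v x = P.grad u x)
    (w : Sp (n + 1) → ℝ) : P.NcT T v w = P.NcT T u w := by
  obtain ⟨p, hp⟩ := hu.exists_poly
  refine integral_congr_ae ?_
  filter_upwards [ae_restrict_of_ae P.surf_ae_mem_Gam,
    ae_restrict_mem (isOpen_openElt T).measurableSet] with x hx hxT
  have t : ∀ i, trace (P.sub i) (P.grad v) x = trace (P.sub i) (P.grad u) x := fun i => by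
    rw [((hp T hT i).2.2.2.2 x hx hxT).trace_eq]
    refine (hasTrace_grad_of_part (T := T) ?_ hx hxT).trace_eq
    filter_upwards [h i, (hp T hT i).2.2.2.1] with y hy hy'
    rw [hy, hy']
  simp only [avgGrad, t]

theorem NcT_of_not_isCut (h : ¬P.IsCut T) (u v : Sp (n + 1) → ℝ) : P.NcT T u v = 0 := by
  have h0 : P.surf.restrict (openElt T) = 0 := by
    rw [surf, Measure.restrict_restrict (isOpen_openElt T).measurableSet,
      not_nonempty_iff_eq_empty.1 h, Measure.restrict_empty]
  rw [NcT, h0, integral_zero_measure]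

/-- The local lifting may be tested with arbitrary broken polynomials, since neither side notices
the means of the test function. -/
theorem aT_lift (hu : MemLp (P.jump u) 2 P.surf) (hv : P.IsBrokenPoly k v)
    (hT : T ∈ P.elements) : P.aT T (P.lift k u) v = P.NcT T v u := by
  have hL := P.memP0_localLift k T u
  have hLb := (hL.isBrokenPoly hT).hasFlux.toIsBroken
  have e1 : P.aT T (P.lift k u) v = P.aT T (P.localLift k T u) v :=
    aT_congr_left (grad_ae_eq_of_sub_const hLb (P.isBrokenPoly_lift k u).hasFlux.toIsBroken hT 0
      fun i x hx => by rw [lift_eq_localLift hT hx, Pi.zero_apply, sub_zero]) v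
  rw [e1]
  by_cases hcut : P.IsCut T
  · obtain ⟨v₀, c, hv₀, hc⟩ := exists_memP0 hv hT
    have hg := grad_ae_eq_of_sub_const hv.hasFlux.toIsBroken
      (hv₀.isBrokenPoly hT).hasFlux.toIsBroken hT c hc
    rw [P.aT_comm, ← aT_congr_left hg, P.aT_comm, ← NcT_congr hv hT hg]
    exact (isLocalLift_localLift hT hcut (hu.restrict _)).2 v₀ hv₀
  · have : P.localLift k T u = 0 := dif_neg fun h => hcut h.1
    rw [this, aT_zero hT hv.hasFlux.toIsBroken, NcT_of_not_isCut hcut]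

/-- The lifting represents `N^c` with respect to the energy inner product. -/
theorem a_lift (hu : MemLp (P.jump u) 2 P.surf) (hv : P.IsBrokenPoly k v) :
    P.a (P.lift k u) v = P.Nc v u :=
  Finset.sum_congr rfl fun _ hT => aT_lift hu hv hT

theorem lift_eq_zero (h : ∀ᵐ x ∂P.surf, P.jump u x = 0) : P.lift k u = 0 := by
  refine Finset.sum_eq_zero fun T hT => ?_
  by_cases hcut : P.IsCut T
  · have hj : MemLp (P.jump u) 2 (P.surf.restrict (openElt T)) :=
      MemLp.restrict _ ((MemLp.zero (p := 2) (μ := P.surf)).ae_eq (h.mono fun x hx => hx.symm))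
    refine (existsUnique_isLocalLift (k := k) hT hj).unique (isLocalLift_localLift hT hcut hj)
      ⟨memP0_zero, fun v hv => ?_⟩
    rw [aT_zero hT (hv.isBrokenPoly hT).hasFlux.toIsBroken]
    symm
    refine integral_eq_zero_of_ae (ae_restrict_of_ae ?_)
    filter_upwards [h] with x hx
    simp [hx]
  · exact dif_neg fun h => hcut h.1

/-- Testing the lifting with itself gives `a(𝓛(u), 𝓛(u)) = N^c(𝓛(u), u)`. By the Cauchy–Schwarz
inequality and the stable weighting, the right-hand side is at most
`(2 c a(𝓛(u), 𝓛(u)))^{1/2} (h⁻¹ ‖⟦u⟧‖²)^{1/2}`. -/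
theorem a_lift_self_le {c : ℝ} (hc : 0 < c) (hs : P.StableWeighting k c)
    (hu : MemLp (P.jump u) 2 P.surf) :
    P.a (P.lift k u) (P.lift k u) ≤ 2 * c * P.Ns1 u u := by
  have hL := P.isBrokenPoly_lift k u
  set A := P.a (P.lift k u) (P.lift k u) with hA
  have hA0 : 0 ≤ A := P.a_nonneg _
  have h1 : A = P.Nc (P.lift k u) u := a_lift hu hL
  have h2 := hL.hasFlux.sq_Nc_le hu
  rw [← h1] at h2
  have h3 := hs.avg_le hL (β := P.alpha) (M := 1) fun i => by simp
  rw [← hA] at h3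
  rw [Ns1_self]
  set J := ∫ x, P.jump u x ^ 2 ∂P.surf
  set Q := ∫ x, ‖P.avg P.alpha (P.lift k u) x‖ ^ 2 ∂P.surf
  have hJ : 0 ≤ J := integral_nonneg fun _ => sq_nonneg _
  have hh := P.h_pos
  have hhi := inv_pos.2 hh
  have h4 : Q ≤ P.h⁻¹ * (2 * c * A) := by
    rw [← div_eq_inv_mul, le_div_iff₀ hh]
    linarith
  have h5 : A * A ≤ (2 * c * (P.h⁻¹ * J)) * A := by
    calc A * A = A ^ 2 := by ring
      _ ≤ Q * J := h2
      _ ≤ P.h⁻¹ * (2 * c * A) * J := mul_le_mul_of_nonneg_right h4 hJ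
      _ = _ := by ring
  rcases hA0.eq_or_lt with h0 | h0
  · rw [← h0]
    positivity
  · exact le_of_mul_le_mul_right h5 h0

end InterfaceProblem

/-! ### The stabilized form -/

namespace InterfaceProblem

variable {n : ℕ} {P : InterfaceProblem n} {T : Finset (Sp (n + 1))} {i : Fin 2} {k : ℕ}
  {u v w : Sp (n + 1) → ℝ}

/-- In this form of `A^*` the first argument occurs without its lifting. -/
theorem Astar_eq (hu : P.MemH1Sub u) (v : Sp (n + 1) → ℝ) : P.Astar k u v =
    P.a u v + P.Nc u v + P.Nc v u + 2 * P.Nc (P.lift k v) u + P.Ns1 u v := by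
  rw [Astar, Ann, a_lift hu.memLp_jump (P.isBrokenPoly_lift k v)]

theorem Astar_comm (u v : Sp (n + 1) → ℝ) : P.Astar k u v = P.Astar k v u := by
  rw [Astar, Ann, Astar, Ann, P.a_comm u v, P.a_comm (P.lift k u), Ns1_comm]
  ring

theorem Astar_smul_add (hu : P.MemH1Sub u) (hv : P.MemH1Sub v) (hw : P.MemH1Sub w)
    (fu : P.HasFlux u) (fv : P.HasFlux v) (fw : P.HasFlux w) (r : ℝ) :
    P.Astar k (r • u + v) w = r * P.Astar k u w + P.Astar k v w := by
  rw [Astar_eq hu, Astar_eq hv, Astar_eq (hu.smul_add hv r),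
    fu.toIsBroken.a_smul_add fv.toIsBroken fw.toIsBroken, fu.Nc_smul_add fv hw.memLp_jump,
    fw.Nc_smul_add_right hu hv, (P.isBrokenPoly_lift k w).hasFlux.Nc_smul_add_right hu hv,
    hu.Ns1_smul_add hv hw]
  ring

/-- On `V_h` the consistency terms are `2 a(𝓛(u), u)`. Hence the form `A^{nn}(u, u)` is
`a(u, u) / 2 + a(u + 2 𝓛(u), u + 2 𝓛(u)) / 2`. -/
theorem half_a_le_Ann (hu : P.MemVh k u) : 1 / 2 * P.a u u ≤ P.Ann k u u := by
  have hL := (P.isBrokenPoly_lift k u).hasFlux.toIsBroken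
  have h1 : P.a (P.lift k u) u = P.Nc u u := a_lift hu.memH1Sub.memLp_jump hu.isBrokenPoly
  have h2 := P.a_nonneg ((2 : ℝ) • P.lift k u + u)
  rw [hL.a_smul_add_self hu.hasFlux.toIsBroken, h1] at h2
  rw [Ann]
  linarith

theorem normA_sq (u : Sp (n + 1) → ℝ) : P.normA u ^ 2 = P.a u u + P.Ns1 u u :=
  Real.sq_sqrt (add_nonneg (P.a_nonneg u) (Ns1_nonneg u))

theorem normA_nonneg (u : Sp (n + 1) → ℝ) : 0 ≤ P.normA u := Real.sqrt_nonneg _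

theorem strongNorm_sq (hu : P.HasFlux u) (β : Fin 2 → ℝ) : P.strongNorm β u ^ 2 =
    P.a u u + P.Ns1 u u + P.h * ∫ x, ‖P.avg β u x‖ ^ 2 ∂P.surf := by
  rw [strongNorm, hu.sum_avgGrad, normA_sq, Real.sq_sqrt]
  exact add_nonneg (add_nonneg (P.a_nonneg u) (Ns1_nonneg u))
    (mul_nonneg P.h_pos.le (integral_nonneg fun _ => sq_nonneg _))

theorem strongNorm_nonneg (β : Fin 2 → ℝ) (u : Sp (n + 1) → ℝ) : 0 ≤ P.strongNorm β u :=
  Real.sqrt_nonneg _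

theorem normA_le_strongNorm (hu : P.HasFlux u) (β : Fin 2 → ℝ) :
    P.normA u ≤ P.strongNorm β u := by
  rw [← sq_le_sq₀ (normA_nonneg u) (strongNorm_nonneg β u)]
  rw [normA_sq, strongNorm_sq hu]
  exact le_add_of_nonneg_right (mul_nonneg P.h_pos.le (integral_nonneg fun _ => sq_nonneg _))

/-- Norm equivalence on `V_h`, for averages with coefficients `β` that are at most `M α` in absolute
value. -/
theorem strongNorm_le {c : ℝ} (hc : 0 < c) (hs : P.StableWeighting k c) (hu : P.MemVh k u)
    {β : Fin 2 → ℝ} {M : ℝ} (hβ : ∀ i, β i ^ 2 ≤ M ^ 2 * P.alpha i ^ 2)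
    {D : ℝ} (hD0 : 0 ≤ D) (hD : 1 + 2 * c * M ^ 2 ≤ D ^ 2) :
    P.strongNorm β u ≤ D * P.normA u := by
  rw [← sq_le_sq₀ (strongNorm_nonneg β u) (mul_nonneg hD0 (normA_nonneg u))]
  rw [strongNorm_sq hu.hasFlux, mul_pow, normA_sq]
  have h1 := hs.avg_le hu.isBrokenPoly hβ
  have h2 := P.a_nonneg u
  have h3 := Ns1_nonneg (P := P) u
  have h4 : 0 ≤ 2 * c * M ^ 2 := by positivity
  nlinarith [mul_le_mul_of_nonneg_right hD (add_nonneg h2 h3), mul_nonneg h4 h3]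

theorem abs_le_of_sq_le {x a b A B : ℝ} (h : x ^ 2 ≤ a * b) (ha0 : 0 ≤ a)
    (hA : 0 ≤ A) (hB : 0 ≤ B) (ha : a ≤ A ^ 2) (hb : b ≤ B ^ 2) : |x| ≤ A * B := by
  refine abs_le_of_sq_le_sq (h.trans ?_) (mul_nonneg hA hB)
  rw [mul_pow]
  exact (mul_le_mul_of_nonneg_left hb ha0).trans (mul_le_mul_of_nonneg_right ha (sq_nonneg _))

/-- Continuity: each of the five terms of `A^*` is estimated by the Cauchy–Schwarz inequality, the
lifting term in combination with the stability of the lifting. -/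
theorem abs_Astar_le {c : ℝ} (hc : 0 < c) (hs : P.StableWeighting k c) (hu : P.MemH1Sub u)
    (hv : P.MemH1Sub v) (fu : P.HasFlux u) (fv : P.HasFlux v) :
    |P.Astar k u v| ≤ (4 + 4 * c) * P.strongNorm P.alpha u * P.strongNorm P.alpha v := by
  have au := P.a_nonneg u
  have av := P.a_nonneg v
  have ju := Ns1_nonneg (P := P) u
  have jv := Ns1_nonneg (P := P) v
  have su := strongNorm_sq fu P.alpha
  have sv := strongNorm_sq fv P.alpha
  have su0 := strongNorm_nonneg (P := P) P.alpha u
  have sv0 := strongNorm_nonneg (P := P) P.alpha v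
  have hh := P.h_pos
  set U := P.strongNorm P.alpha u
  set V := P.strongNorm P.alpha v
  have fu0 : 0 ≤ P.h * ∫ x, ‖P.avg P.alpha u x‖ ^ 2 ∂P.surf :=
    mul_nonneg hh.le (integral_nonneg fun _ => sq_nonneg _)
  have fv0 : 0 ≤ P.h * ∫ x, ‖P.avg P.alpha v x‖ ^ 2 ∂P.surf :=
    mul_nonneg hh.le (integral_nonneg fun _ => sq_nonneg _)
  have b1 : |P.a u v| ≤ U * V :=
    abs_le_of_sq_le (fu.toIsBroken.sq_a_le fv.toIsBroken) au su0 sv0 (by linarith) (by linarith)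
  have nc : ∀ {u v}, P.HasFlux u → P.MemH1Sub v → P.Nc u v ^ 2 ≤
      (P.h * ∫ x, ‖P.avg P.alpha u x‖ ^ 2 ∂P.surf) * P.Ns1 v v := by
    intro u v fu hv
    refine (fu.sq_Nc_le hv.memLp_jump).trans_eq ?_
    rw [Ns1_self]
    field_simp
  have b2 : |P.Nc u v| ≤ U * V :=
    abs_le_of_sq_le (nc fu hv) fu0 su0 sv0 (by linarith) (by linarith)
  have b3 : |P.Nc v u| ≤ U * V := by
    rw [mul_comm]
    exact abs_le_of_sq_le (nc fv hu) fv0 sv0 su0 (by linarith) (by linarith)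
  have b4 : |P.Ns1 u v| ≤ U * V :=
    abs_le_of_sq_le (hu.sq_Ns1_le hv) ju su0 sv0 (by linarith) (by linarith)
  have lu := a_lift_self_le hc hs hu.memLp_jump
  have lv := a_lift_self_le hc hs hv.memLp_jump
  have b5 : |P.a (P.lift k u) (P.lift k v)| ≤ 2 * c * (U * V) := by
    have h1 := (P.isBrokenPoly_lift k u).hasFlux.toIsBroken.sq_a_le
      (P.isBrokenPoly_lift k v).hasFlux.toIsBroken
    refine abs_le_of_sq_le_sq (h1.trans ?_) (by positivity)
    have l1 : P.a (P.lift k u) (P.lift k u) ≤ 2 * c * U ^ 2 :=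
      lu.trans (mul_le_mul_of_nonneg_left (by linarith) (by positivity))
    have l2 : P.a (P.lift k v) (P.lift k v) ≤ 2 * c * V ^ 2 :=
      lv.trans (mul_le_mul_of_nonneg_left (by linarith) (by positivity))
    refine (mul_le_mul l1 l2 (P.a_nonneg _) (by positivity)).trans_eq ?_
    ring
  rw [Astar, Ann, abs_le]
  rw [abs_le] at b1 b2 b3 b4 b5
  constructor <;> linarith [b1.1, b1.2, b2.1, b2.2, b3.1, b3.2, b4.1, b4.2, b5.1, b5.2]

/-! ### Consistency -/

/-- Green's formula on a sub-domain, for a function in `V_reg` and a function in `V_h`. -/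
theorem MemVreg.green (hu : P.MemVreg u) (hv : P.MemVh k v) (i : Fin 2) :
    (∫ x in P.sub i, inner ℝ (P.grad u x) (P.grad v x)) +
      ∫ x in P.sub i, weakLaplacian (P.sub i) u x * v x =
      ∫ x, side i * inner ℝ (trace (P.sub i) (P.grad u) x) (P.normal x) *
        trace (P.sub i) v x ∂P.surf := by
  obtain ⟨w, K, hK, hw, hvw⟩ := hv.exists_lipschitz i
  have hm := (P.isOpen_sub i).measurableSet
  have hvae : ∀ᵐ x ∂volume.restrict (P.sub i), w x = v x := by
    filter_upwards [ae_restrict_mem hm] with x hx using (hvw x hx).symm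
  -- the weak gradient of `v` is the gradient of the Lipschitz function
  have hgv : ∀ᵐ x ∂volume.restrict (P.sub i), P.grad v x = gradient w x := by
    filter_upwards [hv.memH1Sub.grad_ae_eq i, ((hasWeakGrad_of_lipschitz hK (P.sub i)).congr hvae
      (ae_of_all _ fun _ => rfl)).weakGrad_ae_eq (P.isOpen_sub i)] with x h1 h2
    rw [h1, h2]
  have hgu := hu.memH1Sub.grad_ae_eq i
  -- on the interface, the trace of `v` is the value of the Lipschitz function
  have htv : ∀ᵐ x ∂P.surf, trace (P.sub i) v x = w x := by
    filter_upwards [P.surf_ae_mem_Gam] with x hx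
    refine (hasTrace_of_continuous (P.isOpen_sub i)
      (frontier_subset_closure (P.Gam_subset_frontier i hx)) univ_mem hK.continuous ?_).trace_eq
    rw [univ_inter]
    exact hvae.mono fun y hy => hy.symm
  set e : Fin (n + 1) → Sp (n + 1) := fun j => EuclideanSpace.single j 1 with he
  have ie : ∀ (G : Sp (n + 1)) j, (inner ℝ G (e j) : ℝ) = G j := fun G j => by
    simp [he, EuclideanSpace.inner_single_right]
  obtain ⟨M, hM⟩ := hK.continuous.bounded_above_of_compact_support
    (P.hasCompactSupport_of_eq_zero hw)
  have hM0 : 0 ≤ M := (norm_nonneg _).trans (hM 0)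
  have ibp := fun j => P.integral_by_parts ((hu i).2 j).1 ((hu i).2 j).hasWeakGrad
    (((hu i).2 j).memLp_weakGrad (P.isOpen_sub i)) (e j) hK hw
  have i1 : ∀ j, IntegrableOn (fun x => weakGrad (P.sub i) u x j * fderiv ℝ w x (e j))
      (P.sub i) := fun j =>
    Integrable.mul_bdd (c := K * ‖e j‖) (((hu i).2 j).1.integrable (by norm_num))
      (measurable_fderiv_apply_const ℝ w (e j)).aestronglyMeasurable
      (ae_of_all _ fun x => ((fderiv ℝ w x).le_opNorm _).trans
        (mul_le_mul_of_nonneg_right (norm_fderiv_le_of_lipschitz ℝ hK) (norm_nonneg _)))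
  have i2 : ∀ j, IntegrableOn (fun x => w x *
      inner ℝ (weakGrad (P.sub i) (fun y => weakGrad (P.sub i) u y j) x) (e j)) (P.sub i) :=
    fun j => Integrable.bdd_mul (c := M)
      (((((hu i).2 j).memLp_weakGrad (P.isOpen_sub i)).inner_const (e j)).integrable
        (by norm_num)) hK.continuous.aestronglyMeasurable (ae_of_all _ hM)
  have i3 : ∀ j, Integrable (fun x => trace (P.sub i) (fun y => weakGrad (P.sub i) u y j) x *
      (w x * inner ℝ (outerNormal (P.sub i) x) (e j))) P.surf := fun j => by
    refine Integrable.mul_bdd (c := M * ‖e j‖)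
      ((P.memLp_trace_of_memH1 ((hu i).2 j)).integrable (by norm_num)) ?_ ?_
    · exact hK.continuous.aestronglyMeasurable.mul
        ((P.aestronglyMeasurable_outerNormal i).inner_const)
    · filter_upwards [P.ae_isOuterNormal i] with x hx
      rw [norm_mul]
      refine mul_le_mul (hM x) ?_ (norm_nonneg _) hM0
      have := norm_inner_le_norm (𝕜 := ℝ) (outerNormal (P.sub i) x) (e j)
      rwa [hx.1, one_mul] at this
  have s1 : ∫ x in P.sub i, inner ℝ (P.grad u x) (P.grad v x) =
      ∑ j, ∫ x in P.sub i, weakGrad (P.sub i) u x j * fderiv ℝ w x (e j) := by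
    rw [← integral_finsetSum _ fun j _ => i1 j]
    refine integral_congr_ae ?_
    filter_upwards [hgu, hgv] with x h1 h2
    rw [h1, h2, PiLp.inner_apply]
    refine Finset.sum_congr rfl fun j _ => ?_
    have : gradient w x j = fderiv ℝ w x (e j) := by
      rw [← ie, gradient, InnerProductSpace.toDual_symm_apply]
    rw [this]
    simp [mul_comm]
  have s2 : ∫ x in P.sub i, weakLaplacian (P.sub i) u x * v x =
      ∑ j, ∫ x in P.sub i, w x *
        inner ℝ (weakGrad (P.sub i) (fun y => weakGrad (P.sub i) u y j) x) (e j) := by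
    rw [← integral_finsetSum _ fun j _ => i2 j]
    refine integral_congr_ae ?_
    filter_upwards [hvae] with x hx
    simp only [ie, weakLaplacian]
    rw [← hx, ← Finset.mul_sum, mul_comm]
  have s3 : ∫ x, side i * inner ℝ (trace (P.sub i) (P.grad u) x) (P.normal x) *
        trace (P.sub i) v x ∂P.surf =
      ∑ j, ∫ x, trace (P.sub i) (fun y => weakGrad (P.sub i) u y j) x *
        (w x * inner ℝ (outerNormal (P.sub i) x) (e j)) ∂P.surf := by
    rw [← integral_finsetSum _ fun j _ => i3 j]
    refine integral_congr_ae ?_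
    filter_upwards [htv, hu.hasTrace_grad i, P.ae_outerNormal_eq i] with x h1 h2 h3
    rw [h1, h2.trace_eq, h3, PiLp.inner_apply, Finset.mul_sum, Finset.sum_mul]
    refine Finset.sum_congr rfl fun j _ => ?_
    rw [ie]
    simp
    ring
  rw [s1, s2, s3, ← Finset.sum_add_distrib]
  exact Finset.sum_congr rfl fun j _ => ibp j

theorem MemVreg.memLp_weakLaplacian (hu : P.MemVreg u) (i : Fin 2) :
    MemLp (weakLaplacian (P.sub i) u) 2 (volume.restrict (P.sub i)) := by
  refine memLp_finsetSum _ fun j _ => ?_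
  have h := (((hu i).2 j).memLp_weakGrad (P.isOpen_sub i)).inner_const (𝕜 := ℝ)
    (EuclideanSpace.single j (1 : ℝ))
  refine h.ae_eq (ae_of_all _ fun x => ?_)
  simp [EuclideanSpace.inner_single_right]

/-- Consistency: without a jump of `u`, only `a(u, v) + N^c(u, v)` remains of `A^*(u, v)`. Summing
Green's formula over the sub-domains produces the interface integral of the flux times `⟦v⟧`,
which is cancelled by `N^c(u, v)` because the flux of `u` agrees with its weighted average. -/
theorem IsSolution.Astar_eq {f : Sp (n + 1) → ℝ} (hu : P.IsSolution f u) (hv : P.MemVh k v) :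
    P.Astar k u v = ∫ x in P.Om, f x * v x := by
  have hr := hu.memVreg
  have fu := hr.hasFlux
  have fv := hv.hasFlux
  have h1 := hr.memH1Sub
  have z1 : ∀ w, P.Nc w u = 0 := fun w => Finset.sum_eq_zero fun T _ =>
    integral_eq_zero_of_ae (ae_restrict_of_ae (hu.jump_zero.mono fun x hx => by simp [hx]))
  have z2 : P.Ns1 u v = 0 := by
    rw [Ns1, integral_eq_zero_of_ae (hu.jump_zero.mono fun x hx => by simp [hx]), mul_zero]
  rw [InterfaceProblem.Astar_eq h1, z1, z1, z2]
  -- the energy inner product is a sum over the sub-domains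
  have ea : P.a u v = ∑ i, P.alpha i * ∫ x in P.sub i, inner ℝ (P.grad u x) (P.grad v x) := by
    simp only [a, aT]
    rw [Finset.sum_comm]
    refine Finset.sum_congr rfl fun i _ => ?_
    rw [P.setIntegral_sub_eq_sum, Finset.mul_sum]
    have hl : ∀ {w}, P.HasFlux w → MemLp (P.grad w) 2 (volume.restrict (P.sub i)) := fun hw => by
      refine MemLp.mono_measure (Measure.restrict_mono (P.sub_subset i) le_rfl) ?_
      have := hw.memLp_grad
      rwa [P.restrict_dom] at this
    exact integrable_inner_of_memLp (hl fu) (hl fv)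
  have ef : ∀ i, ∫ x in P.sub i, f x * v x =
      -(P.alpha i * ∫ x in P.sub i, weakLaplacian (P.sub i) u x * v x) := fun i => by
    rw [← integral_const_mul, ← integral_neg]
    refine integral_congr_ae ?_
    filter_upwards [hu.pde i] with x hx
    rw [← hx]
    ring
  have hf : ∀ i, IntegrableOn (fun x => f x * v x) (P.sub i) := fun i => by
    have : Integrable (fun x => -P.alpha i * weakLaplacian (P.sub i) u x * v x)
        (volume.restrict (P.sub i)) :=
      integrable_mul_of_memLp ((hr.memLp_weakLaplacian i).const_mul _) (hv.memH1Sub i).1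
    refine this.congr ?_
    filter_upwards [hu.pde i] with x hx
    rw [hx]
  rw [P.setIntegral_Om_eq_sum hf, ea]
  simp only [Fin.sum_univ_two, ef]
  have g0 := hr.green hv 0
  have g1 := hr.green hv 1
  -- by the continuity of the flux, the boundary terms cancel the consistency term
  have hflux : P.alpha 0 * (∫ x, side 0 * inner ℝ (trace (P.sub 0) (P.grad u) x) (P.normal x) *
        trace (P.sub 0) v x ∂P.surf) + P.alpha 1 * (∫ x, side 1 *
        inner ℝ (trace (P.sub 1) (P.grad u) x) (P.normal x) * trace (P.sub 1) v x ∂P.surf) =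
      -P.Nc u v := by
    have it : ∀ i, Integrable (fun x => side i * inner ℝ (trace (P.sub i) (P.grad u) x)
        (P.normal x) * trace (P.sub i) v x) P.surf := fun i => by
      refine integrable_mul_of_memLp (MemLp.const_mul ?_ _)
        (P.memLp_trace_of_memH1 (hv.memH1Sub i))
      refine (fu.memLp_trace i).of_le ((fu.memLp_trace i).1.inner P.aestronglyMeasurable_normal) ?_
      filter_upwards [P.ae_norm_normal] with x hx
      refine (norm_inner_le_norm _ _).trans ?_
      rw [hx, mul_one]
    rw [fu.Nc_eq hv.memH1Sub.memLp_jump, ← integral_const_mul, ← integral_const_mul,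
      ← integral_add ((it 0).const_mul _) ((it 1).const_mul _), ← integral_neg]
    refine integral_congr_ae ?_
    filter_upwards [hu.flux_zero, P.surf_ae_mem_openElt] with x hx hxT
    obtain ⟨T, hT, hxT⟩ := hxT
    have hk := P.kappa_sum T (P.mem_elements.1 hT).1 (P.mem_elements.1 hT).2
    rw [avg_eq P.alpha u hT hxT, avgGrad, Fin.sum_univ_two, inner_add_left, real_inner_smul_left,
      real_inner_smul_left, jump]
    simp only [side, if_true, one_ne_zero, if_false]
    set q₀ := inner ℝ (trace (P.sub 0) (P.grad u) x) (P.normal x)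
    set q₁ := inner ℝ (trace (P.sub 1) (P.grad u) x) (P.normal x)
    have hk1 : P.kappa T 1 = 1 - P.kappa T 0 := by linarith
    have hq : P.alpha 1 * q₁ = P.alpha 0 * q₀ := by linarith
    rw [hk1]
    linear_combination (-(trace (P.sub 1) v x) - (1 - P.kappa T 0) *
      (trace (P.sub 0) v x - trace (P.sub 1) v x)) * hq
  have e0 := congrArg (fun t => P.alpha 0 * t) g0
  have e1 := congrArg (fun t => P.alpha 1 * t) g1
  simp only [mul_add] at e0 e1
  linarith

end InterfaceProblem

end UnfittedNitsche

end

theorem mainTheorem4 (c : ℝ) (hc : 0 < c) :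
    ∃ C : ℝ, 0 < C ∧ ∀ (n k : ℕ) (P : InterfaceProblem n), P.StableWeighting k c →
      -- functions in `H¹(Ω₁ ∪ Ω₂)` have traces on the interface, with a square-integrable jump
      (∀ u, P.MemH1Sub u →
        (∀ᵐ x ∂P.surf, ∀ i, ∃ g, HasTrace (P.sub i) u x g) ∧ MemLp (P.jump u) 2 P.surf) ∧
      -- the local lifting is well-defined
      (∀ T ∈ P.elements, P.IsCut T → ∀ u,
        MemLp (P.jump u) 2 (P.surf.restrict (InterfaceProblem.openElt T)) →
          P.IsLocalLift k T u (P.localLift k T u) ∧ ∃! w, P.IsLocalLift k T u w) ∧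
      -- the lifting represents `N^c`
      (∀ u v, P.MemH1Sub u → P.MemVh k v → P.a (P.lift k u) v = P.Nc v u) ∧
      -- stability of the lifting
      (∀ u, P.MemH1Sub u →
        P.a (P.lift k u) (P.lift k u) ≤ C * (P.h⁻¹ * ∫ x, P.jump u x ^ 2 ∂P.surf)) ∧
      -- the lifting vanishes on functions without a jump
      (∀ u, (∀ᵐ x ∂P.surf, P.jump u x = 0) → P.lift k u = 0) ∧
      -- `A^*` and the norms are well-defined on `V_h + V_reg`
      (∀ u, P.MemSum k u →
        P.MemH1Sub u ∧
        MemLp (P.grad u) 2 (volume.restrict P.Om) ∧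
        MemLp (P.grad (P.lift k u)) 2 (volume.restrict P.Om) ∧
        (∀ᵐ x ∂P.surf, ∀ i, ∃ g, HasTrace (P.sub i) (P.grad u) x g) ∧
        ∀ i, MemLp (trace (P.sub i) (P.grad u)) 2 P.surf) ∧
      -- `A^*` is a symmetric bilinear form on `V_h + V_reg`
      (∀ u v w, P.MemSum k u → P.MemSum k v → P.MemSum k w → ∀ r : ℝ,
        P.Astar k (r • u + v) w = r * P.Astar k u w + P.Astar k v w ∧
        P.Astar k u w = P.Astar k w u) ∧
      -- non-negativity
      (∀ u, P.MemVh k u → 0 ≤ P.a u u ∧ 1 / 2 * P.a u u ≤ P.Ann k u u) ∧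
      -- coercivity
      (∀ u, P.MemVh k u → 1 / 2 * P.normA u ^ 2 ≤ P.Astar k u u) ∧
      -- norm equivalence
      (∀ u, P.MemVh k u →
        P.normA u ≤ P.strongNorm P.alpha u ∧ P.strongNorm P.alpha u ≤ C * P.normA u) ∧
      -- norm equivalence for the variant of the strong norm without diffusion coefficients
      (∀ u, P.MemVh k u →
        P.normA u ≤ P.strongNorm 1 u ∧
        P.strongNorm 1 u ≤ C * (1 + (min (P.alpha 0) (P.alpha 1))⁻¹) * P.normA u) ∧
      -- continuity
      (∀ u v, P.MemSum k u → P.MemSum k v →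
        |P.Astar k u v| ≤ C * P.strongNorm P.alpha u * P.strongNorm P.alpha v) ∧
      -- consistency and Galerkin orthogonality
      (∀ f u, P.IsSolution f u →
        (∀ v, P.MemVh k v → P.Astar k u v = ∫ x in P.Om, f x * v x) ∧
        ∀ uh, P.MemVh k uh →
          (∀ v, P.MemVh k v → P.Astar k uh v = ∫ x in P.Om, f x * v x) →
          ∀ v, P.MemVh k v → P.Astar k (u - uh) v = 0) := by
  -- The constant has to dominate `2 c` (stability of the lifting), `(1 + 2 c)^{1/2}` (norm
  -- equivalence) and `4 + 4 c` (continuity).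
  refine ⟨5 + 4 * c, by linarith, fun n k P hs => ?_⟩
  refine ⟨?_, ?_, ?_, ?_, ?_, ?_, ?_, ?_, ?_, ?_, ?_, ?_, ?_⟩
  · refine fun u hu => ⟨?_, InterfaceProblem.MemH1Sub.memLp_jump hu⟩
    filter_upwards [ae_all_iff.2 fun i => P.ae_hasTrace_of_memH1 (hu i)] with x hx i
      using ⟨_, hx i⟩
  · exact fun T hT hcut u hj => ⟨InterfaceProblem.isLocalLift_localLift hT hcut hj,
      InterfaceProblem.existsUnique_isLocalLift hT hj⟩
  · exact fun u v hu hv => InterfaceProblem.a_lift (InterfaceProblem.MemH1Sub.memLp_jump hu)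
      (InterfaceProblem.MemVh.isBrokenPoly hv)
  · intro u hu
    have h1 := InterfaceProblem.a_lift_self_le hc hs (InterfaceProblem.MemH1Sub.memLp_jump hu)
    have h2 := InterfaceProblem.Ns1_nonneg (P := P) u
    rw [← InterfaceProblem.Ns1_self]
    nlinarith
  · exact fun u hu => InterfaceProblem.lift_eq_zero hu
  · intro u hu
    have fu := InterfaceProblem.MemSum.hasFlux hu
    refine ⟨InterfaceProblem.MemSum.memH1Sub hu, ?_, ?_, ?_, fu.memLp_trace⟩
    · rw [← P.restrict_dom]
      exact fu.memLp_grad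
    · rw [← P.restrict_dom]
      exact (P.isBrokenPoly_lift k u).hasFlux.memLp_grad
    · filter_upwards [ae_all_iff.2 fu.hasTrace] with x hx i using ⟨_, hx i⟩
  · exact fun u v w hu hv hw r => ⟨InterfaceProblem.Astar_smul_add
      (InterfaceProblem.MemSum.memH1Sub hu) (InterfaceProblem.MemSum.memH1Sub hv)
      (InterfaceProblem.MemSum.memH1Sub hw) (InterfaceProblem.MemSum.hasFlux hu)
      (InterfaceProblem.MemSum.hasFlux hv) (InterfaceProblem.MemSum.hasFlux hw) r,
      InterfaceProblem.Astar_comm u w⟩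
  · exact fun u hu => ⟨P.a_nonneg u, InterfaceProblem.half_a_le_Ann hu⟩
  · intro u hu
    have h1 := InterfaceProblem.half_a_le_Ann hu
    have h2 := InterfaceProblem.Ns1_nonneg (P := P) u
    rw [InterfaceProblem.normA_sq, InterfaceProblem.Astar]
    linarith
  · refine fun u hu => ⟨InterfaceProblem.normA_le_strongNorm
      (InterfaceProblem.MemVh.hasFlux hu) _, ?_⟩
    refine InterfaceProblem.strongNorm_le hc hs hu (M := 1) (fun i => by simp) (by linarith) ?_
    nlinarith
  · refine fun u hu => ⟨InterfaceProblem.normA_le_strongNorm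
      (InterfaceProblem.MemVh.hasFlux hu) _, ?_⟩
    -- the coefficients `1` are at most `m⁻¹ α` for the minimum `m` of the diffusion coefficients
    set m := min (P.alpha 0) (P.alpha 1) with hm
    have hm0 : 0 < m := lt_min (P.alpha_pos 0) (P.alpha_pos 1)
    have hmi : 0 < m⁻¹ := inv_pos.2 hm0
    refine InterfaceProblem.strongNorm_le hc hs hu (M := m⁻¹) (fun i => ?_) (by positivity) ?_
    · have h1 : m ≤ P.alpha i := by
        fin_cases i
        · exact min_le_left _ _
        · exact min_le_right _ _
      rw [← mul_pow, Pi.one_apply]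
      refine pow_le_pow_left₀ zero_le_one ?_ 2
      rwa [← div_eq_inv_mul, one_le_div hm0]
    · have h1 : 1 ≤ (5 + 4 * c) ^ 2 := by nlinarith
      have h2 : 2 * c ≤ (5 + 4 * c) ^ 2 := by nlinarith
      calc 1 + 2 * c * m⁻¹ ^ 2 ≤ (5 + 4 * c) ^ 2 + (5 + 4 * c) ^ 2 * m⁻¹ ^ 2 := by gcongr
        _ ≤ ((5 + 4 * c) * (1 + m⁻¹)) ^ 2 := by
          have : 0 ≤ (5 + 4 * c) ^ 2 * (2 * m⁻¹) := by positivity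
          nlinarith
  · intro u v hu hv
    refine (InterfaceProblem.abs_Astar_le hc hs (InterfaceProblem.MemSum.memH1Sub hu)
      (InterfaceProblem.MemSum.memH1Sub hv) (InterfaceProblem.MemSum.hasFlux hu)
      (InterfaceProblem.MemSum.hasFlux hv)).trans ?_
    have h1 := InterfaceProblem.strongNorm_nonneg (P := P) P.alpha u
    have h2 := InterfaceProblem.strongNorm_nonneg (P := P) P.alpha v
    gcongr
    norm_num
  · refine fun f u hu => ⟨fun v hv => hu.Astar_eq hv, fun uh huh hsol v hv => ?_⟩
    have h := InterfaceProblem.Astar_smul_add (k := k) (InterfaceProblem.MemVh.memH1Sub huh)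
      (InterfaceProblem.MemVreg.memH1Sub hu.memVreg) (InterfaceProblem.MemVh.memH1Sub hv)
      (InterfaceProblem.MemVh.hasFlux huh) (InterfaceProblem.MemVreg.hasFlux hu.memVreg)
      (InterfaceProblem.MemVh.hasFlux hv) (-1)
    have e : u - uh = (-1 : ℝ) • uh + u := by
      rw [neg_one_smul, neg_add_eq_sub]
    rw [e, h, hsol v hv, hu.Astar_eq hv]
    ring
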